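/- Let $F\in\mathbb C\{x\}[y]$ be an irreducible Weierstrass polynomial of degree and multiplicity $n$ with tangent cone $y=0$, and let $\varphi(t)=(t^{n},\sum_{k\ge\beta_1}c_kt^k)$ be a primitive Puiseux parametrization of the branch $\mathcal C_F=\{F=0\}$, whose second component starts at its first characteristic exponent. Put $\beta_0=e_0=n$ and, as long as $e_{j-1}>1$, $\beta_j=\min\{k: e_{j-1}\nmid k,\ c_k\ne0\}$ and $e_j=\gcd(e_{j-1},\beta_j)$; let $g$ be the index with $e_g=1$. Put $v_0=n$, $v_1=\beta_1$ and $v_j=\frac{e_{j-2}}{e_{j-1}}v_{j-1}+\beta_j-\beta_{j-1}$ for $2\le j\le g$. For $G\in\mathbb C\{x,y\}$ let $I(F,G)=\operatorname{ord}_tG(\varphi(t))\in\mathbb N\cup\{\infty\}$ be the intersection multiplicity. The canonical semiroots are $F_0=x$ and, for $1\le j\le g$, with $m_j=n/e_{j-1}$ and $\eta_j(t)=\sum_{k<\beta_j}c_kt^{k/e_{j-1}}$, $$F_j=\prod_{\alpha^{m_j}=1}\bigl(y-\eta_j(\alpha x^{1/m_j})\bigr)\in\mathbb C\{x\}[y].$$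 Put $\omega_{ig}=v_iF_i\,dF_g-v_gF_g\,dF_i$. Let $G(\mathcal C_F)$ be the dual graph of the canonical (minimal) embedded resolution of $\mathcal C_F$; its vertices are the components of the exceptional divisor together with one for the strict transform of $\mathcal C_F$. Let $T_g$ be its last triple point (the vertex of valence three, among the components, that is created last), and $E_{T_g}$ the corresponding component. A foliation $\mathcal F_\omega$ is dicritical at $T_g$ if its strict transform is generically transversal to $E_{T_g}$, i.e. if $E_{T_g}$ is not invariant. A branch with parametrization $\psi$ is a separatrix of $\mathcal F_\omega$ if $\psi^*\omega=0$. **Theorem.** Let $0\le i<g$, and let $H_1,H_2\in\mathbb C\{x\}[y]$ with $\deg_yH_1,\deg_yH_2<v_0$, $H_1\ne0$ and $H_2(0,0)=0$. Suppose that $\omega=H_1\omega_{ig}+dH_2=A\,dx+B\,dy$ defines a singular foliation $\mathcal F_\omega$, i.e. $A(0,0)=B(0,0)=0$ and $\gcd(A,B)=1$ in $\mathbb C\{x,y\}$. Then $\mathcal F_\omega$ is dicritical at $T_g$ if and only if $$I(F,H_1)+v_i+v_g<I(F,H_2).$$ Moreover, in that case there are rational functions $s_j\in\mathbb C(u)$,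 $j>\beta_g$, without poles in $\mathbb C^*$, such that for every $u\in\mathbb C^*$ the series $$\psi_u(t)=\Bigl(t^{\beta_0},\ \sum_{\beta_1\le j<\beta_g}c_jt^j+u\,t^{\beta_g}+\sum_{j>\beta_g}s_j(u)t^j\Bigr)$$ converges near $t=0$ and parametrizes a separatrix of $\mathcal F_\omega$ whose strict transform intersects $E_{T_g}$ transversally. -/

import Mathlib

open scoped PowerSeries

noncomputable section

namespace PlaneFoliation

/-! ### Convergent power series -/

/-- A one-variable power series has positive radius of convergence. -/
def IsConvergent (f : ℂ⟦X⟧) : Prop :=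
  ∃ r : ℝ, 0 < r ∧ Summable fun k : ℕ => ‖PowerSeries.coeff k f‖ * r ^ k

/-- A power series in `x = X 0`, `y = X 1` converges absolutely near the origin. -/
def IsConvergent₂ (f : MvPowerSeries (Fin 2) ℂ) : Prop :=
  ∃ r : ℝ, 0 < r ∧
    Summable fun m : Fin 2 →₀ ℕ => ‖MvPowerSeries.coeff m f‖ * r ^ (m 0 + m 1)

lemma summable_smaller {f : ℂ⟦X⟧} {r s : ℝ} (hs : 0 ≤ s) (hsr : s ≤ r)
    (h : Summable fun k : ℕ => ‖PowerSeries.coeff k f‖ * r ^ k) :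
    Summable fun k : ℕ => ‖PowerSeries.coeff k f * (s : ℂ) ^ k‖ := by
  refine Summable.of_nonneg_of_le (fun k => norm_nonneg _) (fun k => ?_) h
  rw [norm_mul, norm_pow, Complex.norm_real, Real.norm_of_nonneg hs]
  gcongr

lemma isConvergent_of_finite {f : ℂ⟦X⟧} (h : ∀ k, 1 ≤ k → PowerSeries.coeff k f = 0) :
    IsConvergent f := by
  refine ⟨1, one_pos, summable_of_ne_finset_zero (s := {0}) fun k hk => ?_⟩
  rw [h k (Nat.one_le_iff_ne_zero.2 (by simpa using hk))]
  simp

lemma IsConvergent.add {f g : ℂ⟦X⟧} (hf : IsConvergent f) (hg : IsConvergent g) :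
    IsConvergent (f + g) := by
  obtain ⟨r, hr, hf⟩ := hf
  obtain ⟨s, hs, hg⟩ := hg
  have hm : 0 < min r s := lt_min hr hs
  refine ⟨min r s, hm, Summable.of_nonneg_of_le (fun k => by positivity) (fun k => ?_)
    ((summable_smaller hm.le (min_le_left r s) hf).add
      (summable_smaller hm.le (min_le_right r s) hg))⟩
  simp only [map_add, norm_mul, norm_pow, Complex.norm_real, Real.norm_of_nonneg hm.le]
  rw [← add_mul]
  gcongr
  exact norm_add_le _ _

lemma IsConvergent.neg {f : ℂ⟦X⟧} (hf : IsConvergent f) : IsConvergent (-f) := by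
  obtain ⟨r, hr, hf⟩ := hf
  exact ⟨r, hr, by simpa using hf⟩

lemma IsConvergent.mul {f g : ℂ⟦X⟧} (hf : IsConvergent f) (hg : IsConvergent g) :
    IsConvergent (f * g) := by
  obtain ⟨r, hr, hf⟩ := hf
  obtain ⟨s, hs, hg⟩ := hg
  have hm : 0 < min r s := lt_min hr hs
  refine ⟨min r s, hm, ?_⟩
  have h := summable_norm_sum_mul_antidiagonal_of_summable_norm
    (summable_smaller hm.le (min_le_left r s) hf) (summable_smaller hm.le (min_le_right r s) hg)
  refine h.congr fun k => ?_
  rw [PowerSeries.coeff_mul]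
  have e : ‖((min r s : ℝ) : ℂ) ^ k‖ = (min r s) ^ k := by
    rw [norm_pow, Complex.norm_real, Real.norm_of_nonneg hm.le]
  rw [← e, ← norm_mul, Finset.sum_mul]
  congr 1
  refine Finset.sum_congr rfl fun p hp => ?_
  rw [← (Finset.HasAntidiagonal.mem_antidiagonal.1 hp : p.1 + p.2 = k), pow_add]
  ring

/-- The ring `ℂ{x}` of convergent power series in one variable. -/
def convergentSeries : Subring ℂ⟦X⟧ where
  carrier := {f | IsConvergent f}
  mul_mem' := IsConvergent.mul
  one_mem' := isConvergent_of_finite fun k hk => by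
    rw [PowerSeries.coeff_one, if_neg (by omega)]
  add_mem' := IsConvergent.add
  zero_mem' := isConvergent_of_finite fun k _ => by simp
  neg_mem' := IsConvergent.neg

/-- A polynomial in `y` with coefficients in `ℂ⟦x⟧`, as a power series in `x` and `y`. -/
def toSeries (H : Polynomial ℂ⟦X⟧) : MvPowerSeries (Fin 2) ℂ :=
  fun m => PowerSeries.coeff (m 0) (H.coeff (m 1))

/-- An element of `ℂ{x}[y]`, as a power series in `x` and `y`. -/
def ofConv (H : Polynomial convergentSeries) : MvPowerSeries (Fin 2) ℂ :=
  toSeries (H.map convergentSeries.subtype)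

/-! ### One-forms and parametrized curves -/

/-- `(A, B)` stands for the one-form `A dx + B dy`. -/
abbrev OneForm := MvPowerSeries (Fin 2) ℂ × MvPowerSeries (Fin 2) ℂ

/-- The differential of a function. -/
def d (G : MvPowerSeries (Fin 2) ℂ) : OneForm :=
  (MvPowerSeries.pderiv ℂ 0 G, MvPowerSeries.pderiv ℂ 1 G)

/-- `A dx + B dy` defines a singular holomorphic foliation: `A` and `B` are convergent, vanish at
the origin, and have no common factor in `ℂ{x,y}` besides units. -/
def IsSingularFoliation (ω : OneForm) : Prop :=
  IsConvergent₂ ω.1 ∧ IsConvergent₂ ω.2 ∧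
  MvPowerSeries.constantCoeff ω.1 = 0 ∧ MvPowerSeries.constantCoeff ω.2 = 0 ∧
  ∀ D A B : MvPowerSeries (Fin 2) ℂ, IsConvergent₂ D → IsConvergent₂ A → IsConvergent₂ B →
    ω.1 = D * A → ω.2 = D * B → MvPowerSeries.constantCoeff D ≠ 0

/-- A parametrized curve `t ↦ (x(t), y(t))`. -/
structure Param where
  x : ℂ⟦X⟧
  y : ℂ⟦X⟧

/-- The pullback `G(x(t), y(t))` of a function. -/
def Param.pull (γ : Param) (G : MvPowerSeries (Fin 2) ℂ) : ℂ⟦X⟧ :=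
  MvPowerSeries.subst ![γ.x, γ.y] G

/-- The coefficient of `dt` in the pullback of a one-form. -/
def Param.pullForm (γ : Param) (ω : OneForm) : ℂ⟦X⟧ :=
  γ.pull ω.1 * PowerSeries.derivative ℂ γ.x + γ.pull ω.2 * PowerSeries.derivative ℂ γ.y

/-- The non-constant analytic curve through the origin parametrized by `γ` is a separatrix
(an invariant curve) of `ω = 0`. -/
def IsSeparatrix (ω : OneForm) (γ : Param) : Prop :=
  IsConvergent γ.x ∧ IsConvergent γ.y ∧
  PowerSeries.constantCoeff γ.x = 0 ∧ PowerSeries.constantCoeff γ.y = 0 ∧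
  ¬ (γ.x = 0 ∧ γ.y = 0) ∧ γ.pullForm ω = 0

/-! ### Characteristic exponents, semigroup generators and semiroots -/

/-- The pair `(β_j, e_j)` of `(t ^ n, ∑ c_k t ^ k)`: `β_0 = e_0 = n`,
`β_{j+1} = min {k | e_j ∤ k, c_k ≠ 0}` and `e_{j+1} = gcd (e_j, β_{j+1})`. -/
def charPair (n : ℕ) (η : ℂ⟦X⟧) : ℕ → ℕ × ℕ
  | 0 => (n, n)
  | j + 1 =>
    let e := (charPair n η j).2
    let b := sInf {k : ℕ | ¬ e ∣ k ∧ PowerSeries.coeff k η ≠ 0}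
    (b, Nat.gcd e b)

/-- The power series `∏_{α ^ m = 1} (y - η(α x^{1/m}))`, written as a polynomial in `y` over `ℂ⟦x⟧`:
the coefficients of `∏_{α ^ m = 1} (y - η(α t))` are power series in `t ^ m = x`. -/
def branchPoly (m : ℕ) (η : ℂ⟦X⟧) : Polynomial ℂ⟦X⟧ :=
  let P : Polynomial ℂ⟦X⟧ := ∏ α ∈ Polynomial.nthRootsFinset m (1 : ℂ),
    (Polynomial.X - Polynomial.C (PowerSeries.rescale α η))
  ∑ j ∈ Finset.range (m + 1),
    Polynomial.monomial j (PowerSeries.mk fun k => PowerSeries.coeff (m * k) (P.coeff j))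

/-- A plane branch: an irreducible Weierstrass polynomial `F ∈ ℂ{x}[y]` of degree and multiplicity
`n` with tangent cone `y = 0`, together with a primitive Puiseux parametrization
`(t ^ n, η(t))` whose second component starts at the first characteristic exponent. -/
structure PlaneBranch where
  n : ℕ
  F : Polynomial convergentSeries
  monic : F.Monic
  natDegree_eq : F.natDegree = n
  tangent : ∀ i, 1 ≤ i → i ≤ n → (i : ℕ∞) < PowerSeries.order (F.coeff (n - i) : ℂ⟦X⟧)
  irreducible : Irreducible F
  η : ℂ⟦X⟧
  convergent : IsConvergent η
  constantCoeff_eq : PowerSeries.constantCoeff η = 0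
  root : Param.pull ⟨PowerSeries.X ^ n, η⟩ (ofConv F) = 0
  primitive : ∀ q : ℕ, q ∣ n → (∀ k, PowerSeries.coeff k η ≠ 0 → q ∣ k) → q = 1
  normalized : ∀ k, PowerSeries.coeff k η ≠ 0 → (charPair n η 1).1 ≤ k

namespace PlaneBranch

variable (C : PlaneBranch)

/-- The Puiseux parametrization of the branch. -/
def param : Param := ⟨PowerSeries.X ^ C.n, C.η⟩

/-- The characteristic exponents `β_j`. -/
def β (j : ℕ) : ℕ := (charPair C.n C.η j).1

/-- `e_j = gcd (β_0, …, β_j)`. -/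
def e (j : ℕ) : ℕ := (charPair C.n C.η j).2

/-- The number `g` of characteristic exponents besides `β_0`. -/
def g : ℕ := sInf {j | C.e j = 1}

/-- `n_0 = 1` and `n_j = e_{j-1} / e_j`. -/
def ratio : ℕ → ℕ
  | 0 => 1
  | j + 1 => C.e j / C.e (j + 1)

/-- The generators of the value semigroup:
`v_0 = n` and `v_{j+1} = n_j v_j + β_{j+1} - β_j` (the `β_j` increase for `j ≤ g`). -/
def v : ℕ → ℕ
  | 0 => C.n
  | j + 1 => C.ratio j * v j + C.β (j + 1) - C.β j

/-- `η_{j+1}(t) = ∑_{k < β_{j+1}} c_k t ^ (k / e_j)`. -/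
def truncated (j : ℕ) : ℂ⟦X⟧ :=
  PowerSeries.mk fun k => if C.e j * k < C.β (j + 1) then PowerSeries.coeff (C.e j * k) C.η else 0

/-- The canonical system of semiroots: `F_0 = x`, `F_i` is the minimal polynomial of
`η_i(x^{e_{i-1} / n})` for `1 ≤ i ≤ g`, and the last one is `F`. -/
def semiroot : ℕ → MvPowerSeries (Fin 2) ℂ
  | 0 => MvPowerSeries.X 0
  | j + 1 =>
    if j + 1 ≤ C.g then toSeries (branchPoly (C.n / C.e j) (C.truncated j)) else ofConv C.F

/-- The intersection multiplicity `I(F, G)`, the order of `G` along the parametrization. -/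
def inter (G : MvPowerSeries (Fin 2) ℂ) : ℕ∞ := (C.param.pull G).order

/-- `ω_{ij} = v_i F_i dF_j - v_j F_j dF_i`. -/
def basicForm (i j : ℕ) : OneForm :=
  ((C.v i : MvPowerSeries (Fin 2) ℂ) * C.semiroot i) • d (C.semiroot j) -
    ((C.v j : MvPowerSeries (Fin 2) ℂ) * C.semiroot j) • d (C.semiroot i)

end PlaneBranch

/-! ### Blowing up the infinitely near points of a branch -/

/-- The quotient `f / h` of power series, for `h ≠ 0` and `ord h ≤ ord f`. -/
def quot (f h : ℂ⟦X⟧) : ℂ⟦X⟧ :=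
  PowerSeries.X ^ (f.order.toNat - h.order.toNat) * f.divXPowOrder * (h.divXPowOrder)⁻¹

/-- A point `P` infinitely near to the origin on a branch, with coordinates `(x, y)` centred at it:
the blow-down map to `ℂ²` in these coordinates, the strict transform of the branch at `P`, and the
indices of the components of the exceptional divisor through `P`, which have the equations
`x = 0` (`divX`) and `y = 0` (`divY`). -/
structure InfPoint where
  mapX : MvPolynomial (Fin 2) ℂ
  mapY : MvPolynomial (Fin 2) ℂ
  curve : Param
  divX : Option ℕ
  divY : Option ℕ

/-- The tangent direction of a parametrized branch: `some c` for the line `y = c x`, and `none`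
for the line `x = 0`. -/
def Param.dir (γ : Param) : Option ℂ :=
  if γ.x.order ≤ γ.y.order then some (PowerSeries.constantCoeff (quot γ.y γ.x)) else none

/-- Blow up the point `P`, creating the component with index `k`, and pass to the point of this
component on the strict transform of the branch. In direction `c` the chart is
`(x, y) ↦ (x, x (y + c))`, with the new component `x = 0`; in the vertical direction the chart is
`(x, y) ↦ (x y, y)`, with the new component `y = 0`. -/
def InfPoint.blowUp (k : ℕ) (P : InfPoint) : InfPoint :=
  match P.curve.dir with
  | some c =>
    let σ : Fin 2 → MvPolynomial (Fin 2) ℂ :=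
      ![MvPolynomial.X 0, MvPolynomial.X 0 * (MvPolynomial.X 1 + MvPolynomial.C c)]
    { mapX := MvPolynomial.bind₁ σ P.mapX
      mapY := MvPolynomial.bind₁ σ P.mapY
      curve := ⟨P.curve.x, quot P.curve.y P.curve.x - PowerSeries.C c⟩
      divX := some k
      divY := open Classical in if c = 0 then P.divY else none }
  | none =>
    let σ : Fin 2 → MvPolynomial (Fin 2) ℂ :=
      ![MvPolynomial.X 0 * MvPolynomial.X 1, MvPolynomial.X 1]
    { mapX := MvPolynomial.bind₁ σ P.mapX
      mapY := MvPolynomial.bind₁ σ P.mapY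
      curve := ⟨quot P.curve.x P.curve.y, P.curve.y⟩
      divX := P.divX
      divY := some k }

/-- The points `P_0 = 0, P_1, P_2, …` infinitely near to the origin on a branch: `P_k` is the
point of the strict transform on the component `E_k` created by blowing up `P_{k-1}`. -/
def infPoint (γ : Param) : ℕ → InfPoint
  | 0 => ⟨MvPolynomial.X 0, MvPolynomial.X 1, γ, none, none⟩
  | k + 1 => (infPoint γ k).blowUp (k + 1)

/-- The strict transform of the component `E_j` passes through `P`. -/
def InfPoint.Through (P : InfPoint) (j : ℕ) : Prop := P.divX = some j ∨ P.divY = some j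

/-- At `P` the strict transform of the branch is smooth and has normal crossings with the
exceptional divisor. -/
def InfPoint.IsNormalCrossing (P : InfPoint) : Prop :=
  min P.curve.x.order P.curve.y.order = 1 ∧
  (P.divX = none ∨ P.divY = none) ∧
  (P.divX ≠ none → P.curve.x.order = 1) ∧ (P.divY ≠ none → P.curve.y.order = 1)

/-- The pullback of `A dx + B dy` by the blow-down map, in the coordinates at `P`. -/
def InfPoint.pullForm (P : InfPoint) (ω : OneForm) : OneForm :=
  let σ : Fin 2 → MvPowerSeries (Fin 2) ℂ := ![P.mapX, P.mapY]
  MvPowerSeries.subst σ ω.1 • d (P.mapX : MvPowerSeries (Fin 2) ℂ) +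
    MvPowerSeries.subst σ ω.2 • d (P.mapY : MvPowerSeries (Fin 2) ℂ)

namespace PlaneBranch

variable (C : PlaneBranch)

/-- The number of blowing-ups in the canonical (minimal) embedded resolution of the branch. -/
def numBlowUps : ℕ := sInf {k | (infPoint C.param k).IsNormalCrossing}

/-- For `1 ≤ a < b`: `E_a` and `E_b` intersect in the canonical resolution. They meet when `E_b` is
created if and only if the blown-up point lies on `E_a`, and they are separated if and only if
their common point is blown up later. -/
def Meet (a b : ℕ) : Prop :=
  1 ≤ a ∧ a < b ∧ b ≤ C.numBlowUps ∧ (infPoint C.param (b - 1)).Through a ∧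
  ∀ l, b ≤ l → l < C.numBlowUps →
    ¬ ((infPoint C.param l).Through a ∧ (infPoint C.param l).Through b)

/-- The dual graph of the canonical resolution. Vertex `k` with `1 ≤ k ≤ numBlowUps` is the
component `E_k` of the exceptional divisor, vertex `0` is the strict transform of the branch
(the arrow), and the other natural numbers are isolated. -/
def dualGraph : SimpleGraph ℕ :=
  SimpleGraph.fromRel fun a b =>
    (a = 0 ∧ 1 ≤ b ∧ (infPoint C.param C.numBlowUps).Through b) ∨ C.Meet a b

/-- `k` is a triple point of the dual graph. -/
def IsTriplePoint (k : ℕ) : Prop := 1 ≤ k ∧ (C.dualGraph.neighborSet k).ncard = 3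

/-- The index of the component that corresponds to the last triple point of the dual graph. -/
def lastTriplePoint : ℕ := sSup {k | C.IsTriplePoint k}

/-- The foliation `ω = 0` is dicritical in `E_k`: near the point `P_k` of `E_k` the pullback of
`ω` is a power of the equation of `E_k` times a form that is not divisible by this equation and
for which `E_k` is not invariant, so that the strict transform is generically transversal
to `E_k`. (Another component through `P_k` may still divide that form, which has no influence on
the invariance of `E_k`.) -/
def IsDicriticalAt (ω : OneForm) (k : ℕ) : Prop :=
  ∃ (m : ℕ) (A B : MvPowerSeries (Fin 2) ℂ),
    ((infPoint C.param k).divX = some k ∧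
      (infPoint C.param k).pullForm ω = ((MvPowerSeries.X 0 : MvPowerSeries (Fin 2) ℂ) ^ m) • ((A, B) : OneForm) ∧
      ¬ (MvPowerSeries.X 0 : MvPowerSeries (Fin 2) ℂ) ∣ B) ∨
    ((infPoint C.param k).divY = some k ∧
      (infPoint C.param k).pullForm ω = ((MvPowerSeries.X 1 : MvPowerSeries (Fin 2) ℂ) ^ m) • ((A, B) : OneForm) ∧
      ¬ (MvPowerSeries.X 1 : MvPowerSeries (Fin 2) ℂ) ∣ A)

/-- The strict transform of the branch `γ` after `k` blowing-ups intersects transversally the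
component `E_k` (for `k = numBlowUps` this takes place in the canonical resolution): the branch `γ`
passes through `P_0, …, P_{k-1}`, and its strict transform at its point on the component that
arises from `P_{k-1}` has intersection multiplicity one with this component. -/
def MeetsTransversally (γ : Param) (k : ℕ) : Prop :=
  (∀ j, j + 1 < k → (infPoint γ j).curve.dir = (infPoint C.param j).curve.dir) ∧
  (((infPoint γ k).divX = some k ∧ (infPoint γ k).curve.x.order = 1) ∨
    ((infPoint γ k).divY = some k ∧ (infPoint γ k).curve.y.order = 1))

/-- `ψ_u(t) = (t ^ β_0, ∑_{j < β_g} c_j t ^ j + u t ^ β_g + ∑_{j > β_g} s_j(u) t ^ j)`. -/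
def family (s : ℕ → RatFunc ℂ) (u : ℂ) : Param where
  x := PowerSeries.X ^ C.β 0
  y := PowerSeries.mk fun j =>
    if j < C.β C.g then PowerSeries.coeff j C.η
    else if j = C.β C.g then u
    else (s j).eval (RingHom.id ℂ) u

end PlaneBranch

end PlaneFoliation

end

/-!
Write `n = β_0`, `ξ(t) = ∑_{k < β_g} c_k t ^ k`, and consider the family of arcs
`(t ^ n, ξ(t) + v t ^ β_g)` with a parameter `v`, which may be a power series, a variable, or an
element of any other ring over `ℂ⟦t⟧`. The branch itself belongs to one value of `v`, and the
separatrices that are looked for belong to others. So the theorem is about the pullback of `ω` to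
this family. For this reason most lemmas quantify over a ring `S` with a homomorphism
`ι : ℂ⟦X⟧ →+* S`; they are used for `ℂ⟦t⟧` (single arcs), for `ℂ⟦t, u⟧` (the generic arc, with
`v = c + u` for the last characteristic coefficient `c`) and for `ℂ⟦t⟧[V]` (all arcs at once).

*Orders along the family.* The semiroot `F_g` takes a value `κ v t ^ v_g + ⋯` on the family, and
an earlier semiroot `F_j` a value `κ t ^ v_j + ⋯`, with non-zero constants `κ`
(`PlaneBranch.semiroot_lead`, `PlaneBranch.semiroot_lead_of_lt`). If a polynomial in `y` of degree
less than `n` is expanded in powers of semiroots, then the orders of the terms are pairwise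
distinct, because they are distinct modulo a suitable `e_j`; hence its leading term is
`κ v ^ m t ^ h`, where `h` is its intersection multiplicity with the branch
(`PlaneBranch.monomial_lead`).

*The resolution.* The blowing-ups that resolve the branch act on the two coordinates of the family
by the Euclidean algorithm. As long as the coordinates are, up to terms in `v` of higher order,
power series in `t ^ e_{g-1}` (the first stage), and then as long as they are monomials in `t` and
`v` of different `t`-orders (the second stage), all members of the family with a unit `v` pass
through the same infinitely near points. The process ends at a point where both coordinates have
the same order `a` and the leading coefficient of their quotient is `κ v ^ q` with `q ≠ 0`; the
next blowing-up separates the family (`PlaneBranch.exists_lastStage`). In the chart obtained in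
this way the generic arc becomes a map `(t, u) ↦ (t ^ a · unit, κ u + ⋯)`, and orders in `t` of
functions that are pulled back by this map are multiples of `a`. As the integers `v_0, …, v_g` are
such orders and are coprime, `a = 1` (`PlaneBranch.SeparatingChart.eq_one`). Consequently the
last blowing-up is the one just described, its centre is an intersection point of two exceptional
components, and the new component, which moreover meets the strict transform of the branch away
from these two, is the last triple point (`PlaneBranch.LastStage.lastTriplePoint_eq`).

*The criterion.* Since the chart is étale and maps `t = 0` to the last component, this component is
dicritical if and only if, in the pullback of `ω` to the generic arc, the coefficient of `du` has at
most the order in `t` of the coefficient of `dt` (`PlaneBranch.LastStage.isDicriticalAt_iff`). The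
orders in `ω_{ig}` are balanced in such a way that both coefficients of its pullback are divisible
by `t ^ (v_i + v_g)`, and the coefficient of `du` has exactly this order
(`PlaneBranch.exists_basic_eq`). On the other hand `dH₂` contributes the order `I(F, H₂) - 1` in
`dt` and at least `I(F, H₂)` in `du`. Comparing the two gives the inequality
(`PlaneBranch.tCoeff_vCoeff_cases`).

*The separatrices.* An arc of the family is a separatrix if and only if its parameter `v(t)` solves
the differential equation `A(t, v) + B(t, v) v' = 0` whose coefficients are those of the pullback of
`ω`. In the dicritical case a common power of `t` can be cancelled, after which
`B(0, v) = κ v ^ m`. So there is a unique formal solution with initial value `u ≠ 0`; solving over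
the Laurent polynomials in `u` shows that its coefficients are rational functions without poles in
`ℂ^*` (`exists_rational_solution`), and it converges by the method of majorants
(`isConvergent_of_odeSide_eq_zero`).
-/

noncomputable section

namespace PlaneFoliation

/-! ### Substitution into polynomials in `y` over power series in `x` -/

lemma toSeries_add (G H : Polynomial ℂ⟦X⟧) : toSeries (G + H) = toSeries G + toSeries H := by
  funext m
  simp [toSeries]
  rfl

lemma toSeries_monomial (k : ℕ) (f : ℂ⟦X⟧) :
    toSeries (Polynomial.monomial k f) =
      PowerSeries.subst (MvPowerSeries.X 0 : MvPowerSeries (Fin 2) ℂ) f *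
        MvPowerSeries.X 1 ^ k := by
  classical
  ext m
  rw [MvPowerSeries.X_pow_eq, MvPowerSeries.coeff_mul_monomial, PowerSeries.coeff_subst_single]
  change PowerSeries.coeff (m 0) ((Polynomial.monomial k f).coeff (m 1)) = _
  rw [Polynomial.coeff_monomial]
  by_cases h : k = m 1
  · subst h
    have h1 : Finsupp.single (1 : Fin 2) (m 1) ≤ m := by simp
    have h2 : m - Finsupp.single 1 (m 1) =
        Finsupp.single (0 : Fin 2) ((m - Finsupp.single (1 : Fin 2) (m 1) : Fin 2 →₀ ℕ) 0) := by
      ext i; fin_cases i <;> simp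
    rw [if_pos rfl, if_pos h1, if_pos h2]
    simp
  · rw [if_neg h]
    split_ifs with h1 h2
    · exfalso
      have h3 := DFunLike.congr_fun h2 1
      have h4 := h1 1
      simp at h3 h4
      omega
    · simp
    · simp

lemma hasSubst_pair {τ : Type*} {a b : MvPowerSeries τ ℂ}
    (ha : MvPowerSeries.constantCoeff a = 0) (hb : MvPowerSeries.constantCoeff b = 0) :
    MvPowerSeries.HasSubst ![a, b] :=
  MvPowerSeries.hasSubst_of_constantCoeff_zero fun i => by fin_cases i <;> simpa

lemma subst_toSeries {τ : Type*} {a b : MvPowerSeries τ ℂ}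
    (ha : MvPowerSeries.constantCoeff a = 0) (hb : MvPowerSeries.constantCoeff b = 0)
    (H : Polynomial ℂ⟦X⟧) :
    MvPowerSeries.subst ![a, b] (toSeries H) =
      H.eval₂ (PowerSeries.substAlgHom (PowerSeries.HasSubst.of_constantCoeff_zero ha) :
        ℂ⟦X⟧ →ₐ[ℂ] MvPowerSeries τ ℂ).toRingHom b := by
  have hs := hasSubst_pair ha hb
  induction H using Polynomial.induction_on' with
  | add p q hp hq =>
    rw [toSeries_add, MvPowerSeries.subst_add hs, hp, hq, Polynomial.eval₂_add]
  | monomial k f =>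
    rw [toSeries_monomial, MvPowerSeries.subst_mul hs, MvPowerSeries.subst_pow hs,
      MvPowerSeries.subst_X hs, Polynomial.eval₂_monomial]
    congr 1
    change _ = (PowerSeries.substAlgHom (PowerSeries.HasSubst.of_constantCoeff_zero ha)) f
    rw [PowerSeries.coe_substAlgHom]
    have := MvPowerSeries.subst_comp_subst_apply (R := ℂ) (S := ℂ) (T := ℂ)
      (PowerSeries.HasSubst.const (PowerSeries.HasSubst.X (0 : Fin 2))) hs f
    refine this.trans ?_
    rw [PowerSeries.subst]
    congr 1
    funext _
    rw [MvPowerSeries.subst_X hs]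
    rfl

lemma subst_pow_eq_subst_expand {τ : Type*} {a : MvPowerSeries τ ℂ}
    (ha : MvPowerSeries.constantCoeff a = 0) {n : ℕ} (hn : n ≠ 0) (f : ℂ⟦X⟧) :
    PowerSeries.subst (a ^ n) f = PowerSeries.subst a (PowerSeries.expand n hn f) := by
  rw [PowerSeries.expand_apply, PowerSeries.subst_comp_subst_apply
    (PowerSeries.HasSubst.X_pow hn) (PowerSeries.HasSubst.of_constantCoeff_zero ha)]
  congr 1
  rw [PowerSeries.subst_pow (PowerSeries.HasSubst.of_constantCoeff_zero ha),
    PowerSeries.subst_X (PowerSeries.HasSubst.of_constantCoeff_zero ha)]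

/-- The value of `H ∈ ℂ⟦x⟧[y]` at the point `(t ^ n, y)` of a ring `S` in which power series in
`t` can be evaluated by `ι`. -/
def valueAt {S : Type*} [CommRing S] (ι : ℂ⟦X⟧ →+* S) (n : ℕ) (hn : n ≠ 0) (y : S) :
    Polynomial ℂ⟦X⟧ →+* S :=
  Polynomial.eval₂RingHom (ι.comp (PowerSeries.expand n hn).toRingHom) y

lemma pull_toSeries {n : ℕ} (hn : n ≠ 0) {y : ℂ⟦X⟧} (hy : PowerSeries.constantCoeff y = 0)
    (H : Polynomial ℂ⟦X⟧) :
    Param.pull ⟨PowerSeries.X ^ n, y⟩ (toSeries H) = valueAt (RingHom.id _) n hn y H := by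
  have ha : MvPowerSeries.constantCoeff (PowerSeries.X ^ n : ℂ⟦X⟧) = 0 := by
    change PowerSeries.constantCoeff (PowerSeries.X ^ n : ℂ⟦X⟧) = 0
    simp [hn]
  refine (subst_toSeries ha hy H).trans ?_
  rw [valueAt, Polynomial.coe_eval₂RingHom]
  congr 1

namespace PlaneBranch

variable (C : PlaneBranch)

/-! ### Characteristic exponents -/

lemma n_ne_zero : C.n ≠ 0 := by
  intro h
  have h1 : C.F = 1 := by
    apply Polynomial.eq_one_of_monic_natDegree_zero C.monic
    rw [C.natDegree_eq, h]
  exact C.irreducible.not_isUnit (h1 ▸ isUnit_one)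

lemma e_succ (j : ℕ) : C.e (j + 1) = Nat.gcd (C.e j) (C.β (j + 1)) := rfl

lemma e_zero : C.e 0 = C.n := rfl
lemma β_zero : C.β 0 = C.n := rfl

lemma e_succ_dvd (j : ℕ) : C.e (j + 1) ∣ C.e j := by
  rw [e_succ]; exact Nat.gcd_dvd_left _ _

lemma e_dvd_e {i j : ℕ} (h : i ≤ j) : C.e j ∣ C.e i := by
  induction j, h using Nat.le_induction with
  | base => exact dvd_rfl
  | succ j _ ih => exact (C.e_succ_dvd j).trans ih

lemma e_dvd_n (j : ℕ) : C.e j ∣ C.n := C.e_dvd_e (Nat.zero_le j)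

lemma e_pos (j : ℕ) : 0 < C.e j :=
  Nat.pos_of_dvd_of_pos (C.e_dvd_n j) (Nat.pos_of_ne_zero C.n_ne_zero)

lemma β_mem {j : ℕ} (hj : j < C.g) :
    ¬ C.e j ∣ C.β (j + 1) ∧ PowerSeries.coeff (C.β (j + 1)) C.η ≠ 0 := by
  have h1 : C.e j ≠ 1 := fun h => Nat.notMem_of_lt_sInf hj h
  have hne : {k : ℕ | ¬ C.e j ∣ k ∧ PowerSeries.coeff k C.η ≠ 0}.Nonempty := by
    by_contra hemp
    refine h1 (C.primitive _ (C.e_dvd_n j) fun k hk => ?_)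
    by_contra hd
    exact hemp ⟨k, hd, hk⟩
  exact Nat.sInf_mem hne

lemma e_dvd_of_lt {j k : ℕ} (hk : k < C.β (j + 1)) (hc : PowerSeries.coeff k C.η ≠ 0) :
    C.e j ∣ k := by
  by_contra h
  exact Nat.notMem_of_lt_sInf hk ⟨h, hc⟩

lemma e_g (hg : 0 < C.g) : C.e C.g = 1 := by
  apply Nat.sInf_mem (s := {j | C.e j = 1})
  by_contra h
  rw [Set.not_nonempty_iff_eq_empty] at h
  have : C.g = 0 := by rw [g, h, Nat.sInf_empty]
  omega

lemma e_dvd_β_succ (j : ℕ) : C.e (j + 1) ∣ C.β (j + 1) := by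
  rw [e_succ]; exact Nat.gcd_dvd_right _ _

lemma e_dvd_β {i j : ℕ} (h : i ≤ j) : C.e j ∣ C.β i := by
  refine (C.e_dvd_e h).trans ?_
  cases i with
  | zero => exact dvd_rfl
  | succ i => exact C.e_dvd_β_succ i

/-- The `e_j` decrease strictly up to the index `g`, because `e_j` does not divide `β_{j+1}`. -/
lemma e_succ_lt {j : ℕ} (hj : j < C.g) : C.e (j + 1) < C.e j := by
  refine lt_of_le_of_ne (Nat.le_of_dvd (C.e_pos j) (C.e_succ_dvd j)) fun h => ?_
  exact (C.β_mem hj).1 (h ▸ C.e_dvd_β_succ j)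

/-- The tangent cone is `y = 0`, hence the first characteristic exponent exceeds `n`. -/
lemma n_lt_of_coeff_ne_zero {k : ℕ} (hk : PowerSeries.coeff k C.η ≠ 0) : C.n < k := by
  have hn := C.n_ne_zero
  have hη : C.η ≠ 0 := by rintro h; simp [h] at hk
  set o := C.η.order.toNat with ho
  have hord : C.η.order = o := (ENat.natCast_toNat (by simpa using hη)).symm
  have ho1 : 1 ≤ o := by
    rw [Nat.one_le_iff_ne_zero]
    intro h0
    have := C.constantCoeff_eq
    rw [h0] at hord
    have h2 := (PowerSeries.order_eq_nat.1 hord).1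
    rw [PowerSeries.coeff_zero_eq_constantCoeff_apply] at h2
    exact h2 this
  suffices h : C.n < o from
    h.trans_le (by have := PowerSeries.order_le k hk; rw [hord] at this; exact_mod_cast this)
  by_contra! hle
  have hroot := C.root
  rw [ofConv, pull_toSeries hn C.constantCoeff_eq] at hroot
  set P := C.F.map convergentSeries.subtype with hP
  have hPm : P.Monic := C.monic.map _
  have hPd : P.natDegree = C.n := by rw [hP, C.monic.natDegree_map, C.natDegree_eq]
  have hcoeff : ∀ j < C.n, PowerSeries.X ^ (C.n * (C.n - j + 1)) ∣
      PowerSeries.expand C.n hn (P.coeff j) := by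
    intro j hj
    have h1 := C.tangent (C.n - j) (by omega) (by omega)
    rw [Nat.sub_sub_self hj.le] at h1
    have h2 : (PowerSeries.X : ℂ⟦X⟧) ^ (C.n - j + 1) ∣ P.coeff j := by
      rw [PowerSeries.X_pow_dvd_iff]
      intro m hm
      apply PowerSeries.coeff_of_lt_order
      rw [hP, Polynomial.coeff_map]
      refine lt_of_le_of_lt ?_ h1
      exact_mod_cast (by omega : m ≤ C.n - j)
    obtain ⟨q, hq⟩ := h2
    rw [hq, map_mul, map_pow, PowerSeries.expand_X, ← pow_mul]
    exact dvd_mul_right _ _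
  have hXo : PowerSeries.X ^ o ∣ C.η := PowerSeries.X_pow_order_dvd
  -- If `η` had order `o ≤ n`, then `η ^ n` would be the only term of order `n * o` in
  -- `F(t ^ n, η(t)) = 0`, all others being of larger order by the condition on the tangent cone.
  have key : (PowerSeries.X : ℂ⟦X⟧) ^ (C.n * o + 1) ∣ C.η ^ C.n := by
    have h3 : valueAt (RingHom.id _) C.n hn C.η P =
        ∑ j ∈ Finset.range C.n, PowerSeries.expand C.n hn (P.coeff j) * C.η ^ j + C.η ^ C.n := by
      rw [valueAt, Polynomial.coe_eval₂RingHom, Polynomial.eval₂_eq_sum_range, hPd,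
        Finset.sum_range_succ]
      have h4 : P.coeff C.n = 1 := by rw [← hPd]; exact hPm
      rw [h4, map_one, one_mul]
      rfl
    rw [h3] at hroot
    rw [← neg_eq_of_add_eq_zero_right hroot, dvd_neg]
    refine Finset.dvd_sum fun j hj => ?_
    rw [Finset.mem_range] at hj
    have h5 := mul_dvd_mul (hcoeff j hj) (pow_dvd_pow_of_dvd hXo j)
    rw [← pow_mul, ← pow_add] at h5
    refine (pow_dvd_pow _ ?_).trans h5
    obtain ⟨i, hi⟩ : ∃ i, C.n = j + i := ⟨C.n - j, by omega⟩
    have h6 : C.n - j = i := by omega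
    have h7 : i * o ≤ i * C.n := Nat.mul_le_mul_left _ hle
    have h8 : C.n * o = o * j + i * o := by rw [hi]; ring
    have h9 : C.n * (i + 1) = i * C.n + C.n := by ring
    rw [h6]; omega
  have hne : PowerSeries.coeff (C.n * o) (C.η ^ C.n) ≠ 0 := by
    obtain ⟨q, hq⟩ := hXo
    have hq0 : PowerSeries.constantCoeff q ≠ 0 := by
      have h2 := (PowerSeries.order_eq_nat.1 hord).1
      rw [hq] at h2
      simpa [PowerSeries.coeff_X_pow_mul'] using h2
    rw [hq, mul_pow, ← pow_mul, mul_comm o, PowerSeries.coeff_X_pow_mul']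
    simp [hq0]
  exact hne (PowerSeries.X_pow_dvd_iff.1 key _ (Nat.lt_succ_self _))

lemma β_lt_succ {j : ℕ} (hj : j < C.g) : C.β j < C.β (j + 1) := by
  have h1 := C.β_mem hj
  cases j with
  | zero => exact C.n_lt_of_coeff_ne_zero h1.2
  | succ j =>
    by_contra! h
    rcases h.lt_or_eq with h | h
    · exact h1.1 ((C.e_succ_dvd j).trans (C.e_dvd_of_lt h h1.2))
    · exact h1.1 (h ▸ C.e_dvd_β_succ j)

lemma β_le_of_le {i j : ℕ} (hij : i ≤ j) (hj : j ≤ C.g) : C.β i ≤ C.β j := by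
  induction j, hij using Nat.le_induction with
  | base => exact le_rfl
  | succ j _ ih => exact (ih (by omega)).trans (C.β_lt_succ (by omega)).le

lemma β_pos {j : ℕ} (hj : j ≤ C.g) : 0 < C.β j :=
  (Nat.pos_of_ne_zero C.n_ne_zero).trans_le (C.β_le_of_le (Nat.zero_le j) hj)

lemma two_le_e {j : ℕ} (hj : j < C.g) : 2 ≤ C.e j := by
  have := C.e_succ_lt hj
  have := C.e_pos (j + 1)
  omega

/-! ### Generators of the semigroup -/

lemma v_zero : C.v 0 = C.n := rfl

lemma v_succ (j : ℕ) : C.v (j + 1) = C.ratio j * C.v j + C.β (j + 1) - C.β j := rfl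

/-- The closed formula for `v_{j+1}`, as a sum of contact orders of conjugates. -/
lemma e_mul_v_succ {j : ℕ} (hj : j < C.g) :
    C.e j * C.v (j + 1) =
      ∑ l ∈ Finset.range j, (C.e l - C.e (l + 1)) * C.β (l + 1) + C.e j * C.β (j + 1) := by
  induction j with
  | zero =>
    rw [v_succ, v_zero, β_zero]
    simp [ratio]
  | succ j ih =>
    have ih := ih (by omega)
    have h1 := C.β_lt_succ hj
    have h2 : C.e (j + 1) * C.ratio (j + 1) = C.e j := Nat.mul_div_cancel' (C.e_succ_dvd j)
    have h3 := (C.e_succ_lt (show j < C.g by omega)).le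
    rw [v_succ, Finset.sum_range_succ, Nat.add_sub_assoc h1.le, mul_add, ← mul_assoc, h2, ih]
    obtain ⟨a, ha⟩ : ∃ a, C.e j = C.e (j + 1) + a := ⟨_, (Nat.add_sub_cancel' h3).symm⟩
    obtain ⟨b, hb⟩ : ∃ b, C.β (j + 1 + 1) = C.β (j + 1) + b :=
      ⟨_, (Nat.add_sub_cancel' h1.le).symm⟩
    have h4 : C.e j - C.e (j + 1) = a := by omega
    have h5 : C.β (j + 1 + 1) - C.β (j + 1) = b := by omega
    rw [h4, h5, hb, ha]
    ring

lemma v_pos {j : ℕ} (hj : j ≤ C.g) : 0 < C.v j := by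
  cases j with
  | zero => exact Nat.pos_of_ne_zero C.n_ne_zero
  | succ j =>
    rw [v_succ]
    have := C.β_lt_succ (show j < C.g by omega)
    omega

lemma e_dvd_v {j : ℕ} (hj : j ≤ C.g) : C.e j ∣ C.v j := by
  induction j with
  | zero => exact dvd_rfl
  | succ j ih =>
    have h1 := ih (by omega)
    rw [v_succ, Nat.add_sub_assoc (C.β_lt_succ (by omega)).le]
    refine dvd_add ((C.e_succ_dvd j).trans (h1.mul_left _)) ?_
    exact Nat.dvd_sub (C.e_dvd_β_succ j) (C.e_dvd_β (Nat.le_succ j))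

lemma gcd_e_v {j : ℕ} (hj : j < C.g) : Nat.gcd (C.e j) (C.v (j + 1)) = C.e (j + 1) := by
  have h : C.v (j + 1) + C.β j = C.ratio j * C.v j + C.β (j + 1) := by
    rw [v_succ]
    have := C.β_lt_succ hj
    omega
  have h1 : C.e j ∣ C.β j := C.e_dvd_β le_rfl
  have h2 : C.e j ∣ C.ratio j * C.v j := (C.e_dvd_v hj.le).mul_left _
  refine Nat.dvd_antisymm ?_ ?_
  · rw [e_succ]
    refine Nat.dvd_gcd (Nat.gcd_dvd_left _ _) ?_
    have h3 : Nat.gcd (C.e j) (C.v (j + 1)) ∣ C.ratio j * C.v j + C.β (j + 1) := by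
      rw [← h]
      exact dvd_add (Nat.gcd_dvd_right _ _) ((Nat.gcd_dvd_left _ _).trans h1)
    exact (Nat.dvd_add_right ((Nat.gcd_dvd_left _ _).trans h2)).1 h3
  · exact Nat.dvd_gcd (C.e_succ_dvd j) (C.e_dvd_v hj)

end PlaneBranch

/-! ### Leading terms with respect to a parameter -/

/-- `x` has the leading term `s * t ^ a` with respect to `t`: it is `t ^ a * (s + t * r)` for
some `r`. The coefficient `s` is allowed to vanish. -/
def HasLead {S : Type*} [CommRing S] (t : S) (a : ℕ) (s x : S) : Prop :=
  ∃ r, x = t ^ a * (s + t * r)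

namespace HasLead

variable {S : Type*} [CommRing S] {t s s' x y : S} {a b : ℕ}

lemma mul (hx : HasLead t a s x) (hy : HasLead t b s' y) :
    HasLead t (a + b) (s * s') (x * y) := by
  obtain ⟨r, rfl⟩ := hx
  obtain ⟨r', rfl⟩ := hy
  exact ⟨s * r' + r * s' + t * r * r', by ring⟩

lemma one : HasLead t 0 1 1 := ⟨0, by ring⟩

lemma prod {κ : Type*} (A : Finset κ) (o : κ → ℕ) (c f : κ → S)
    (h : ∀ i ∈ A, HasLead t (o i) (c i) (f i)) :
    HasLead t (∑ i ∈ A, o i) (∏ i ∈ A, c i) (∏ i ∈ A, f i) := by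
  classical
  induction A using Finset.induction_on with
  | empty => simpa using one
  | insert i A hi ih =>
    rw [Finset.sum_insert hi, Finset.prod_insert hi, Finset.prod_insert hi]
    exact (h i (Finset.mem_insert_self _ _)).mul
      (ih fun k hk => h k (Finset.mem_insert_of_mem hk))

lemma congr (hx : HasLead t a s x) (h : t ∣ s - s') : HasLead t a s' x := by
  obtain ⟨r, rfl⟩ := hx
  obtain ⟨q, hq⟩ := h
  exact ⟨r + q, by rw [eq_add_of_sub_eq hq]; ring⟩

lemma add_of_dvd (hx : HasLead t a s x) (hy : t ^ (a + 1) ∣ y) : HasLead t a s (x + y) := by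
  obtain ⟨r, rfl⟩ := hx
  obtain ⟨q, rfl⟩ := hy
  exact ⟨r + q, by ring⟩

lemma dvd (hx : HasLead t a s x) (h : b ≤ a) : t ^ b ∣ x := by
  obtain ⟨r, rfl⟩ := hx
  exact (pow_dvd_pow t h).mul_right _

lemma add_of_lt (hx : HasLead t a s x) (hy : HasLead t b s' y) (h : a < b) :
    HasLead t a s (x + y) := hx.add_of_dvd (hy.dvd h)

lemma map {T : Type*} [CommRing T] (φ : S →+* T) (hx : HasLead t a s x) :
    HasLead (φ t) a (φ s) (φ x) := by
  obtain ⟨r, rfl⟩ := hx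
  exact ⟨φ r, by simp⟩

lemma order_eq {f : ℂ⟦X⟧} {κ : ℂ} (hκ : κ ≠ 0)
    (h : HasLead PowerSeries.X a (PowerSeries.C κ) f) : f.order = a := by
  obtain ⟨r, rfl⟩ := h
  rw [PowerSeries.order_mul, PowerSeries.order_X_pow, PowerSeries.order_zero_of_unit, add_zero]
  rw [PowerSeries.isUnit_iff_constantCoeff]
  simpa using hκ

end HasLead

lemma hasLead_of_coeff {f : ℂ⟦X⟧} {a : ℕ} (h : ∀ k < a, PowerSeries.coeff k f = 0) :
    HasLead PowerSeries.X a (PowerSeries.C (PowerSeries.coeff a f)) f := by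
  obtain ⟨q, rfl⟩ := PowerSeries.X_pow_dvd_iff.2 h
  have h1 : PowerSeries.coeff a (PowerSeries.X ^ a * q) = PowerSeries.constantCoeff q := by
    simp [PowerSeries.coeff_X_pow_mul']
  rw [h1]
  obtain ⟨r, hr⟩ : PowerSeries.X ∣ q - PowerSeries.C (PowerSeries.constantCoeff q) := by
    rw [PowerSeries.X_dvd_iff]; simp
  exact ⟨r, by rw [← hr]; ring⟩

/-! ### The product over the conjugates of a Puiseux series -/

section BranchPoly

variable (m : ℕ) (η : ℂ⟦X⟧)

/-- The polynomial `∏_{α ^ m = 1} (y - η(α t))`. -/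
def conjProd : Polynomial ℂ⟦X⟧ :=
  ∏ α ∈ Polynomial.nthRootsFinset m (1 : ℂ),
    (Polynomial.X - Polynomial.C (PowerSeries.rescale α η))

lemma branchPoly_eq : branchPoly m η = ∑ j ∈ Finset.range (m + 1),
    Polynomial.monomial j
      (PowerSeries.mk fun k => PowerSeries.coeff (m * k) ((conjProd m η).coeff j)) := rfl

variable {m}

lemma card_nthRootsFinset_complex (hm : m ≠ 0) :
    (Polynomial.nthRootsFinset m (1 : ℂ)).card = m :=
  (Complex.isPrimitiveRoot_exp m hm).card_nthRootsFinset

lemma conjProd_monic : (conjProd m η).Monic :=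
  Polynomial.monic_prod_of_monic _ _ fun _ _ => Polynomial.monic_X_sub_C _

lemma conjProd_natDegree (hm : m ≠ 0) : (conjProd m η).natDegree = m := by
  rw [conjProd, Polynomial.natDegree_prod_of_monic _ _ fun _ _ => Polynomial.monic_X_sub_C _]
  simp [card_nthRootsFinset_complex hm]

lemma conjProd_map_rescale (hm : m ≠ 0) {ζ : ℂ} (hζ : ζ ^ m = 1) :
    (conjProd m η).map (PowerSeries.rescale ζ) = conjProd m η := by
  have hmem : ∀ α : ℂ, α ∈ Polynomial.nthRootsFinset m (1 : ℂ) ↔ α ^ m = 1 := fun α =>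
    Polynomial.mem_nthRootsFinset (Nat.pos_of_ne_zero hm) _
  have hζ0 : ζ ≠ 0 := by
    rintro rfl
    simp [hm] at hζ
  rw [conjProd, Polynomial.map_prod]
  refine Finset.prod_bij (fun α _ => α * ζ) ?_ ?_ ?_ ?_
  · intro α hα
    rw [hmem] at hα ⊢
    rw [mul_pow, hα, hζ, one_mul]
  · intro α _ α' _ h
    exact mul_right_cancel₀ hζ0 h
  · intro α hα
    rw [hmem] at hα
    refine ⟨α * ζ⁻¹, ?_, by rw [mul_assoc, inv_mul_cancel₀ hζ0, mul_one]⟩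
    rw [hmem, mul_pow, inv_pow, hα, hζ, inv_one, one_mul]
  · intro α _
    rw [Polynomial.map_sub, Polynomial.map_X, Polynomial.map_C, PowerSeries.rescale_rescale]

/-- The product over the conjugates is invariant under `t ↦ ζ t` for every `m`-th root of unity
`ζ`, so that its coefficients are power series in `t ^ m`; `branchPoly` is this product with
`x = t ^ m`. -/
lemma expand_coeff_branchPoly (hm : m ≠ 0) :
    (branchPoly m η).map (PowerSeries.expand m hm).toRingHom = conjProd m η := by
  refine Polynomial.ext fun j => ?_
  rw [Polynomial.coeff_map, branchPoly_eq, Polynomial.finsetSum_coeff]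
  simp only [Polynomial.coeff_monomial]
  rw [Finset.sum_ite_eq']
  split_ifs with hj
  · refine PowerSeries.ext fun k => ?_
    change PowerSeries.coeff k (PowerSeries.expand m hm _) = _
    rw [PowerSeries.coeff_expand]
    split_ifs with hk
    · rw [PowerSeries.coeff_mk, Nat.mul_div_cancel' hk]
    · have hζ := Complex.isPrimitiveRoot_exp m hm
      have h1 := congr_arg (fun P => PowerSeries.coeff k (Polynomial.coeff P j))
        (conjProd_map_rescale η hm hζ.pow_eq_one)
      simp only [Polynomial.coeff_map, PowerSeries.coeff_rescale] at h1
      have h2 : Complex.exp (2 * Real.pi * Complex.I / m) ^ k ≠ 1 := fun h =>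
        hk (hζ.dvd_of_pow_eq_one k h)
      by_contra h3
      exact h2 (mul_right_cancel₀ (Ne.symm h3) (h1.trans (one_mul _).symm))
  · rw [map_zero]
    refine (Polynomial.coeff_eq_zero_of_natDegree_lt ?_).symm
    rw [conjProd_natDegree η hm]
    simp at hj
    omega

lemma expand_injective (hm : m ≠ 0) :
    Function.Injective (PowerSeries.expand m hm : ℂ⟦X⟧ →ₐ[ℂ] ℂ⟦X⟧).toRingHom := by
  intro f g h
  refine PowerSeries.ext fun k => ?_
  rw [← PowerSeries.coeff_expand_mul m hm f, ← PowerSeries.coeff_expand_mul m hm g]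
  exact congr_arg _ h

lemma branchPoly_monic (hm : m ≠ 0) : (branchPoly m η).Monic := by
  refine Polynomial.monic_of_injective (expand_injective hm) ?_
  rw [expand_coeff_branchPoly]
  exact conjProd_monic η

lemma branchPoly_natDegree (hm : m ≠ 0) : (branchPoly m η).natDegree = m := by
  rw [← Polynomial.natDegree_map_eq_of_injective (expand_injective hm),
    expand_coeff_branchPoly, conjProd_natDegree η hm]

lemma valueAt_branchPoly {S : Type*} [CommRing S] (ι : ℂ⟦X⟧ →+* S) {n e : ℕ} (hn : n ≠ 0)
    (he : e ≠ 0) (hm : m ≠ 0) (h : n = e * m) (y : S) :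
    valueAt ι n hn y (branchPoly m η) = ∏ α ∈ Polynomial.nthRootsFinset m (1 : ℂ),
      (y - ι (PowerSeries.expand e he (PowerSeries.rescale α η))) := by
  subst h
  have h1 : ι.comp (PowerSeries.expand (e * m) hn).toRingHom =
      (ι.comp (PowerSeries.expand e he).toRingHom).comp (PowerSeries.expand m hm).toRingHom := by
    ext1 f
    change ι _ = ι _
    congr 1
    exact PowerSeries.expand_mul e he m hm f
  rw [valueAt, Polynomial.coe_eval₂RingHom, h1, ← Polynomial.eval₂_map, expand_coeff_branchPoly,
    conjProd, Polynomial.eval₂_finsetProd]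
  refine Finset.prod_congr rfl fun α _ => ?_
  rw [Polynomial.eval₂_sub, Polynomial.eval₂_X, Polynomial.eval₂_C]
  rfl

end BranchPoly

namespace PlaneBranch

variable (C : PlaneBranch)

/-- The sum of the terms of the parametrization below the characteristic exponent `β_{j+1}`. -/
def initialPart (j : ℕ) : ℂ⟦X⟧ :=
  PowerSeries.mk fun k => if k < C.β (j + 1) then PowerSeries.coeff k C.η else 0

lemma coeff_initialPart (j k : ℕ) : PowerSeries.coeff k (C.initialPart j) =
    if k < C.β (j + 1) then PowerSeries.coeff k C.η else 0 := PowerSeries.coeff_mk _ _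

lemma expand_truncated (j : ℕ) (α : ℂ) (he : C.e j ≠ 0) (k : ℕ) :
    PowerSeries.coeff k (PowerSeries.expand (C.e j) he (PowerSeries.rescale α (C.truncated j))) =
      PowerSeries.coeff k (C.initialPart j) * α ^ (k / C.e j) := by
  rw [PowerSeries.coeff_expand, coeff_initialPart]
  by_cases hd : C.e j ∣ k
  · rw [if_pos hd, PowerSeries.coeff_rescale, truncated, PowerSeries.coeff_mk,
      Nat.mul_div_cancel' hd, mul_comm]
  · rw [if_neg hd]
    split_ifs with hk
    · have : PowerSeries.coeff k C.η = 0 := by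
        by_contra hc
        exact hd (C.e_dvd_of_lt hk hc)
      rw [this, zero_mul]
    · rw [zero_mul]

/-- The second coordinate `ξ(t) + v t ^ β` of the family through the branch, where `ξ` is the
part of the parametrization below `β = β_{j+1}`. -/
def pt {S : Type*} [CommRing S] (ι : ℂ⟦X⟧ →+* S) (j : ℕ) (v : S) : S :=
  ι (C.initialPart j) + v * ι PowerSeries.X ^ C.β (j + 1)

/-- The semiroot `F_{j+1}` as a polynomial. -/
def semirootPoly (j : ℕ) : Polynomial ℂ⟦X⟧ := branchPoly (C.n / C.e j) (C.truncated j)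

lemma n_div_e_ne_zero (j : ℕ) : C.n / C.e j ≠ 0 :=
  (Nat.div_pos (Nat.le_of_dvd (Nat.pos_of_ne_zero C.n_ne_zero) (C.e_dvd_n j)) (C.e_pos j)).ne'

lemma semirootPoly_monic (j : ℕ) : (C.semirootPoly j).Monic :=
  branchPoly_monic _ (C.n_div_e_ne_zero j)

lemma semirootPoly_natDegree (j : ℕ) : (C.semirootPoly j).natDegree = C.n / C.e j :=
  branchPoly_natDegree _ (C.n_div_e_ne_zero j)

/-- Two conjugates of the truncated parametrization agree exactly up to the characteristic
exponent at which the root of unity that relates them begins to act. -/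
lemma conj_lead {j l : ℕ} (hj : j < C.g) (hl : l < j) {α : ℂ} (h1 : α ^ (C.e l / C.e j) = 1)
    (h2 : α ^ (C.e (l + 1) / C.e j) ≠ 1) :
    ∃ κ : ℂ, κ ≠ 0 ∧ ∀ {S : Type} [CommRing S] (ι : ℂ⟦X⟧ →+* S) (v : S),
      HasLead (ι PowerSeries.X) (C.β (l + 1)) (ι (PowerSeries.C κ)) (C.pt ι j v -
        ι (PowerSeries.expand (C.e j) (C.e_pos j).ne'
          (PowerSeries.rescale α (C.truncated j)))) := by
  set f := C.initialPart j - PowerSeries.expand (C.e j) (C.e_pos j).ne'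
    (PowerSeries.rescale α (C.truncated j)) with hf
  have hcoeff : ∀ k, PowerSeries.coeff k f =
      PowerSeries.coeff k (C.initialPart j) * (1 - α ^ (k / C.e j)) := by
    intro k
    rw [hf, map_sub, expand_truncated]
    ring
  have hlt : C.β (l + 1) < C.β (j + 1) :=
    (C.β_le_of_le (show l + 1 ≤ j by omega) (by omega)).trans_lt (C.β_lt_succ hj)
  have hlow : ∀ k < C.β (l + 1), PowerSeries.coeff k f = 0 := by
    intro k hk
    rw [hcoeff, coeff_initialPart]
    by_cases hc : PowerSeries.coeff k C.η = 0
    · simp [hc]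
    · obtain ⟨q, hq⟩ := C.e_dvd_of_lt hk hc
      have h3 : k / C.e j = C.e l / C.e j * q := by
        rw [hq, Nat.div_mul_right_comm (C.e_dvd_e hl.le)]
      rw [h3, pow_mul, h1]
      simp
  refine ⟨PowerSeries.coeff (C.β (l + 1)) f, ?_, ?_⟩
  · rw [hcoeff, coeff_initialPart, if_pos hlt]
    refine mul_ne_zero (C.β_mem (by omega)).2 (sub_ne_zero.2 fun h => h2 ?_)
    -- If `α` also fixed the term of order `β_{l+1}`, its order would divide
    -- `gcd (e_l, β_{l+1}) / e_j = e_{l+1} / e_j`.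
    have h4 : orderOf α ∣ C.e l / C.e j := orderOf_dvd_of_pow_eq_one h1
    have h5 : orderOf α ∣ C.β (l + 1) / C.e j := orderOf_dvd_of_pow_eq_one h.symm
    have h6 := Nat.dvd_gcd h4 h5
    rw [Nat.gcd_div (C.e_dvd_e hl.le) (C.e_dvd_β (show l + 1 ≤ j by omega)), ← C.e_succ] at h6
    exact orderOf_dvd_iff_pow_eq_one.1 h6
  · intro S _ ι v
    have h3 := (hasLead_of_coeff hlow).map ι
    have h4 := h3.add_of_dvd (y := v * ι PowerSeries.X ^ C.β (j + 1))
      ((pow_dvd_pow _ hlt).mul_left _)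
    convert h4 using 1
    rw [hf, map_sub, pt]
    ring

lemma mem_nthRoots {j l : ℕ} (hl : l ≤ j) (α : ℂ) :
    α ∈ Polynomial.nthRootsFinset (C.e l / C.e j) (1 : ℂ) ↔ α ^ (C.e l / C.e j) = 1 :=
  Polynomial.mem_nthRootsFinset
    (Nat.div_pos (Nat.le_of_dvd (C.e_pos l) (C.e_dvd_e hl)) (C.e_pos j)) _

lemma nthRoots_mono {j l : ℕ} (hl : l < j) :
    Polynomial.nthRootsFinset (C.e (l + 1) / C.e j) (1 : ℂ) ⊆
      Polynomial.nthRootsFinset (C.e l / C.e j) (1 : ℂ) := by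
  intro α hα
  rw [C.mem_nthRoots hl] at hα
  rw [C.mem_nthRoots hl.le]
  obtain ⟨q, hq⟩ := Nat.div_dvd_div (C.e_dvd_e (show l + 1 ≤ j by omega)) (C.e_succ_dvd l)
  rw [hq, pow_mul, hα, one_pow]

/-- The product of the differences with the conjugates that differ below `β_{l+1}`. -/
lemma prod_conj_lead {j : ℕ} (hj : j < C.g) {l : ℕ} (hl : l ≤ j) :
    ∃ κ : ℂ, κ ≠ 0 ∧ ∀ {S : Type} [CommRing S] (ι : ℂ⟦X⟧ →+* S) (v : S),
      HasLead (ι PowerSeries.X)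
        (∑ i ∈ Finset.range l, (C.e i / C.e j - C.e (i + 1) / C.e j) * C.β (i + 1))
        (ι (PowerSeries.C κ))
        (∏ α ∈ Polynomial.nthRootsFinset (C.e 0 / C.e j) (1 : ℂ) \
            Polynomial.nthRootsFinset (C.e l / C.e j) (1 : ℂ),
          (C.pt ι j v - ι (PowerSeries.expand (C.e j) (C.e_pos j).ne'
            (PowerSeries.rescale α (C.truncated j))))) := by
  induction l with
  | zero =>
    refine ⟨1, one_ne_zero, fun ι v => ?_⟩
    simpa using HasLead.one
  | succ l ih =>
    obtain ⟨κ, hκ, ih⟩ := ih (by omega)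
    have hl' : l < j := by omega
    have hex : ∀ α : ℂ, ∃ κ : ℂ, κ ≠ 0 ∧
        (α ∈ Polynomial.nthRootsFinset (C.e l / C.e j) (1 : ℂ) \
            Polynomial.nthRootsFinset (C.e (l + 1) / C.e j) (1 : ℂ) →
        ∀ {S : Type} [CommRing S] (ι : ℂ⟦X⟧ →+* S) (v : S),
          HasLead (ι PowerSeries.X) (C.β (l + 1)) (ι (PowerSeries.C κ)) (C.pt ι j v -
            ι (PowerSeries.expand (C.e j) (C.e_pos j).ne'
              (PowerSeries.rescale α (C.truncated j))))) := by
      intro α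
      by_cases hα : α ∈ Polynomial.nthRootsFinset (C.e l / C.e j) (1 : ℂ) \
            Polynomial.nthRootsFinset (C.e (l + 1) / C.e j) (1 : ℂ)
      · have h := Finset.mem_sdiff.1 hα
        rw [C.mem_nthRoots hl'.le, C.mem_nthRoots hl'] at h
        obtain ⟨κ, h1, h2⟩ := C.conj_lead hj hl' h.1 h.2
        exact ⟨κ, h1, fun _ => h2⟩
      · exact ⟨1, one_ne_zero, fun h => absurd h hα⟩
    choose k hk0 hk using hex
    have hsub : Polynomial.nthRootsFinset (C.e l / C.e j) (1 : ℂ) ⊆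
        Polynomial.nthRootsFinset (C.e 0 / C.e j) (1 : ℂ) := by
      intro α hα
      rw [C.mem_nthRoots hl'.le] at hα
      rw [C.mem_nthRoots (Nat.zero_le j)]
      obtain ⟨q, hq⟩ := Nat.div_dvd_div (C.e_dvd_e hl'.le) (C.e_dvd_e (Nat.zero_le l))
      rw [hq, pow_mul, hα, one_pow]
    have hsplit : Polynomial.nthRootsFinset (C.e 0 / C.e j) (1 : ℂ) \
            Polynomial.nthRootsFinset (C.e (l + 1) / C.e j) (1 : ℂ) =
        (Polynomial.nthRootsFinset (C.e 0 / C.e j) (1 : ℂ) \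
            Polynomial.nthRootsFinset (C.e l / C.e j) (1 : ℂ)) ∪
        (Polynomial.nthRootsFinset (C.e l / C.e j) (1 : ℂ) \
            Polynomial.nthRootsFinset (C.e (l + 1) / C.e j) (1 : ℂ)) :=
      (Finset.sdiff_union_sdiff_cancel hsub (C.nthRoots_mono hl')).symm
    have hdisj : Disjoint (Polynomial.nthRootsFinset (C.e 0 / C.e j) (1 : ℂ) \
            Polynomial.nthRootsFinset (C.e l / C.e j) (1 : ℂ))
        (Polynomial.nthRootsFinset (C.e l / C.e j) (1 : ℂ) \
            Polynomial.nthRootsFinset (C.e (l + 1) / C.e j) (1 : ℂ)) :=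
      Finset.disjoint_left.2 fun α h1 h2 =>
        (Finset.mem_sdiff.1 h1).2 (Finset.mem_sdiff.1 h2).1
    have hcard : (Polynomial.nthRootsFinset (C.e l / C.e j) (1 : ℂ) \
            Polynomial.nthRootsFinset (C.e (l + 1) / C.e j) (1 : ℂ)).card =
        C.e l / C.e j - C.e (l + 1) / C.e j := by
      rw [Finset.card_sdiff_of_subset (C.nthRoots_mono hl'), card_nthRootsFinset_complex,
        card_nthRootsFinset_complex]
      · exact (Nat.div_pos (Nat.le_of_dvd (C.e_pos _) (C.e_dvd_e hl)) (C.e_pos j)).ne'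
      · exact (Nat.div_pos (Nat.le_of_dvd (C.e_pos _) (C.e_dvd_e hl'.le)) (C.e_pos j)).ne'
    refine ⟨κ * ∏ α ∈ Polynomial.nthRootsFinset (C.e l / C.e j) (1 : ℂ) \
            Polynomial.nthRootsFinset (C.e (l + 1) / C.e j) (1 : ℂ), k α,
      mul_ne_zero hκ (Finset.prod_ne_zero_iff.2 fun α _ => hk0 α), fun ι v => ?_⟩
    have h1 := HasLead.prod _ (fun _ => C.β (l + 1)) (fun α => ι (PowerSeries.C (k α))) _
      fun α hα => hk α hα ι v
    have h2 := (ih ι v).mul h1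
    rw [Finset.sum_const, hcard, smul_eq_mul, ← Finset.sum_range_succ
      (fun i => (C.e i / C.e j - C.e (i + 1) / C.e j) * C.β (i + 1)),
      ← Finset.prod_union hdisj, ← hsplit, ← map_prod, ← map_mul, ← map_prod, ← map_mul] at h2
    exact h2

/-- `v_{j+1}` is the sum of the contact orders of the family with the conjugates of the
truncated parametrization: `e_i / e_j - e_{i+1} / e_j` of them have contact `β_{i+1}`. -/
lemma v_succ_eq_sum {j : ℕ} (hj : j < C.g) : C.v (j + 1) =
    ∑ i ∈ Finset.range j, (C.e i / C.e j - C.e (i + 1) / C.e j) * C.β (i + 1) +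
      C.β (j + 1) := by
  refine Nat.eq_of_mul_eq_mul_left (C.e_pos j) ?_
  rw [C.e_mul_v_succ hj, mul_add, Finset.mul_sum]
  congr 1
  refine Finset.sum_congr rfl fun i hi => ?_
  rw [Finset.mem_range] at hi
  rw [← mul_assoc, Nat.mul_sub, Nat.mul_div_cancel' (C.e_dvd_e hi.le),
    Nat.mul_div_cancel' (C.e_dvd_e hi)]

/-- The value of the semiroot `F_{j+1}` on the family: its leading coefficient is proportional
to `v`, and its order is `v_{j+1}`. -/
lemma semiroot_lead {j : ℕ} (hj : j < C.g) :
    ∃ κ : ℂ, κ ≠ 0 ∧ ∀ {S : Type} [CommRing S] (ι : ℂ⟦X⟧ →+* S) (v : S),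
      HasLead (ι PowerSeries.X) (C.v (j + 1)) (ι (PowerSeries.C κ) * v)
        (valueAt ι C.n C.n_ne_zero (C.pt ι j v) (C.semirootPoly j)) := by
  obtain ⟨κ, hκ, h⟩ := C.prod_conj_lead hj le_rfl
  refine ⟨κ, hκ, fun ι v => ?_⟩
  rw [semirootPoly, valueAt_branchPoly _ ι C.n_ne_zero (C.e_pos j).ne' (C.n_div_e_ne_zero j)
    (Nat.mul_div_cancel' (C.e_dvd_n j)).symm, C.v_succ_eq_sum hj]
  have h1 : HasLead (ι PowerSeries.X) (C.β (j + 1)) v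
      (∏ α ∈ Polynomial.nthRootsFinset (C.e j / C.e j) (1 : ℂ),
        (C.pt ι j v - ι (PowerSeries.expand (C.e j) (C.e_pos j).ne'
            (PowerSeries.rescale α (C.truncated j))))) := by
    rw [Nat.div_self (C.e_pos j)]
    have h2 : Polynomial.nthRootsFinset 1 (1 : ℂ) = {1} := by
      ext α
      rw [Polynomial.mem_nthRootsFinset one_pos, pow_one, Finset.mem_singleton]
    rw [h2, Finset.prod_singleton]
    have h3 : PowerSeries.expand (C.e j) (C.e_pos j).ne'
        (PowerSeries.rescale 1 (C.truncated j)) = C.initialPart j := by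
      ext k
      rw [expand_truncated, one_pow, mul_one]
    rw [h3, pt]
    exact ⟨0, by ring⟩
  have h2 := (h ι v).mul h1
  have hsub : Polynomial.nthRootsFinset (C.e j / C.e j) (1 : ℂ) ⊆
      Polynomial.nthRootsFinset (C.e 0 / C.e j) (1 : ℂ) := by
    intro α hα
    rw [C.mem_nthRoots le_rfl] at hα
    rw [C.mem_nthRoots (Nat.zero_le j)]
    obtain ⟨q, hq⟩ := Nat.div_dvd_div (C.e_dvd_e le_rfl) (C.e_dvd_e (Nat.zero_le j))
    rw [hq, pow_mul, hα, one_pow]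
  rw [Finset.prod_sdiff hsub] at h2
  exact h2

/-! ### Leading terms of functions along the family -/

/-- The part of the parametrization of order at least `β_{j+1}`, up to the exponent `β_{j+2}`,
as a value for the parameter of the family. -/
def middlePart (j : ℕ) : ℂ⟦X⟧ :=
  PowerSeries.mk fun k => PowerSeries.coeff (k + C.β (j + 1)) (C.initialPart (j + 1))

lemma initialPart_succ {j : ℕ} (hj : j + 1 < C.g) :
    C.initialPart (j + 1) =
      C.initialPart j + C.middlePart j * PowerSeries.X ^ C.β (j + 1) := by
  have hlt := C.β_lt_succ hj
  ext k
  rw [map_add, PowerSeries.coeff_mul_X_pow', coeff_initialPart, coeff_initialPart]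
  by_cases h : k < C.β (j + 1)
  · rw [if_pos (h.trans hlt), if_pos h, if_neg (not_le.2 h), add_zero]
  · rw [if_neg h, if_pos (not_lt.1 h), middlePart, PowerSeries.coeff_mk,
      Nat.sub_add_cancel (not_lt.1 h), coeff_initialPart, zero_add]

/-- The family through `β_{j+2}` arises from the family through `β_{j+1}` by a substitution for
the parameter whose constant term is the coefficient of `t ^ β_{j+1}` in `η`. -/
lemma pt_succ {j : ℕ} (hj : j + 1 < C.g) {S : Type*} [CommRing S] (ι : ℂ⟦X⟧ →+* S) (v : S) :
    C.pt ι (j + 1) v = C.pt ι j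
      (ι (C.middlePart j) + v * ι PowerSeries.X ^ (C.β (j + 2) - C.β (j + 1))) := by
  rw [pt, pt, C.initialPart_succ hj, map_add, map_mul, map_pow, add_mul, mul_assoc, ← pow_add,
    Nat.sub_add_cancel (C.β_lt_succ hj).le]
  ring

lemma X_dvd_middlePart_sub {j : ℕ} (hj : j + 1 < C.g) : PowerSeries.X ∣
    C.middlePart j - PowerSeries.C (PowerSeries.coeff (C.β (j + 1)) C.η) := by
  rw [PowerSeries.X_dvd_iff, map_sub, PowerSeries.constantCoeff_C, middlePart,
    ← PowerSeries.coeff_zero_eq_constantCoeff_apply, PowerSeries.coeff_mk, zero_add,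
    coeff_initialPart, if_pos (C.β_lt_succ hj), sub_self]

lemma dvd_middle_sub {j : ℕ} (hj : j + 1 < C.g) {S : Type*} [CommRing S] (ι : ℂ⟦X⟧ →+* S)
    (v : S) : ι PowerSeries.X ∣
      ι (C.middlePart j) + v * ι PowerSeries.X ^ (C.β (j + 2) - C.β (j + 1)) -
        ι (PowerSeries.C (PowerSeries.coeff (C.β (j + 1)) C.η)) := by
  rw [add_sub_right_comm, ← map_sub]
  refine dvd_add (map_dvd ι (C.X_dvd_middlePart_sub hj)) (Dvd.dvd.mul_left ?_ _)
  exact dvd_pow_self _ (Nat.sub_pos_of_lt (C.β_lt_succ hj)).ne'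

/-- Functions of degree less than the degree `n / e_j` of the semiroot `F_{j+1}`
have a leading coefficient independent of `v` on the family, and their order is divisible
by `e_j`. -/
def LowDegreeLead (j : ℕ) : Prop :=
  ∀ H : Polynomial ℂ⟦X⟧, H ≠ 0 → H.natDegree < C.n / C.e j →
    ∃ κ : ℂ, κ ≠ 0 ∧ ∃ h : ℕ, C.e j ∣ h ∧
      ∀ {S : Type} [CommRing S] (ι : ℂ⟦X⟧ →+* S) (v : S),
        HasLead (ι PowerSeries.X) h (ι (PowerSeries.C κ))
          (valueAt ι C.n C.n_ne_zero (C.pt ι j v) H)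

lemma lowDegreeLead_zero : C.LowDegreeLead 0 := by
  intro H hH hdeg
  rw [e_zero, Nat.div_self (Nat.pos_of_ne_zero C.n_ne_zero), Nat.lt_one_iff] at hdeg
  rw [Polynomial.eq_C_of_natDegree_eq_zero hdeg] at hH ⊢
  set f := H.coeff 0
  have hf : f ≠ 0 := by
    rintro h
    simp [h] at hH
  set o := f.order.toNat with ho
  refine ⟨PowerSeries.coeff o f, PowerSeries.coeff_order hf, C.n * o, dvd_mul_right _ _,
    fun ι v => ?_⟩
  have h1 : HasLead PowerSeries.X o (PowerSeries.C (PowerSeries.coeff o f)) f :=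
    hasLead_of_coeff fun k hk => PowerSeries.coeff_of_lt_order_toNat k hk
  obtain ⟨r, hr⟩ := (h1.map (PowerSeries.expand C.n C.n_ne_zero).toRingHom).map ι
  rw [valueAt, Polynomial.coe_eval₂RingHom, Polynomial.eval₂_C]
  have h2 : (PowerSeries.expand C.n C.n_ne_zero).toRingHom (PowerSeries.X : ℂ⟦X⟧) =
      PowerSeries.X ^ C.n := PowerSeries.expand_X _ _
  have h3 : (PowerSeries.expand C.n C.n_ne_zero).toRingHom
      (PowerSeries.C (PowerSeries.coeff o f)) = PowerSeries.C (PowerSeries.coeff o f) :=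
    PowerSeries.expand_C _ _ _
  rw [h2, h3, map_pow] at hr
  obtain ⟨n', hn'⟩ := Nat.exists_eq_succ_of_ne_zero C.n_ne_zero
  refine ⟨ι PowerSeries.X ^ n' * r, ?_⟩
  rw [RingHom.comp_apply, hr, pow_mul]
  congr 2
  rw [hn', pow_succ]
  ring

/-- The expansion in powers of a semiroot: the orders of the terms are pairwise distinct, so
that the leading term is that of a single one. -/
lemma lead_of_natDegree_lt_mul {j : ℕ} (hj : j < C.g) (hlow : C.LowDegreeLead j) (q : ℕ)
    (hq : q ≤ C.e j / C.e (j + 1)) (H : Polynomial ℂ⟦X⟧) (hH : H ≠ 0)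
    (hdeg : H.natDegree < q * (C.n / C.e j)) :
    ∃ κ : ℂ, κ ≠ 0 ∧ ∃ h m l : ℕ, m < q ∧ h = m * C.v (j + 1) + C.e j * l ∧
      ∀ {S : Type} [CommRing S] (ι : ℂ⟦X⟧ →+* S) (v : S),
        HasLead (ι PowerSeries.X) h (ι (PowerSeries.C κ) * v ^ m)
          (valueAt ι C.n C.n_ne_zero (C.pt ι j v) H) := by
  induction q generalizing H with
  | zero => simp at hdeg
  | succ q ih =>
    set F := C.semirootPoly j
    have hF : F.Monic := C.semirootPoly_monic j
    have hFd : F.natDegree = C.n / C.e j := C.semirootPoly_natDegree j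
    have hF1 : F ≠ 1 := by
      intro h
      rw [h, Polynomial.natDegree_one] at hFd
      exact C.n_div_e_ne_zero j hFd.symm
    set A := H %ₘ F
    set Q := H /ₘ F
    have hHQ : H = A + F * Q := (Polynomial.modByMonic_add_div H F).symm
    have hA : A.natDegree < C.n / C.e j := hFd ▸ Polynomial.natDegree_modByMonic_lt H hF hF1
    have hAlead : A ≠ 0 → ∃ κ : ℂ, κ ≠ 0 ∧ ∃ l : ℕ,
        ∀ {S : Type} [CommRing S] (ι : ℂ⟦X⟧ →+* S) (v : S),
          HasLead (ι PowerSeries.X) (C.e j * l) (ι (PowerSeries.C κ))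
            (valueAt ι C.n C.n_ne_zero (C.pt ι j v) A) := by
      intro hA0
      obtain ⟨κ, hκ, h, ⟨l, rfl⟩, hl⟩ := hlow A hA0 hA
      exact ⟨κ, hκ, l, hl⟩
    have hQlead : Q ≠ 0 → ∃ κ : ℂ, κ ≠ 0 ∧ ∃ m l : ℕ, m < q ∧
        ∀ {S : Type} [CommRing S] (ι : ℂ⟦X⟧ →+* S) (v : S),
          HasLead (ι PowerSeries.X) ((m + 1) * C.v (j + 1) + C.e j * l)
            (ι (PowerSeries.C κ) * v ^ (m + 1))
            (valueAt ι C.n C.n_ne_zero (C.pt ι j v) (F * Q)) := by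
      intro hQ0
      have hQd : Q.natDegree < q * (C.n / C.e j) := by
        have h1 : Q.natDegree = H.natDegree - F.natDegree := Polynomial.natDegree_divByMonic H hF
        have h2 : F.degree ≤ H.degree := by
          by_contra hlt
          exact hQ0 ((Polynomial.divByMonic_eq_zero_iff hF).2 (not_le.1 hlt))
        have h3 := Polynomial.natDegree_le_natDegree h2
        have h4 : (q + 1) * (C.n / C.e j) = q * (C.n / C.e j) + C.n / C.e j := by ring
        omega
      obtain ⟨κ, hκ, h, m, l, hm, rfl, hl⟩ := ih (by omega) Q hQ0 hQd
      obtain ⟨κ', hκ', hF'⟩ := C.semiroot_lead hj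
      refine ⟨κ' * κ, mul_ne_zero hκ' hκ, m, l, hm, fun ι v => ?_⟩
      have h5 := (hF' ι v).mul (hl ι v)
      rw [← map_mul] at h5
      convert h5 using 1
      · ring
      · rw [map_mul, map_mul]
        ring
    by_cases hA0 : A = 0
    · have hQ0 : Q ≠ 0 := by
        rintro h
        rw [hA0, h] at hHQ
        exact hH (by simpa using hHQ)
      obtain ⟨κ, hκ, m, l, hm, h⟩ := hQlead hQ0
      refine ⟨κ, hκ, _, m + 1, l, by omega, rfl, fun ι v => ?_⟩
      have := h ι v
      rwa [hHQ, hA0, zero_add]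
    · obtain ⟨κ, hκ, l, h⟩ := hAlead hA0
      by_cases hQ0 : Q = 0
      · refine ⟨κ, hκ, _, 0, l, by omega, rfl, fun ι v => ?_⟩
        have := h ι v
        rw [hHQ, hQ0, mul_zero, add_zero, pow_zero, mul_one, zero_mul, zero_add]
        exact this
      · obtain ⟨κ', hκ', m, l', hm, h'⟩ := hQlead hQ0
        -- Equality would imply that `e_j / e_{j+1}` divides `m + 1`, as
        -- `gcd (e_j, v_{j+1}) = e_{j+1}`, but `m + 1 ≤ q < e_j / e_{j+1}`.
        have hne : C.e j * l ≠ (m + 1) * C.v (j + 1) + C.e j * l' := by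
          intro heq
          have h1 : C.e j ∣ (m + 1) * C.v (j + 1) :=
            (Nat.dvd_add_left (dvd_mul_right (C.e j) l')).1 (heq ▸ dvd_mul_right _ _)
          have hpos : 0 < Nat.gcd (C.e j) (C.v (j + 1)) := by
            rw [C.gcd_e_v hj]
            exact C.e_pos _
          have h2 := Nat.coprime_div_gcd_div_gcd hpos
          rw [C.gcd_e_v hj] at h2
          have h3 : C.e j / C.e (j + 1) ∣ (m + 1) * (C.v (j + 1) / C.e (j + 1)) := by
            rw [← Nat.mul_div_assoc _ (C.e_dvd_v hj)]
            exact Nat.div_dvd_div (C.e_succ_dvd j) h1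
          have h4 := Nat.le_of_dvd (Nat.succ_pos _) (h2.dvd_of_dvd_mul_right h3)
          omega
        rcases lt_or_gt_of_ne hne with hlt | hlt
        · refine ⟨κ, hκ, _, 0, l, by omega, rfl, fun ι v => ?_⟩
          have := (h ι v).add_of_lt (h' ι v) hlt
          rw [hHQ, pow_zero, mul_one, zero_mul, zero_add, map_add]
          exact this
        · refine ⟨κ', hκ', _, m + 1, l', by omega, rfl, fun ι v => ?_⟩
          have := (h' ι v).add_of_lt (h ι v) hlt
          rw [hHQ, add_comm A, map_add]
          exact this

/-- Functions of degree less than `n / e_{j+1}` have a leading term that is a monomial in `v` on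
the family, with order divisible by `e_{j+1}`. -/
lemma monomial_lead_of_lowDegreeLead {j : ℕ} (hj : j < C.g) (hlow : C.LowDegreeLead j)
    (H : Polynomial ℂ⟦X⟧) (hH : H ≠ 0) (hdeg : H.natDegree < C.n / C.e (j + 1)) :
    ∃ κ : ℂ, κ ≠ 0 ∧ ∃ h m : ℕ, C.e (j + 1) ∣ h ∧
      ∀ {S : Type} [CommRing S] (ι : ℂ⟦X⟧ →+* S) (v : S),
        HasLead (ι PowerSeries.X) h (ι (PowerSeries.C κ) * v ^ m)
          (valueAt ι C.n C.n_ne_zero (C.pt ι j v) H) := by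
  have h1 : C.e j / C.e (j + 1) * (C.n / C.e j) = C.n / C.e (j + 1) := by
    rw [Nat.div_mul_div_comm (C.e_succ_dvd j) (C.e_dvd_n j), mul_comm (C.e (j + 1)),
      Nat.mul_div_mul_left _ _ (C.e_pos j)]
  obtain ⟨κ, hκ, h, m, l, -, rfl, hl⟩ :=
    C.lead_of_natDegree_lt_mul hj hlow _ le_rfl H hH (h1 ▸ hdeg)
  exact ⟨κ, hκ, _, m, dvd_add ((C.e_dvd_v hj).mul_left _) ((C.e_succ_dvd j).mul_right _), hl⟩

/-- Induction on `j`: on the next family the parameter `v` of the previous one is replaced by a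
non-zero constant plus terms of positive order, so that a monomial in `v` becomes a constant. -/
lemma lowDegreeLead {j : ℕ} (hj : j < C.g) : C.LowDegreeLead j := by
  induction j with
  | zero => exact C.lowDegreeLead_zero
  | succ j ih =>
    intro H hH hdeg
    obtain ⟨κ, hκ, h, m, hd, hl⟩ :=
      C.monomial_lead_of_lowDegreeLead (by omega) (ih (by omega)) H hH hdeg
    set c := PowerSeries.coeff (C.β (j + 1)) C.η
    have hlt := C.β_lt_succ hj
    have hc : c ≠ 0 := (C.β_mem (by omega)).2
    refine ⟨κ * c ^ m, mul_ne_zero hκ (pow_ne_zero _ hc), h, hd, fun ι v => ?_⟩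
    rw [C.pt_succ hj]
    refine (hl ι _).congr ?_
    rw [map_mul, map_mul, map_pow, map_pow, ← mul_sub]
    refine Dvd.dvd.mul_left ((?_ : _ ∣ _).trans (sub_dvd_pow_sub_pow _ _ m)) _
    exact C.dvd_middle_sub hj ι v

/-- A function of degree less than `n` has a leading term which is a monomial in `v` on the
family that passes through the last characteristic exponent. -/
lemma monomial_lead {g' : ℕ} (hg : C.g = g' + 1) (H : Polynomial ℂ⟦X⟧) (hH : H ≠ 0)
    (hdeg : H.natDegree < C.n) :
    ∃ κ : ℂ, κ ≠ 0 ∧ ∃ h m : ℕ,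
      ∀ {S : Type} [CommRing S] (ι : ℂ⟦X⟧ →+* S) (v : S),
        HasLead (ι PowerSeries.X) h (ι (PowerSeries.C κ) * v ^ m)
          (valueAt ι C.n C.n_ne_zero (C.pt ι g' v) H) := by
  have h1 : C.e (g' + 1) = 1 := by rw [← hg]; exact C.e_g (by omega)
  obtain ⟨κ, hκ, h, m, -, hl⟩ := C.monomial_lead_of_lowDegreeLead (by omega)
    (C.lowDegreeLead (j := g') (by omega)) H hH (by rw [h1, Nat.div_one]; exact hdeg)
  exact ⟨κ, hκ, h, m, hl⟩

/-- The family through a later characteristic exponent is part of each earlier family. -/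
lemma exists_pt_eq {j l : ℕ} (hj : j < l) (hl : l < C.g) {S : Type*} [CommRing S]
    (ι : ℂ⟦X⟧ →+* S) (v : S) : ∃ w : S, C.pt ι l v = C.pt ι j w ∧
      ι PowerSeries.X ∣ w - ι (PowerSeries.C (PowerSeries.coeff (C.β (j + 1)) C.η)) := by
  induction l, hj using Nat.le_induction generalizing v with
  | base => exact ⟨_, C.pt_succ hl ι v, C.dvd_middle_sub hl ι v⟩
  | succ l hjl ih =>
    rw [C.pt_succ hl]
    exact ih (by omega) _

/-- The value of the generators of the semigroup: an earlier semiroot has a constant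
leading coefficient on the family. -/
lemma semiroot_lead_of_lt {j l : ℕ} (hj : j < l) (hl : l < C.g) :
    ∃ κ : ℂ, κ ≠ 0 ∧ ∀ {S : Type} [CommRing S] (ι : ℂ⟦X⟧ →+* S) (v : S),
      HasLead (ι PowerSeries.X) (C.v (j + 1)) (ι (PowerSeries.C κ))
        (valueAt ι C.n C.n_ne_zero (C.pt ι l v) (C.semirootPoly j)) := by
  obtain ⟨κ, hκ, h⟩ := C.semiroot_lead (hj.trans hl)
  refine ⟨κ * PowerSeries.coeff (C.β (j + 1)) C.η,
    mul_ne_zero hκ (C.β_mem (hj.trans hl)).2, fun ι v => ?_⟩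
  obtain ⟨w, hw, hd⟩ := C.exists_pt_eq hj hl ι v
  rw [hw]
  refine (h ι w).congr ?_
  rw [map_mul, map_mul, ← mul_sub]
  exact hd.mul_left _

end PlaneBranch

/-! ### Division by elements with an invertible leading coefficient -/

/-- A ring in which power series in a parameter `t = ι X` can be evaluated, in which `t` is
not a zero divisor and belongs to the Jacobson radical. -/
structure IsSeriesRing {S : Type*} [CommRing S] (ι : ℂ⟦X⟧ →+* S) : Prop where
  mem_nonZeroDivisors : ι PowerSeries.X ∈ nonZeroDivisors S
  isUnit_one_add : ∀ s : S, IsUnit (1 + ι PowerSeries.X * s)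

lemma isSeriesRing_id : IsSeriesRing (RingHom.id ℂ⟦X⟧) where
  mem_nonZeroDivisors := mem_nonZeroDivisors_of_ne_zero PowerSeries.X_ne_zero
  isUnit_one_add s := by
    rw [PowerSeries.isUnit_iff_constantCoeff]
    simp

/-- A non-zero complex number as a unit of `S`. -/
def cst {S : Type*} [CommRing S] (ι : ℂ⟦X⟧ →+* S) : ℂˣ →* Sˣ :=
  Units.map (ι.comp PowerSeries.C).toMonoidHom

lemma hasLead_constantCoeff {S : Type*} [CommRing S] (ι : ℂ⟦X⟧ →+* S) (f : ℂ⟦X⟧) :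
    HasLead (ι PowerSeries.X) 0 (ι (PowerSeries.C (PowerSeries.constantCoeff f))) (ι f) := by
  have := (hasLead_of_coeff (f := f) (a := 0) (by simp)).map ι
  rwa [PowerSeries.coeff_zero_eq_constantCoeff_apply] at this

section

variable {S : Type*} [CommRing S] {ι : ℂ⟦X⟧ →+* S}

lemma IsSeriesRing.isUnit_add (hS : IsSeriesRing ι) (s : Sˣ) (r : S) :
    IsUnit (s + ι PowerSeries.X * r) := by
  have h : (s : S) + ι PowerSeries.X * r = s * (1 + ι PowerSeries.X * (↑s⁻¹ * r)) := by
    have := s.mul_inv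
    linear_combination (-ι PowerSeries.X * r) * this
  rw [h]
  exact s.isUnit.mul (hS.isUnit_one_add _)

lemma HasLead.exists_unit (hS : IsSeriesRing ι) {a : ℕ} {s : Sˣ} {x : S}
    (h : HasLead (ι PowerSeries.X) a s x) : ∃ u : Sˣ, x = ι PowerSeries.X ^ a * u := by
  obtain ⟨r, rfl⟩ := h
  obtain ⟨u, hu⟩ := hS.isUnit_add s r
  exact ⟨u, by rw [hu]⟩

lemma HasLead.mem_nonZeroDivisors (hS : IsSeriesRing ι) {a : ℕ} {s : Sˣ} {x : S}
    (h : HasLead (ι PowerSeries.X) a s x) : x ∈ nonZeroDivisors S := by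
  obtain ⟨u, rfl⟩ := h.exists_unit hS
  exact mul_mem (pow_mem hS.mem_nonZeroDivisors a) u.isUnit.mem_nonZeroDivisors

/-- An element of order `b` is divisible by one of order `a ≤ b` whose leading coefficient is a
unit, and the leading coefficient of the quotient is the quotient of the leading coefficients. -/
lemma HasLead.exists_div (hS : IsSeriesRing ι) {a b : ℕ} {s : Sˣ} {s' x y : S}
    (hx : HasLead (ι PowerSeries.X) a s x) (hy : HasLead (ι PowerSeries.X) b s' y)
    (hab : a ≤ b) :
    ∃ q, y = x * q ∧ HasLead (ι PowerSeries.X) (b - a) (↑s⁻¹ * s') q := by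
  obtain ⟨r, rfl⟩ := hx
  obtain ⟨r', rfl⟩ := hy
  obtain ⟨u, hu⟩ := hS.isUnit_add s r
  obtain ⟨l, rfl⟩ := Nat.exists_eq_add_of_le hab
  refine ⟨ι PowerSeries.X ^ l * (s' + ι PowerSeries.X * r') * ↑u⁻¹, ?_, ?_⟩
  · rw [← hu, pow_add]
    have := u.mul_inv
    linear_combination (-ι PowerSeries.X ^ a * ι PowerSeries.X ^ l *
      (s' + ι PowerSeries.X * r')) * this
  · rw [Nat.add_sub_cancel_left]
    refine ⟨↑u⁻¹ * (r' - ↑s⁻¹ * s' * r), ?_⟩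
    have h1 := u.mul_inv
    have h2 := s.mul_inv
    have h3 : (↑u⁻¹ : S) * s = 1 - ↑u⁻¹ * ι PowerSeries.X * r := by
      linear_combination h1 + (-↑u⁻¹ : S) * hu
    have h4 : (↑u⁻¹ : S) = ↑s⁻¹ - ↑u⁻¹ * ι PowerSeries.X * r * ↑s⁻¹ := by
      linear_combination (↑s⁻¹ : S) * h3 - (↑u⁻¹ : S) * h2
    linear_combination (ι PowerSeries.X ^ l * s') * h4

/-- The quotient of two principal units. -/
lemma HasLead.exists_div_principal (hS : IsSeriesRing ι) {d : ℕ} (hd : 1 ≤ d) {s s' u u' : S}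
    (hu : HasLead (ι PowerSeries.X) d s (u - 1)) (hu' : HasLead (ι PowerSeries.X) d s' (u' - 1)) :
    ∃ w, u' = u * w ∧ HasLead (ι PowerSeries.X) d (s' - s) (w - 1) := by
  obtain ⟨r, hr⟩ := hu
  obtain ⟨r', hr'⟩ := hu'
  obtain ⟨l, rfl⟩ := Nat.exists_eq_add_of_le' hd
  obtain ⟨z, hz⟩ := hS.isUnit_one_add (ι PowerSeries.X ^ l * (s + ι PowerSeries.X * r))
  have hz' : u = z := by
    rw [hz]
    linear_combination hr
  have h1 := z.mul_inv
  refine ⟨u' * ↑z⁻¹, ?_, ?_⟩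
  · rw [hz']
    linear_combination -u' * h1
  · set t := ι PowerSeries.X
    set w := (↑z⁻¹ : S)
    -- `w = 1 - t * m * w`
    have h2 : w = 1 - t * (t ^ l * (s + t * r)) * w := by
      linear_combination h1 - w * hz
    have h3 : u' * w - 1 = (u' - u) * w := by
      rw [hz']
      linear_combination h1
    refine ⟨(r' - r) * w - (s' - s) * (t ^ l * (s + t * r)) * w, ?_⟩
    rw [h3]
    linear_combination w * (hr' - hr) + t ^ (l + 1) * (s' - s) * h2

end

/-! ### The quotient of power series and the tangent direction -/

lemma quot_eq {f h q : ℂ⟦X⟧} (hh : h ≠ 0) (hf : f = h * q) : quot f h = q := by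
  subst hf
  by_cases hq : q = 0
  · simp [quot, hq]
  have h1 : (h * q).order.toNat - h.order.toNat = q.order.toNat := by
    rw [PowerSeries.order_mul, ENat.toNat_add (by simpa using hh) (by simpa using hq)]
    omega
  have h2 : PowerSeries.constantCoeff h.divXPowOrder ≠ 0 := by
    rw [Ne, PowerSeries.constantCoeff_divXPowOrder_eq_zero_iff]
    exact hh
  rw [quot, h1, PowerSeries.divXPowOrder_mul, mul_comm h.divXPowOrder, ← mul_assoc, mul_assoc,
    PowerSeries.mul_inv_cancel _ h2, mul_one, PowerSeries.X_pow_order_mul_divXPowOrder]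

lemma dir_of_eq_mul {x y q : ℂ⟦X⟧} (hx : x ≠ 0) (h : y = x * q) :
    (Param.mk x y).dir = some (PowerSeries.constantCoeff q) := by
  have h1 : x.order ≤ y.order := by
    rw [h, PowerSeries.order_mul]
    exact le_self_add
  rw [Param.dir]
  simp only
  rw [if_pos h1, quot_eq hx h]

lemma dir_of_order_lt {x y : ℂ⟦X⟧} (h : y.order < x.order) : (Param.mk x y).dir = none := by
  rw [Param.dir]
  simp only
  rw [if_neg (not_le.2 h)]

lemma infPoint_succ (γ : Param) (k : ℕ) :
    infPoint γ (k + 1) = (infPoint γ k).blowUp (k + 1) := rfl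

namespace InfPoint

variable {P : InfPoint} {k : ℕ}

lemma blowUp_of_some {c : ℂ} (h : P.curve.dir = some c) : P.blowUp k =
    { mapX := MvPolynomial.bind₁ ![MvPolynomial.X 0,
        MvPolynomial.X 0 * (MvPolynomial.X 1 + MvPolynomial.C c)] P.mapX
      mapY := MvPolynomial.bind₁ ![MvPolynomial.X 0,
        MvPolynomial.X 0 * (MvPolynomial.X 1 + MvPolynomial.C c)] P.mapY
      curve := ⟨P.curve.x, quot P.curve.y P.curve.x - PowerSeries.C c⟩
      divX := some k
      divY := open Classical in if c = 0 then P.divY else none } := by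
  rw [blowUp, h]

lemma blowUp_of_none (h : P.curve.dir = none) : P.blowUp k =
    { mapX := MvPolynomial.bind₁ ![MvPolynomial.X 0 * MvPolynomial.X 1,
        MvPolynomial.X 1] P.mapX
      mapY := MvPolynomial.bind₁ ![MvPolynomial.X 0 * MvPolynomial.X 1,
        MvPolynomial.X 1] P.mapY
      curve := ⟨quot P.curve.x P.curve.y, P.curve.y⟩
      divX := P.divX
      divY := some k } := by
  rw [blowUp, h]

end InfPoint

namespace PlaneBranch

variable (C : PlaneBranch)

/-! ### Lifting the family to the infinitely near points of the branch -/

/-- The tangent direction of the strict transform of the branch at its point `P_k`. -/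
def dirAt (k : ℕ) : Option ℂ := (infPoint C.param k).curve.dir

/-- `(x, y)` are the coordinates at the infinitely near point `P_k` of the point
`(t ^ n, ξ(t) + v t ^ β)` of the family. -/
def Lifts (g' : ℕ) {S : Type} [CommRing S] (ι : ℂ⟦X⟧ →+* S) (v : S) : ℕ → S → S → Prop
  | 0, x, y => x = ι PowerSeries.X ^ C.n ∧ y = C.pt ι g' v
  | k + 1, x', y' => ∃ x y, Lifts g' ι v k x y ∧
      ((∃ c, C.dirAt k = some c ∧ x ∈ nonZeroDivisors S ∧ x' = x ∧
          y = x * (y' + ι (PowerSeries.C c))) ∨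
        (C.dirAt k = none ∧ y ∈ nonZeroDivisors S ∧ y' = y ∧ x = x' * y))

/-- The member of the family through the infinitely near points that belongs to `v`. -/
def member (g' : ℕ) (v : ℂ⟦X⟧) : Param :=
  ⟨PowerSeries.X ^ C.n, C.pt (RingHom.id _) g' v⟩

/-- The members of the family have the same infinitely near points as the branch itself, up to
`P_k`. -/
def SameDir (g' k : ℕ) : Prop :=
  ∀ v : ℂ⟦X⟧ˣ, ∀ j < k, (infPoint (C.member g' v) j).curve.dir = C.dirAt j

/-- The value of the parameter at the branch itself. -/
def tailPart (g' : ℕ) : ℂ⟦X⟧ :=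
  PowerSeries.mk fun k => PowerSeries.coeff (k + C.β (g' + 1)) C.η

variable {C} {g' : ℕ}

lemma η_eq (C : PlaneBranch) (g' : ℕ) : C.η = C.pt (RingHom.id _) g' (C.tailPart g') := by
  ext k
  rw [pt, map_add, RingHom.id_apply, RingHom.id_apply, PowerSeries.coeff_mul_X_pow',
    coeff_initialPart]
  by_cases h : k < C.β (g' + 1)
  · rw [if_pos h, if_neg (not_le.2 h), add_zero]
  · rw [if_neg h, if_pos (not_lt.1 h), tailPart, PowerSeries.coeff_mk,
      Nat.sub_add_cancel (not_lt.1 h), zero_add]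

lemma constantCoeff_tailPart (C : PlaneBranch) (g' : ℕ) :
    PowerSeries.constantCoeff (C.tailPart g') = PowerSeries.coeff (C.β (g' + 1)) C.η := by
  rw [tailPart, ← PowerSeries.coeff_zero_eq_constantCoeff_apply, PowerSeries.coeff_mk, zero_add]

lemma exists_unit_tailPart (hg : C.g = g' + 1) : ∃ v : ℂ⟦X⟧ˣ, (v : ℂ⟦X⟧) = C.tailPart g' := by
  have h : IsUnit (C.tailPart g') := by
    rw [PowerSeries.isUnit_iff_constantCoeff, constantCoeff_tailPart]
    exact (C.β_mem (by omega)).2.isUnit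
  exact ⟨h.unit, rfl⟩

lemma param_eq_member (C : PlaneBranch) (g' : ℕ) :
    C.param = C.member g' (C.tailPart g') := by
  rw [param, member, ← η_eq]

/-- As long as a member of the family has the tangent directions of the branch, its strict
transforms are the lifts. -/
lemma curve_of_lifts {v : ℂ⟦X⟧} {k : ℕ} {x y : ℂ⟦X⟧}
    (hs : ∀ j < k, (infPoint (C.member g' v) j).curve.dir = C.dirAt j)
    (h : C.Lifts g' (RingHom.id _) v k x y) :
    (infPoint (C.member g' v) k).curve = ⟨x, y⟩ := by
  induction k generalizing x y with
  | zero =>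
    obtain ⟨rfl, rfl⟩ := h
    rfl
  | succ k ih =>
    obtain ⟨x₀, y₀, h0, h1⟩ := h
    have hc := ih (fun j hj => hs j (by omega)) h0
    have hd := hs k (by omega)
    rw [infPoint_succ]
    rcases h1 with ⟨c, h2, h3, rfl, h4⟩ | ⟨h2, h3, rfl, h4⟩
    · rw [InfPoint.blowUp_of_some (hd.trans h2), hc]
      simp only
      rw [quot_eq (nonZeroDivisors.ne_zero h3) h4, RingHom.id_apply, add_sub_cancel_right]
    · rw [InfPoint.blowUp_of_none (hd.trans h2), hc]
      simp only
      rw [quot_eq (nonZeroDivisors.ne_zero h3) (h4.trans (mul_comm _ _))]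

/-- If the lifts of all members of the family to `P_k` have the same tangent direction `δ`, then
this is the direction of the branch, which is one of the members, and all of them pass through
`P_{k+1}`. -/
lemma SameDir.succ (hg : C.g = g' + 1) {k : ℕ} (hs : C.SameDir g' k) {δ : Option ℂ}
    (h : ∀ v : ℂ⟦X⟧ˣ, ∃ x y, C.Lifts g' (RingHom.id _) v k x y ∧ (Param.mk x y).dir = δ) :
    C.SameDir g' (k + 1) ∧ C.dirAt k = δ := by
  have h1 : ∀ v : ℂ⟦X⟧ˣ, (infPoint (C.member g' v) k).curve.dir = δ := by
    intro v
    obtain ⟨x, y, hl, hd⟩ := h v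
    rw [curve_of_lifts (hs v) hl, hd]
  have h2 : C.dirAt k = δ := by
    obtain ⟨v, hv⟩ := exists_unit_tailPart hg
    rw [dirAt, param_eq_member C g', ← hv]
    exact h1 v
  refine ⟨fun v j hj => ?_, h2⟩
  rcases Nat.lt_succ_iff_lt_or_eq.1 hj with hj | rfl
  · exact hs v j hj
  · rw [h1, h2]

variable (C) in
/-- What is known at the point `P_k` before the family becomes separated: all its members pass
through `P_k`, no normal crossing has occurred, and an exceptional component that
is missing at `P_k` is accounted for by the orders `a` and `b` of the coordinates. -/
structure Unseparated (g' k a b : ℕ) : Prop where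
  sameDir : C.SameDir g' k
  not_normalCrossing : ∀ j ≤ k, ¬ (infPoint C.param j).IsNormalCrossing
  divX : (infPoint C.param k).divX ≠ none ∨ (k = 0 ∧ a < b)
  divY : 2 ≤ a ∨ (infPoint C.param k).divY ≠ none

/-- There is no normal crossing at a point of an exceptional component `x = 0` if the first
coordinate has order at least two on the branch or if `y = 0` is exceptional as well. -/
lemma not_normalCrossing_of_lifts (hg : C.g = g' + 1) {k a : ℕ} (hs : C.SameDir g' k)
    (hX : (infPoint C.param k).divX ≠ none)
    (hY : 2 ≤ a ∨ (infPoint C.param k).divY ≠ none)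
    (h : ∀ v : ℂ⟦X⟧ˣ, ∃ x y, C.Lifts g' (RingHom.id _) v k x y ∧ x.order = a) :
    ¬ (infPoint C.param k).IsNormalCrossing := by
  rintro ⟨-, h1, h2, -⟩
  obtain ⟨v, hv⟩ := exists_unit_tailPart hg
  obtain ⟨x, y, hl, ho⟩ := h v
  have hc := curve_of_lifts (hs v) hl
  rw [hv, ← param_eq_member] at hc
  have h3 := h2 hX
  rw [hc] at h3
  simp only at h3
  rw [ho] at h3
  have h4 : a = 1 := by exact_mod_cast h3
  have h5 : (infPoint C.param k).divY = none := h1.resolve_left hX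
  rcases hY with hY | hY
  · omega
  · exact hY h5

/-- A blowing-up in direction `c` keeps the family unseparated. For `c ≠ 0` the component `y = 0` is
lost, which is harmless if `a ≥ 2`. -/
lemma Unseparated.succ_some (hg : C.g = g' + 1) {k a b b' : ℕ} {c : ℂ}
    (h : C.Unseparated g' k a b) (hs : C.SameDir g' (k + 1)) (hd : C.dirAt k = some c)
    (hc : c = 0 ∨ 2 ≤ a)
    (hl : ∀ v : ℂ⟦X⟧ˣ, ∃ x y, C.Lifts g' (RingHom.id _) v (k + 1) x y ∧ x.order = a) :
    C.Unseparated g' (k + 1) a b' := by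
  have hX : (infPoint C.param (k + 1)).divX ≠ none := by
    rw [infPoint_succ, InfPoint.blowUp_of_some hd]
    simp
  have hY : 2 ≤ a ∨ (infPoint C.param (k + 1)).divY ≠ none := by
    rcases hc with rfl | hc
    · rw [infPoint_succ, InfPoint.blowUp_of_some hd]
      simpa using h.divY
    · exact Or.inl hc
  refine ⟨hs, fun j hj => ?_, Or.inl hX, hY⟩
  rcases Nat.le_succ_iff.1 hj with hj | rfl
  · exact h.not_normalCrossing j hj
  · exact not_normalCrossing_of_lifts hg hs hX hY hl

/-- A blowing-up in the vertical direction keeps the family unseparated. It does not occur at the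
origin, where `a < b`. -/
lemma Unseparated.succ_none (hg : C.g = g' + 1) {k a b a' b' : ℕ} (hab : b < a)
    (h : C.Unseparated g' k a b) (hs : C.SameDir g' (k + 1)) (hd : C.dirAt k = none)
    (hl : ∀ v : ℂ⟦X⟧ˣ, ∃ x y, C.Lifts g' (RingHom.id _) v (k + 1) x y ∧ x.order = a') :
    C.Unseparated g' (k + 1) a' b' := by
  have hX : (infPoint C.param (k + 1)).divX ≠ none := by
    rw [infPoint_succ, InfPoint.blowUp_of_none hd]
    exact h.divX.resolve_right (by omega)
  have hY : (infPoint C.param (k + 1)).divY ≠ none := by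
    rw [infPoint_succ, InfPoint.blowUp_of_none hd]
    simp
  refine ⟨hs, fun j hj => ?_, Or.inl hX, Or.inr hY⟩
  rcases Nat.le_succ_iff.1 hj with hj | rfl
  · exact h.not_normalCrossing j hj
  · exact not_normalCrossing_of_lifts hg hs hX (Or.inr hY) hl

/-! ### The two stages of the resolution of the family -/

variable (C) in
/-- The first stage: the two coordinates of the family at `P_k` are, up to a relative error
`t ^ d`, power series in `t ^ e` of orders `a` and `b`, and the relative error is led by
`κ v` and `κ' v`, where `κ` and `κ'` are not proportional to `a` and `b`.
The exponent `d` is not divisible by `e = e_{g-1}`. -/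
def FirstStage (g' k a b d : ℕ) : Prop :=
  1 ≤ a ∧ 1 ≤ b ∧ C.e g' ∣ a ∧ C.e g' ∣ b ∧ ¬ C.e g' ∣ d ∧
  ∃ f h : ℂ⟦X⟧, PowerSeries.constantCoeff f ≠ 0 ∧ PowerSeries.constantCoeff h ≠ 0 ∧
  ∃ κ κ' : ℂ, κ * b ≠ κ' * a ∧
  ∀ {S : Type} [CommRing S] (ι : ℂ⟦X⟧ →+* S), IsSeriesRing ι → ∀ v : Sˣ,
    ∃ x y u u' : S, C.Lifts g' ι v k x y ∧
      x = ι PowerSeries.X ^ a * ι (PowerSeries.expand (C.e g') (C.e_pos g').ne' f) * u ∧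
      y = ι PowerSeries.X ^ b * ι (PowerSeries.expand (C.e g') (C.e_pos g').ne' h) * u' ∧
      HasLead (ι PowerSeries.X) d (ι (PowerSeries.C κ) * v) (u - 1) ∧
      HasLead (ι PowerSeries.X) d (ι (PowerSeries.C κ') * v) (u' - 1)

variable (C) in
/-- The second stage: the leading terms of the two coordinates of the family at `P_k` are
constant multiples of `t ^ a * v ^ p` and `t ^ b * v ^ q`, which are multiplicatively
independent. -/
def SecondStage (g' k a b : ℕ) (p q : ℤ) : Prop :=
  1 ≤ a ∧ 1 ≤ b ∧ a * q ≠ b * p ∧ ∃ κ κ' : ℂˣ,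
  ∀ {S : Type} [CommRing S] (ι : ℂ⟦X⟧ →+* S), IsSeriesRing ι → ∀ v : Sˣ,
    ∃ x y : S, C.Lifts g' ι v k x y ∧
      HasLead (ι PowerSeries.X) a (cst ι κ * v ^ p : Sˣ) x ∧
      HasLead (ι PowerSeries.X) b (cst ι κ' * v ^ q : Sˣ) y

variable (C) in
/-- The end of the second stage: at `P_k` both coordinates of the family have the same order `a`,
and the leading coefficient of their quotient is a non-trivial monomial in `v`, so that the next
blowing-up separates the family. -/
def LastStage (g' k a : ℕ) : Prop :=
  C.Unseparated g' k a a ∧ 1 ≤ a ∧ ∃ (κ κ' : ℂˣ) (p q : ℤ), q ≠ 0 ∧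
  C.dirAt k = some (κ' * PowerSeries.coeff (C.β (g' + 1)) C.η ^ q) ∧
  ∀ {S : Type} [CommRing S] (ι : ℂ⟦X⟧ →+* S), IsSeriesRing ι → ∀ v : Sˣ,
    ∃ x z : S, C.Lifts g' ι v k x (x * z) ∧
      HasLead (ι PowerSeries.X) a (cst ι κ * v ^ p : Sˣ) x ∧
      HasLead (ι PowerSeries.X) 0 (cst ι κ' * v ^ q : Sˣ) z

lemma order_of_hasLead_unit {a : ℕ} {s : ℂ⟦X⟧ˣ} {x : ℂ⟦X⟧} (h : HasLead PowerSeries.X a s x) :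
    x.order = a := by
  obtain ⟨u, rfl⟩ := HasLead.exists_unit isSeriesRing_id h
  rw [RingHom.id_apply, PowerSeries.order_mul, PowerSeries.order_X_pow,
    PowerSeries.order_zero_of_unit u.isUnit, add_zero]

lemma constantCoeff_of_hasLead_zero {s x : ℂ⟦X⟧} (h : HasLead PowerSeries.X 0 s x) :
    PowerSeries.constantCoeff x = PowerSeries.constantCoeff s := by
  obtain ⟨r, rfl⟩ := h
  simp

lemma constantCoeff_of_hasLead_pos {a : ℕ} (ha : 1 ≤ a) {s x : ℂ⟦X⟧}
    (h : HasLead PowerSeries.X a s x) : PowerSeries.constantCoeff x = 0 := by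
  rw [← PowerSeries.X_dvd_iff]
  simpa using h.dvd ha

/-! ### Steps of the second stage -/

lemma monomial_div_monomial {G : Type*} [CommGroup G] (A B v : G) (p q : ℤ) :
    (A * v ^ p)⁻¹ * (B * v ^ q) = A⁻¹ * B * v ^ (q - p) := by
  rw [mul_inv, mul_mul_mul_comm, zpow_sub, mul_comm (v ^ q)]

/-- A step of the Euclidean algorithm on the exponents: `(a, b)` is replaced by `(a, b - a)`. -/
lemma SecondStage.step_lt (hg : C.g = g' + 1) {k a b : ℕ} {p q : ℤ} (hab : a < b)
    (hu : C.Unseparated g' k a b) (h : C.SecondStage g' k a b p q) :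
    C.Unseparated g' (k + 1) a (b - a) ∧ C.SecondStage g' (k + 1) a (b - a) p (q - p) := by
  obtain ⟨ha, hb, hpq, κ, κ', h⟩ := h
  obtain ⟨hs, hd⟩ := hu.sameDir.succ hg (δ := some 0) fun v => by
    obtain ⟨x, y, hl, hx, hy⟩ := h (RingHom.id _) isSeriesRing_id v
    obtain ⟨z, rfl, hz⟩ := hx.exists_div isSeriesRing_id hy hab.le
    refine ⟨x, _, hl, ?_⟩
    rw [dir_of_eq_mul (nonZeroDivisors.ne_zero (hx.mem_nonZeroDivisors isSeriesRing_id)) rfl,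
      constantCoeff_of_hasLead_pos (by omega) hz]
  have h2 : C.SecondStage g' (k + 1) a (b - a) p (q - p) := by
    refine ⟨ha, by omega, ?_, κ, κ⁻¹ * κ', fun {S} _ ι hS v => ?_⟩
    · intro h
      apply hpq
      push_cast [hab.le] at h
      linarith
    · obtain ⟨x, y, hl, hx, hy⟩ := h ι hS v
      obtain ⟨z, rfl, hz⟩ := hx.exists_div hS hy hab.le
      refine ⟨x, z, ⟨x, _, hl, Or.inl ⟨0, hd, hx.mem_nonZeroDivisors hS, rfl, by simp⟩⟩, hx, ?_⟩
      convert hz using 1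
      rw [← Units.val_mul, map_mul, map_inv, monomial_div_monomial]
  refine ⟨hu.succ_some hg hs hd (Or.inl rfl) fun v => ?_, h2⟩
  obtain ⟨-, -, -, κ, κ', h⟩ := h2
  obtain ⟨x, y, hl, hx, hy⟩ := h (RingHom.id _) isSeriesRing_id v
  exact ⟨x, y, hl, order_of_hasLead_unit hx⟩

/-- A step of the Euclidean algorithm on the exponents: `(a, b)` is replaced by `(a - b, b)`. -/
lemma SecondStage.step_gt (hg : C.g = g' + 1) {k a b : ℕ} {p q : ℤ} (hab : b < a)
    (hu : C.Unseparated g' k a b) (h : C.SecondStage g' k a b p q) :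
    C.Unseparated g' (k + 1) (a - b) b ∧ C.SecondStage g' (k + 1) (a - b) b (p - q) q := by
  obtain ⟨ha, hb, hpq, κ, κ', h⟩ := h
  obtain ⟨hs, hd⟩ := hu.sameDir.succ hg (δ := none) fun v => by
    obtain ⟨x, y, hl, hx, hy⟩ := h (RingHom.id _) isSeriesRing_id v
    refine ⟨x, y, hl, dir_of_order_lt ?_⟩
    rw [order_of_hasLead_unit hx, order_of_hasLead_unit hy]
    exact_mod_cast hab
  have h2 : C.SecondStage g' (k + 1) (a - b) b (p - q) q := by
    refine ⟨by omega, hb, ?_, κ'⁻¹ * κ, κ', fun {S} _ ι hS v => ?_⟩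
    · intro h
      apply hpq
      push_cast [hab.le] at h
      linarith
    · obtain ⟨x, y, hl, hx, hy⟩ := h ι hS v
      obtain ⟨z, rfl, hz⟩ := hy.exists_div hS hx hab.le
      refine ⟨z, y, ⟨_, y, hl, Or.inr ⟨hd, hy.mem_nonZeroDivisors hS, rfl, mul_comm _ _⟩⟩, ?_, hy⟩
      convert hz using 1
      rw [← Units.val_mul, map_mul, map_inv, monomial_div_monomial]
  refine ⟨hu.succ_none hg hab hs hd fun v => ?_, h2⟩
  obtain ⟨-, -, -, κ, κ', h⟩ := h2
  obtain ⟨x, y, hl, hx, hy⟩ := h (RingHom.id _) isSeriesRing_id v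
  exact ⟨x, y, hl, order_of_hasLead_unit hx⟩

/-- When the orders agree, the Euclidean algorithm stops; the exponent of `v` in the quotient of the
coordinates is not zero because the two monomials are independent. -/
lemma SecondStage.last (hg : C.g = g' + 1) {k a : ℕ} {p q : ℤ}
    (hu : C.Unseparated g' k a a) (h : C.SecondStage g' k a a p q) : C.LastStage g' k a := by
  obtain ⟨ha, -, hpq, κ, κ', h⟩ := h
  have h2 : ∀ {S : Type} [CommRing S] (ι : ℂ⟦X⟧ →+* S), IsSeriesRing ι → ∀ v : Sˣ,
    ∃ x z : S, C.Lifts g' ι v k x (x * z) ∧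
      HasLead (ι PowerSeries.X) a (cst ι κ * v ^ p : Sˣ) x ∧
      HasLead (ι PowerSeries.X) 0 (cst ι (κ⁻¹ * κ') * v ^ (q - p) : Sˣ) z := by
    intro S _ ι hS v
    obtain ⟨x, y, hl, hx, hy⟩ := h ι hS v
    obtain ⟨z, rfl, hz⟩ := hx.exists_div hS hy le_rfl
    refine ⟨x, z, hl, hx, ?_⟩
    rw [Nat.sub_self] at hz
    convert hz using 1
    rw [← Units.val_mul, map_mul, map_inv, monomial_div_monomial]
  refine ⟨hu, ha, κ, κ⁻¹ * κ', p, q - p, ?_, ?_, h2⟩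
  · intro h0
    apply hpq
    rw [sub_eq_zero.1 h0]
  · obtain ⟨v, hv⟩ := exists_unit_tailPart hg
    obtain ⟨x, z, hl, hx, hz⟩ := h2 (RingHom.id _) isSeriesRing_id v
    have hc := curve_of_lifts (hu.sameDir v) hl
    rw [hv, ← param_eq_member] at hc
    rw [dirAt, hc,
      dir_of_eq_mul (nonZeroDivisors.ne_zero (hx.mem_nonZeroDivisors isSeriesRing_id)) rfl,
      constantCoeff_of_hasLead_zero hz]
    congr 1
    rw [← constantCoeff_tailPart, ← hv]
    have h3 : ∀ s : ℂ⟦X⟧ˣ, PowerSeries.constantCoeff (s : ℂ⟦X⟧) =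
        (Units.map (PowerSeries.constantCoeff (R := ℂ)).toMonoidHom s : ℂˣ) := fun _ => rfl
    rw [h3, h3, map_mul, map_zpow, Units.val_mul, Units.val_zpow_eq_zpow_val]
    congr 1

lemma SecondStage.exists_last (hg : C.g = g' + 1) {k a b : ℕ} {p q : ℤ}
    (hu : C.Unseparated g' k a b) (h : C.SecondStage g' k a b p q) :
    ∃ k' a', C.LastStage g' k' a' := by
  induction hm : a + b using Nat.strong_induction_on generalizing k a b p q with
  | _ m ih =>
    have ha := h.1
    have hb := h.2.1
    rcases lt_trichotomy a b with hab | rfl | hab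
    · obtain ⟨h1, h2⟩ := h.step_lt hg hab hu
      exact ih _ (by omega) h1 h2 rfl
    · exact ⟨k, a, h.last hg hu⟩
    · obtain ⟨h1, h2⟩ := h.step_gt hg hab hu
      exact ih _ (by omega) h1 h2 rfl

/-! ### Steps of the first stage -/

section

variable {S : Type} [CommRing S] {ι : ℂ⟦X⟧ →+* S}

/-- The quotient of two coordinates of the shape they have in the first stage. -/
lemma exists_quotient_firstStage (hS : IsSeriesRing ι) {E : ℂ⟦X⟧ →+* ℂ⟦X⟧} {a b d : ℕ}
    (hab : a ≤ b) (hd : 1 ≤ d) {f h : ℂ⟦X⟧} (hf : PowerSeries.constantCoeff f ≠ 0)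
    {κ κ' : ℂ} {v u u' : S}
    (hu : HasLead (ι PowerSeries.X) d (ι (PowerSeries.C κ) * v) (u - 1))
    (hu' : HasLead (ι PowerSeries.X) d (ι (PowerSeries.C κ') * v) (u' - 1)) :
    ∃ w, ι PowerSeries.X ^ b * ι (E h) * u' =
        ι PowerSeries.X ^ a * ι (E f) * u *
          (ι PowerSeries.X ^ (b - a) * ι (E (h * f⁻¹)) * w) ∧
      HasLead (ι PowerSeries.X) d (ι (PowerSeries.C (κ' - κ)) * v) (w - 1) := by
  obtain ⟨w, hw, hl⟩ := hu.exists_div_principal hS hd hu'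
  refine ⟨w, ?_, ?_⟩
  · obtain ⟨l, rfl⟩ := Nat.exists_eq_add_of_le hab
    have h1 : ι (E h) = ι (E f) * ι (E (h * f⁻¹)) := by
      rw [← map_mul, ← map_mul, mul_left_comm, PowerSeries.mul_inv_cancel _ hf, mul_one]
    rw [h1, hw, Nat.add_sub_cancel_left]
    ring
  · rw [map_sub, map_sub, sub_mul]
    exact hl

lemma hasLead_firstStage {E : ℂ⟦X⟧ →+* ℂ⟦X⟧}
    (hE : ∀ f, PowerSeries.constantCoeff (E f) = PowerSeries.constantCoeff f)
    {a d : ℕ} (hd : 1 ≤ d) {f : ℂ⟦X⟧} {s u : S} (hu : HasLead (ι PowerSeries.X) d s (u - 1)) :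
    HasLead (ι PowerSeries.X) a (ι (PowerSeries.C (PowerSeries.constantCoeff f)))
      (ι PowerSeries.X ^ a * ι (E f) * u) := by
  have h1 : HasLead (ι PowerSeries.X) 0 1 u := by
    have h := HasLead.one (t := ι PowerSeries.X).add_of_dvd (hu.dvd (b := 0 + 1) (by omega))
    rwa [add_sub_cancel] at h
  have h2 : HasLead (ι PowerSeries.X) a 1 (ι PowerSeries.X ^ a) := ⟨0, by ring⟩
  have h3 := (h2.mul (hasLead_constantCoeff ι (E f))).mul h1
  rwa [hE, one_mul, mul_one, add_zero, add_zero] at h3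

end

lemma constantCoeff_div_ne_zero {f h : ℂ⟦X⟧} (hf : PowerSeries.constantCoeff f ≠ 0)
    (hh : PowerSeries.constantCoeff h ≠ 0) : PowerSeries.constantCoeff (h * f⁻¹) ≠ 0 := by
  rw [map_mul, PowerSeries.constantCoeff_inv]
  exact mul_ne_zero hh (inv_ne_zero hf)

variable (C) in
/-- Power series in `t ^ e`, for `e = e_{g-1}`. -/
abbrev expandE (g' : ℕ) : ℂ⟦X⟧ →+* ℂ⟦X⟧ :=
  (PowerSeries.expand (C.e g') (C.e_pos g').ne' : ℂ⟦X⟧ →ₐ[ℂ] ℂ⟦X⟧).toRingHom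

lemma constantCoeff_expandE (f : ℂ⟦X⟧) :
    PowerSeries.constantCoeff (C.expandE g' f) = PowerSeries.constantCoeff f :=
  PowerSeries.constantCoeff_expand _ _ _

lemma order_eq_of_hasLead_C {a : ℕ} {κ : ℂ} (hκ : κ ≠ 0) {x : ℂ⟦X⟧}
    (h : HasLead (RingHom.id ℂ⟦X⟧ PowerSeries.X) a (RingHom.id ℂ⟦X⟧ (PowerSeries.C κ)) x) :
    x.order = a := h.order_eq hκ

/-- A step of the Euclidean algorithm on the orders; the relative error keeps its order `d`. -/
lemma FirstStage.step_lt (hg : C.g = g' + 1) {k a b d : ℕ} (hab : a < b)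
    (hu : C.Unseparated g' k a b) (h : C.FirstStage g' k a b d) :
    C.Unseparated g' (k + 1) a (b - a) ∧ C.FirstStage g' (k + 1) a (b - a) d := by
  obtain ⟨ha, hb, hea, heb, hed, f, h₀, hf, hh, κ, κ', hκ, h⟩ := h
  have hd1 : 1 ≤ d := by
    rw [Nat.one_le_iff_ne_zero]
    rintro rfl
    exact hed (dvd_zero _)
  have hreg : ∀ {S : Type} [CommRing S] {ι : ℂ⟦X⟧ →+* S} (_ : IsSeriesRing ι) {s u : S}
      (_ : HasLead (ι PowerSeries.X) d s (u - 1)),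
      ι PowerSeries.X ^ a * ι (C.expandE g' f) * u ∈ nonZeroDivisors S := by
    intro S _ ι hS s u hu
    refine HasLead.mem_nonZeroDivisors hS (a := a) (s := cst ι (Units.mk0 _ hf)) ?_
    exact hasLead_firstStage constantCoeff_expandE hd1 hu
  obtain ⟨hs, hd⟩ := hu.sameDir.succ hg (δ := some 0) fun v => by
    obtain ⟨x, y, u, u', hl, rfl, rfl, hx, hy⟩ := h (RingHom.id _) isSeriesRing_id v
    obtain ⟨w, hw, -⟩ := exists_quotient_firstStage (E := C.expandE g') (h := h₀)
      isSeriesRing_id hab.le hd1 hf hx hy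
    refine ⟨_, _, hl, ?_⟩
    have hne := nonZeroDivisors.ne_zero (hreg isSeriesRing_id hx)
    refine (dir_of_eq_mul hne hw).trans ?_
    have h0 : b - a ≠ 0 := by omega
    simp [h0]
  have h2 : C.FirstStage g' (k + 1) a (b - a) d := by
    refine ⟨ha, by omega, hea, Nat.dvd_sub heb hea, hed, f, h₀ * f⁻¹, hf,
      constantCoeff_div_ne_zero hf hh, κ, κ' - κ, ?_, fun {S} _ ι hS v => ?_⟩
    · intro h
      apply hκ
      push_cast [hab.le] at h
      linear_combination h
    · obtain ⟨x, y, u, u', hl, rfl, rfl, hx, hy⟩ := h ι hS v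
      obtain ⟨w, hw, hw'⟩ := exists_quotient_firstStage (E := C.expandE g') (h := h₀)
        hS hab.le hd1 hf hx hy
      refine ⟨_, _, u, w, ⟨_, _, hl, Or.inl ⟨0, hd, hreg hS hx, rfl, ?_⟩⟩, rfl, rfl, hx, hw'⟩
      rw [map_zero, map_zero, add_zero]
      exact hw
  refine ⟨hu.succ_some hg hs hd (Or.inl rfl) fun v => ?_, h2⟩
  obtain ⟨-, -, -, -, -, f, h₀, hf, hh, κ, κ', hκ, h⟩ := h2
  obtain ⟨x, y, u, u', hl, rfl, rfl, hx, hy⟩ := h (RingHom.id _) isSeriesRing_id v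
  exact ⟨_, _, hl, order_eq_of_hasLead_C hf (hasLead_firstStage constantCoeff_expandE hd1 hx)⟩

/-- A step of the Euclidean algorithm on the orders; the relative error keeps its order `d`. -/
lemma FirstStage.step_gt (hg : C.g = g' + 1) {k a b d : ℕ} (hab : b < a)
    (hu : C.Unseparated g' k a b) (h : C.FirstStage g' k a b d) :
    C.Unseparated g' (k + 1) (a - b) b ∧ C.FirstStage g' (k + 1) (a - b) b d := by
  obtain ⟨ha, hb, hea, heb, hed, f, h₀, hf, hh, κ, κ', hκ, h⟩ := h
  have hd1 : 1 ≤ d := by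
    rw [Nat.one_le_iff_ne_zero]
    rintro rfl
    exact hed (dvd_zero _)
  have hreg : ∀ {S : Type} [CommRing S] {ι : ℂ⟦X⟧ →+* S} (_ : IsSeriesRing ι) {s u : S}
      (_ : HasLead (ι PowerSeries.X) d s (u - 1)),
      ι PowerSeries.X ^ b * ι (C.expandE g' h₀) * u ∈ nonZeroDivisors S := by
    intro S _ ι hS s u hu
    refine HasLead.mem_nonZeroDivisors hS (a := b) (s := cst ι (Units.mk0 _ hh)) ?_
    exact hasLead_firstStage constantCoeff_expandE hd1 hu
  obtain ⟨hs, hd⟩ := hu.sameDir.succ hg (δ := none) fun v => by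
    obtain ⟨x, y, u, u', hl, rfl, rfl, hx, hy⟩ := h (RingHom.id _) isSeriesRing_id v
    refine ⟨_, _, hl, dir_of_order_lt ?_⟩
    have h1 := order_eq_of_hasLead_C hf
      (hasLead_firstStage (a := a) (C.constantCoeff_expandE (g' := g')) hd1 hx)
    have h2 := order_eq_of_hasLead_C hh
      (hasLead_firstStage (a := b) (C.constantCoeff_expandE (g' := g')) hd1 hy)
    refine lt_of_eq_of_lt h2 (lt_of_lt_of_eq ?_ h1.symm)
    exact_mod_cast hab
  have h2 : C.FirstStage g' (k + 1) (a - b) b d := by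
    refine ⟨by omega, hb, Nat.dvd_sub hea heb, heb, hed, f * h₀⁻¹, h₀,
      constantCoeff_div_ne_zero hh hf, hh, κ - κ', κ', ?_, fun {S} _ ι hS v => ?_⟩
    · intro h
      apply hκ
      push_cast [hab.le] at h
      linear_combination h
    · obtain ⟨x, y, u, u', hl, rfl, rfl, hx, hy⟩ := h ι hS v
      obtain ⟨w, hw, hw'⟩ := exists_quotient_firstStage (E := C.expandE g') (h := f)
        hS hab.le hd1 hh hy hx
      refine ⟨_, _, w, u', ⟨_, _, hl, Or.inr ⟨hd, hreg hS hy, rfl, ?_⟩⟩, rfl, rfl, hw', hy⟩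
      exact hw.trans (mul_comm _ _)
  refine ⟨hu.succ_none hg hab hs hd fun v => ?_, h2⟩
  obtain ⟨-, -, -, -, -, f, h₀, hf, hh, κ, κ', hκ, h⟩ := h2
  obtain ⟨x, y, u, u', hl, rfl, rfl, hx, hy⟩ := h (RingHom.id _) isSeriesRing_id v
  exact ⟨_, _, hl, order_eq_of_hasLead_C hf (hasLead_firstStage constantCoeff_expandE hd1 hx)⟩

lemma expandE_C (c : ℂ) : C.expandE g' (PowerSeries.C c) = PowerSeries.C c :=
  PowerSeries.expand_C _ _ _

lemma expandE_X : C.expandE g' PowerSeries.X = PowerSeries.X ^ C.e g' :=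
  PowerSeries.expand_X _ _

/-- A power series in `t ^ e` either is divisible by `t ^ (d + 1)`, or has an order less
than `d`. -/
lemma expandE_cases {d : ℕ} (hed : ¬ C.e g' ∣ d) (p : ℂ⟦X⟧) :
    PowerSeries.X ^ (d + 1) ∣ C.expandE g' p ∨
      ∃ (o : ℕ) (p₁ : ℂ⟦X⟧), C.e g' * o < d ∧ PowerSeries.constantCoeff p₁ ≠ 0 ∧
        p = PowerSeries.X ^ o * p₁ := by
  by_cases hp : p = 0
  · left
    simp [hp]
  have h1 : p = PowerSeries.X ^ p.order.toNat * p.divXPowOrder :=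
    PowerSeries.X_pow_order_mul_divXPowOrder.symm
  by_cases hlt : C.e g' * p.order.toNat < d
  · right
    refine ⟨_, _, hlt, ?_, h1⟩
    rwa [Ne, PowerSeries.constantCoeff_divXPowOrder_eq_zero_iff]
  · left
    have h2 : d ≠ C.e g' * p.order.toNat := fun h => hed (h ▸ dvd_mul_right _ _)
    rw [h1, map_mul, map_pow, expandE_X, ← pow_mul]
    exact (pow_dvd_pow _ (by omega)).mul_right _

/-- If both coordinates have the same order, their quotient is a power series in `t ^ e` plus an
error that is led by a multiple of `v t ^ d`. After its constant term is removed, the order `b'` of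
the power series is either less than `d`, in which case the first stage goes on with the relative error
of order `d' = d - b'`, or greater than `d`, in which case the error has become the leading term
and the second stage begins. Equality is impossible since `e` does not divide `d`. -/
lemma FirstStage.step_eq (hg : C.g = g' + 1) {k a d : ℕ}
    (hu : C.Unseparated g' k a a) (h : C.FirstStage g' k a a d) :
    (∃ b' d', b' + d' = d ∧ C.Unseparated g' (k + 1) a b' ∧
        C.FirstStage g' (k + 1) a b' d') ∨
      (C.Unseparated g' (k + 1) a d ∧ C.SecondStage g' (k + 1) a d 0 1) := by
  obtain ⟨ha, -, hea, -, hed, f, h₀, hf, hh, κ, κ', hκ, h⟩ := h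
  have hd1 : 1 ≤ d := by
    rw [Nat.one_le_iff_ne_zero]
    rintro rfl
    exact hed (dvd_zero _)
  have ha2 : 2 ≤ a := (C.two_le_e (by omega)).trans (Nat.le_of_dvd ha hea)
  set φ := h₀ * f⁻¹ with hφ
  set c₀ := PowerSeries.constantCoeff φ with hc₀
  have hc₀' : c₀ ≠ 0 := constantCoeff_div_ne_zero hf hh
  have hκ' : κ' - κ ≠ 0 := fun h => hκ (by rw [sub_eq_zero.1 h])
  have hK : c₀ * (κ' - κ) ≠ 0 := mul_ne_zero hc₀' hκ'
  have hlead : ∀ {S : Type} [CommRing S] {ι : ℂ⟦X⟧ →+* S} {s u : S}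
      (_ : HasLead (ι PowerSeries.X) d s (u - 1)),
      HasLead (ι PowerSeries.X) a (cst ι (Units.mk0 _ hf))
        (ι PowerSeries.X ^ a * ι (C.expandE g' f) * u) := by
    intro S _ ι s u hu
    exact hasLead_firstStage constantCoeff_expandE hd1 hu
  -- the coordinates at the next point, before the direction `c₀` is subtracted
  have hq : ∀ {S : Type} [CommRing S] (ι : ℂ⟦X⟧ →+* S), IsSeriesRing ι → ∀ v : Sˣ,
      ∃ u w : S, HasLead (ι PowerSeries.X) d (ι (PowerSeries.C κ) * v) (u - 1) ∧
        HasLead (ι PowerSeries.X) d (ι (PowerSeries.C (κ' - κ)) * v) (w - 1) ∧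
        C.Lifts g' ι v k (ι PowerSeries.X ^ a * ι (C.expandE g' f) * u)
          (ι PowerSeries.X ^ a * ι (C.expandE g' f) * u * (ι (C.expandE g' φ) * w)) := by
    intro S _ ι hS v
    obtain ⟨x, y, u, u', hl, rfl, rfl, hx, hy⟩ := h ι hS v
    obtain ⟨w, hw, hw'⟩ := exists_quotient_firstStage (E := C.expandE g') (h := h₀)
      hS (le_refl a) hd1 hf hx hy
    refine ⟨u, w, hx, hw', ?_⟩
    rw [Nat.sub_self, pow_zero, one_mul (ι (C.expandE g' (h₀ * f⁻¹)))] at hw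
    rw [← hw]
    exact hl
  obtain ⟨hs, hd⟩ := hu.sameDir.succ hg (δ := some c₀) fun v => by
    obtain ⟨u, w, hx, hw, hl⟩ := hq (RingHom.id _) isSeriesRing_id v
    refine ⟨_, _, hl, ?_⟩
    rw [dir_of_eq_mul (nonZeroDivisors.ne_zero
      ((hlead hx).mem_nonZeroDivisors isSeriesRing_id)) rfl]
    have h1 := constantCoeff_of_hasLead_pos hd1 hw
    rw [map_sub, map_one, sub_eq_zero] at h1
    rw [map_mul, h1, mul_one, RingHom.id_apply, constantCoeff_expandE]
  have hnext : ∀ {S : Type} [CommRing S] (ι : ℂ⟦X⟧ →+* S), IsSeriesRing ι → ∀ v : Sˣ,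
      ∃ u z : S, HasLead (ι PowerSeries.X) d (ι (PowerSeries.C κ) * v) (u - 1) ∧
        HasLead (ι PowerSeries.X) d (ι (PowerSeries.C (c₀ * (κ' - κ))) * v) z ∧
        C.Lifts g' ι v (k + 1) (ι PowerSeries.X ^ a * ι (C.expandE g' f) * u)
          (ι (C.expandE g' (φ - PowerSeries.C c₀)) + z) := by
    intro S _ ι hS v
    obtain ⟨u, w, hx, hw, hl⟩ := hq ι hS v
    refine ⟨u, ι (C.expandE g' φ) * (w - 1), hx, ?_, _, _, hl, Or.inl
      ⟨c₀, hd, (hlead hx).mem_nonZeroDivisors hS, rfl, ?_⟩⟩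
    · have h1 := (hasLead_constantCoeff ι (C.expandE g' φ)).mul hw
      rw [constantCoeff_expandE, zero_add, ← mul_assoc, ← map_mul, ← map_mul] at h1
      exact h1
    · rw [map_sub, map_sub, expandE_C]
      ring
  have hunsep : ∀ b', C.Unseparated g' (k + 1) a b' := fun b' =>
    hu.succ_some hg hs hd (Or.inr ha2) fun v => by
      obtain ⟨u, z, hx, -, hl⟩ := hnext (RingHom.id _) isSeriesRing_id v
      exact ⟨_, _, hl, order_of_hasLead_unit (hlead hx)⟩
  rcases expandE_cases hed (φ - PowerSeries.C c₀) with hdvd | ⟨o, p₁, ho, hp₁, hp⟩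
  · right
    refine ⟨hunsep d, ha, hd1, by simp; omega, Units.mk0 _ hf, Units.mk0 _ hK,
      fun {S} _ ι hS v => ?_⟩
    obtain ⟨u, z, hx, hz, hl⟩ := hnext ι hS v
    refine ⟨_, _, hl, ?_, ?_⟩
    · rw [zpow_zero, mul_one]
      exact hlead hx
    · rw [zpow_one, add_comm]
      refine HasLead.add_of_dvd hz ?_
      rw [← map_pow]
      exact map_dvd ι hdvd
  · left
    have ho1 : 1 ≤ o := by
      rw [Nat.one_le_iff_ne_zero]
      rintro rfl
      apply hp₁
      rw [pow_zero, one_mul] at hp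
      rw [← hp, map_sub, PowerSeries.constantCoeff_C, sub_self]
    have he := C.e_pos g'
    obtain ⟨d', hd'⟩ := Nat.exists_eq_add_of_lt ho
    refine ⟨C.e g' * o, d' + 1, by omega, hunsep _, ha, Nat.mul_pos he ho1, hea,
      dvd_mul_right _ _, ?_, f, p₁, hf, hp₁, 0,
      (PowerSeries.constantCoeff p₁)⁻¹ * (c₀ * (κ' - κ)), ?_, fun {S} _ ι hS v => ?_⟩
    · intro h1
      apply hed
      rw [hd', add_assoc]
      exact dvd_add (dvd_mul_right _ _) h1
    · rw [zero_mul]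
      exact (mul_ne_zero (mul_ne_zero (inv_ne_zero hp₁) hK) (by exact_mod_cast (by omega))).symm
    · obtain ⟨u, z, hx, ⟨r, rfl⟩, hl⟩ := hnext ι hS v
      set s := ι (PowerSeries.C (c₀ * (κ' - κ))) * (v : S) with hs'
      refine ⟨_, _, u, 1 + ι (C.expandE g' p₁⁻¹) *
        (ι PowerSeries.X ^ (d' + 1) * (s + ι PowerSeries.X * r)), hl, rfl, ?_, ?_, ?_⟩
      · have h1 : ι (C.expandE g' p₁) * ι (C.expandE g' p₁⁻¹) = 1 := by
          rw [← map_mul, ← map_mul, PowerSeries.mul_inv_cancel _ hp₁, map_one, map_one]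
        have h2 : ι (C.expandE g' (φ - PowerSeries.C c₀)) =
            ι PowerSeries.X ^ (C.e g' * o) * ι (C.expandE g' p₁) := by
          rw [hp, map_mul, map_pow, expandE_X, ← pow_mul, map_mul, map_pow]
        rw [h2]
        change _ = ι PowerSeries.X ^ (C.e g' * o) * ι (C.expandE g' p₁) * _
        have h3 : ι PowerSeries.X ^ d =
            ι PowerSeries.X ^ (C.e g' * o) * ι PowerSeries.X ^ (d' + 1) := by
          rw [← pow_add]
          congr 1
        rw [h3]
        linear_combination (-ι PowerSeries.X ^ (C.e g' * o) * ι PowerSeries.X ^ (d' + 1) *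
          (s + ι PowerSeries.X * r)) * h1
      · have h1 : ι PowerSeries.X ^ (d' + 1 + 1) ∣ u - 1 := hx.dvd (by
          have := Nat.mul_pos he ho1
          omega)
        obtain ⟨q, hq'⟩ := h1
        exact ⟨q, by rw [hq', map_zero, map_zero]; ring⟩
      · rw [add_sub_cancel_left]
        have h1 := (hasLead_constantCoeff ι (C.expandE g' p₁⁻¹)).mul
          (⟨r, rfl⟩ : HasLead (ι PowerSeries.X) (d' + 1) s _)
        rw [constantCoeff_expandE, zero_add, PowerSeries.constantCoeff_inv, hs', ← mul_assoc,
          ← map_mul, ← map_mul] at h1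
        exact h1

/-- Each step of the first stage decreases `a + b + d`. -/
lemma FirstStage.exists_last (hg : C.g = g' + 1) {k a b d : ℕ}
    (hu : C.Unseparated g' k a b) (h : C.FirstStage g' k a b d) :
    ∃ k' a', C.LastStage g' k' a' := by
  induction hm : a + b + d using Nat.strong_induction_on generalizing k a b d with
  | _ m ih =>
    have ha := h.1
    have hb := h.2.1
    rcases lt_trichotomy a b with hab | rfl | hab
    · obtain ⟨h1, h2⟩ := h.step_lt hg hab hu
      exact ih _ (by omega) h1 h2 rfl
    · rcases h.step_eq hg hu with ⟨b', d', hd, h1, h2⟩ | ⟨h1, h2⟩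
      · exact ih _ (by omega) h1 h2 rfl
      · exact h2.exists_last hg h1
    · obtain ⟨h1, h2⟩ := h.step_gt hg hab hu
      exact ih _ (by omega) h1 h2 rfl

/-! ### The start of the resolution -/

/-- At the origin both coordinates have order at least two. -/
lemma unseparated_zero (C : PlaneBranch) {g' : ℕ} (hg : C.g = g' + 1) :
    C.Unseparated g' 0 C.n (C.β 1) := by
  have hn : 2 ≤ C.n := C.two_le_e (j := 0) (by omega)
  have hlt : C.n < C.β 1 := C.β_lt_succ (j := 0) (by omega)
  refine ⟨fun v j hj => absurd hj (Nat.not_lt_zero j), fun j hj => ?_, Or.inr ⟨rfl, hlt⟩,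
    Or.inl hn⟩
  rw [Nat.le_zero.1 hj]
  rintro ⟨h, -⟩
  have h1 : (2 : ℕ∞) ≤ min ((PowerSeries.X : ℂ⟦X⟧) ^ C.n).order C.η.order := by
    refine le_min ?_ ?_
    · rw [PowerSeries.order_X_pow]
      exact_mod_cast hn
    · refine PowerSeries.nat_le_order _ 2 fun k hk => ?_
      by_contra hc
      have := C.n_lt_of_coeff_ne_zero hc
      omega
  have h2 : min ((PowerSeries.X : ℂ⟦X⟧) ^ C.n).order C.η.order = 1 := h
  rw [h2] at h1
  exact absurd h1 (by decide)

/-- The resolution of the branch reaches the point where the family is separated. -/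
lemma exists_lastStage (C : PlaneBranch) {g' : ℕ} (hg : C.g = g' + 1) :
    ∃ k a, C.LastStage g' k a := by
  have hu := C.unseparated_zero hg
  have hn : 1 ≤ C.n := Nat.pos_of_ne_zero C.n_ne_zero
  have hβ : 1 ≤ C.β 1 := C.β_pos (by omega)
  have hX : ∀ {S : Type} [CommRing S] (ι : ℂ⟦X⟧ →+* S),
      HasLead (ι PowerSeries.X) C.n 1 (ι PowerSeries.X ^ C.n) := fun ι => ⟨0, by ring⟩
  rcases Nat.eq_zero_or_pos g' with rfl | hpos
  · have h0 : C.initialPart 0 = 0 := by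
      ext k
      rw [coeff_initialPart, map_zero]
      split_ifs with hk
      · by_contra hc
        exact absurd hk (not_lt.2 (C.normalized k hc))
      · rfl
    refine SecondStage.exists_last (p := 0) (q := 1) hg hu ⟨hn, hβ, ?_, 1, 1,
      fun {S} _ ι hS v => ⟨_, _, ⟨rfl, rfl⟩, ?_, ?_⟩⟩
    · simp
      omega
    · simpa using hX ι
    · rw [pt, h0, map_zero, zero_add, map_one, one_mul, zpow_one]
      exact ⟨0, by ring⟩
  · have hlt : C.β 1 < C.β (g' + 1) :=
      (C.β_le_of_le (show 1 ≤ g' by omega) (by omega)).trans_lt (C.β_lt_succ (by omega))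
    have hdvd : PowerSeries.X ^ (C.β 1 / C.e g') ∣ C.truncated g' := by
      rw [PowerSeries.X_pow_dvd_iff]
      intro k hk
      rw [truncated, PowerSeries.coeff_mk]
      split_ifs with h
      · by_contra hc
        have h1 := C.normalized _ hc
        have h2 : C.e g' * k < C.e g' * (C.β 1 / C.e g') :=
          Nat.mul_lt_mul_of_pos_left hk (C.e_pos g')
        rw [Nat.mul_div_cancel' (C.e_dvd_β (show 1 ≤ g' by omega))] at h2
        exact absurd h2 (not_lt.2 h1)
      · rfl
    obtain ⟨h₀, hh₀⟩ := hdvd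
    have hE : C.initialPart g' = PowerSeries.X ^ C.β 1 * C.expandE g' h₀ := by
      have h1 : C.initialPart g' = C.expandE g' (C.truncated g') := by
        ext k
        have h2 := C.expand_truncated g' 1 (C.e_pos g').ne' k
        rw [one_pow, mul_one, PowerSeries.rescale_one] at h2
        exact h2.symm
      rw [h1, hh₀, map_mul, map_pow, expandE_X, ← pow_mul,
        Nat.mul_div_cancel' (C.e_dvd_β (show 1 ≤ g' by omega))]
    have hh : PowerSeries.constantCoeff h₀ ≠ 0 := by
      have h1 := congr_arg (PowerSeries.coeff (C.β 1)) hE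
      rw [coeff_initialPart, if_pos hlt, PowerSeries.coeff_X_pow_mul', if_pos le_rfl, Nat.sub_self,
        PowerSeries.coeff_zero_eq_constantCoeff_apply, constantCoeff_expandE] at h1
      rw [← h1]
      exact (C.β_mem (by omega)).2
    refine FirstStage.exists_last (d := C.β (g' + 1) - C.β 1) hg hu ⟨hn, hβ, C.e_dvd_n g',
      C.e_dvd_β (by omega), ?_, 1, h₀, by simp, hh, 0, (PowerSeries.constantCoeff h₀)⁻¹, ?_,
      fun {S} _ ι hS v => ?_⟩
    · intro h
      refine (C.β_mem (show g' < C.g by omega)).1 ?_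
      have h1 := dvd_add h (C.e_dvd_β (show 1 ≤ g' by omega))
      rwa [Nat.sub_add_cancel hlt.le] at h1
    · rw [zero_mul]
      exact (mul_ne_zero (inv_ne_zero hh) (by exact_mod_cast C.n_ne_zero)).symm
    · refine ⟨_, _, 1, 1 + ι (C.expandE g' h₀⁻¹) *
        (ι PowerSeries.X ^ (C.β (g' + 1) - C.β 1) * v), ⟨rfl, rfl⟩, by simp, ?_, ⟨0, by simp⟩, ?_⟩
      · have h1 : ι (C.expandE g' h₀) * ι (C.expandE g' h₀⁻¹) = 1 := by
          rw [← map_mul, ← map_mul, PowerSeries.mul_inv_cancel _ hh, map_one, map_one]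
        have h2 : ι PowerSeries.X ^ C.β (g' + 1) =
            ι PowerSeries.X ^ C.β 1 * ι PowerSeries.X ^ (C.β (g' + 1) - C.β 1) := by
          rw [← pow_add, Nat.add_sub_cancel' hlt.le]
        rw [pt, hE, map_mul, map_pow, h2]
        change _ = ι PowerSeries.X ^ C.β 1 * ι (C.expandE g' h₀) * _
        linear_combination (-ι PowerSeries.X ^ C.β 1 *
          ι PowerSeries.X ^ (C.β (g' + 1) - C.β 1) * v) * h1
      · rw [add_sub_cancel_left]
        have h1 := (hasLead_constantCoeff ι (C.expandE g' h₀⁻¹)).mul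
          (⟨0, by ring⟩ : HasLead (ι PowerSeries.X) (C.β (g' + 1) - C.β 1) (v : S)
            (ι PowerSeries.X ^ (C.β (g' + 1) - C.β 1) * v))
        rwa [constantCoeff_expandE, zero_add, PowerSeries.constantCoeff_inv] at h1

end PlaneBranch

/-! ### Power series in two variables -/

/-- Power series in `t = X 0` and `u = X 1`. -/
abbrev Bi : Type := MvPowerSeries (Fin 2) ℂ

/-- Power series in one variable, as power series in the `i`-th of two variables. -/
def inVar (i : Fin 2) : ℂ⟦X⟧ →ₐ[ℂ] Bi := PowerSeries.substAlgHom (PowerSeries.HasSubst.X i)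

lemma inVar_apply (i : Fin 2) (f : ℂ⟦X⟧) :
    inVar i f = PowerSeries.subst (MvPowerSeries.X i : Bi) f := by
  rw [inVar, PowerSeries.coe_substAlgHom]

lemma inVar_X (i : Fin 2) : inVar i PowerSeries.X = MvPowerSeries.X i :=
  PowerSeries.substAlgHom_X _

lemma inVar_C (i : Fin 2) (c : ℂ) : inVar i (PowerSeries.C c) = MvPowerSeries.C c := by
  rw [inVar_apply, PowerSeries.subst_C]

lemma coeff_inVar (i : Fin 2) (f : ℂ⟦X⟧) (m : Fin 2 →₀ ℕ) :
    MvPowerSeries.coeff m (inVar i f) =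
      if m = Finsupp.single i (m i) then PowerSeries.coeff (m i) f else 0 := by
  classical
  rw [inVar_apply, PowerSeries.coeff_subst_single]

lemma constantCoeff_inVar (i : Fin 2) (f : ℂ⟦X⟧) :
    MvPowerSeries.constantCoeff (inVar i f) = PowerSeries.constantCoeff f := by
  rw [← MvPowerSeries.coeff_zero_eq_constantCoeff_apply, coeff_inVar]
  simp

lemma isUnit_of_constantCoeff_ne_zero {f : Bi} (h : MvPowerSeries.constantCoeff f ≠ 0) :
    IsUnit f := MvPowerSeries.isUnit_iff_constantCoeff.2 h.isUnit

lemma subst_pair_inVar_one {τ : Type*} {a b : MvPowerSeries τ ℂ}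
    (ha : MvPowerSeries.constantCoeff a = 0) (hb : MvPowerSeries.constantCoeff b = 0)
    (f : ℂ⟦X⟧) : MvPowerSeries.subst ![a, b] (inVar 1 f) = PowerSeries.subst b f := by
  have hs := hasSubst_pair ha hb
  rw [inVar_apply]
  refine (MvPowerSeries.subst_comp_subst_apply (R := ℂ) (S := ℂ) (T := ℂ)
    (PowerSeries.HasSubst.const (PowerSeries.HasSubst.X (1 : Fin 2))) hs f).trans ?_
  rw [PowerSeries.subst]
  congr 1
  funext _
  rw [MvPowerSeries.subst_X hs]
  rfl

/-- Every power series is, up to a multiple of `t`, a power series in `u`. -/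
lemma exists_eq_X_mul_add (f : Bi) : ∃ (r : Bi) (f₀ : ℂ⟦X⟧),
    f = MvPowerSeries.X 0 * r + inVar 1 f₀ := by
  set f₀ : ℂ⟦X⟧ := PowerSeries.mk fun k => MvPowerSeries.coeff (Finsupp.single 1 k) f
  have h : (MvPowerSeries.X 0 : Bi) ∣ f - inVar 1 f₀ := by
    rw [MvPowerSeries.X_dvd_iff]
    intro m hm
    have h1 : m = Finsupp.single 1 (m 1) := by
      ext i
      fin_cases i <;> simp [hm]
    rw [map_sub, coeff_inVar, if_pos h1, PowerSeries.coeff_mk, ← h1, sub_self]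
  obtain ⟨r, hr⟩ := h
  exact ⟨r, f₀, by rw [← hr]; ring⟩

/-- The restriction of a power series to the line `t = 0`. -/
def restrict : Bi →ₐ[ℂ] ℂ⟦X⟧ :=
  MvPowerSeries.substAlgHom (hasSubst_pair (τ := Unit) (a := 0) (b := (PowerSeries.X : ℂ⟦X⟧))
    (map_zero _) PowerSeries.constantCoeff_X)

lemma restrict_X_zero : restrict (MvPowerSeries.X 0) = 0 := by
  rw [restrict, MvPowerSeries.substAlgHom_X]
  rfl

lemma restrict_inVar (f : ℂ⟦X⟧) : restrict (inVar 1 f) = f := by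
  have h : restrict (inVar 1 f) =
      MvPowerSeries.subst ![(0 : ℂ⟦X⟧), PowerSeries.X] (inVar 1 f) := by
    rw [restrict, MvPowerSeries.coe_substAlgHom]
  rw [h]
  exact (subst_pair_inVar_one (τ := Unit) (map_zero _) PowerSeries.constantCoeff_X f).trans
    (PowerSeries.X_subst f)

lemma X_zero_dvd_iff {f : Bi} : (MvPowerSeries.X 0 : Bi) ∣ f ↔ restrict f = 0 := by
  constructor
  · rintro ⟨r, rfl⟩
    rw [map_mul, restrict_X_zero, zero_mul]
  · intro h
    obtain ⟨r, f₀, rfl⟩ := exists_eq_X_mul_add f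
    rw [map_add, map_mul, restrict_X_zero, zero_mul, zero_add, restrict_inVar] at h
    rw [h, map_zero, add_zero]
    exact dvd_mul_right _ _

lemma X_zero_ne_zero : (MvPowerSeries.X 0 : Bi) ≠ 0 := by
  intro h
  have h1 := inVar_X 0
  rw [h] at h1
  have h2 := congr_arg (MvPowerSeries.coeff (Finsupp.single 0 1)) h1
  rw [coeff_inVar] at h2
  simp at h2

lemma prime_X_zero : Prime (MvPowerSeries.X 0 : Bi) := by
  refine ⟨X_zero_ne_zero, fun h => ?_, fun a b h => ?_⟩
  · have h1 := X_zero_dvd_iff.1 (h.dvd (a := 1))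
    rw [map_one] at h1
    exact one_ne_zero h1
  · rw [X_zero_dvd_iff, map_mul] at h
    rw [X_zero_dvd_iff, X_zero_dvd_iff]
    exact mul_eq_zero.1 h

lemma isSeriesRing_inVar : IsSeriesRing (inVar 0).toRingHom where
  mem_nonZeroDivisors := by
    change inVar 0 PowerSeries.X ∈ _
    rw [inVar_X]
    exact mem_nonZeroDivisors_of_ne_zero (X_zero_ne_zero)
  isUnit_one_add s := by
    change IsUnit (1 + inVar 0 PowerSeries.X * s)
    rw [inVar_X]
    apply isUnit_of_constantCoeff_ne_zero
    simp

/-- A substitution whose first component is divisible by `t` and whose second component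
is not, preserves non-divisibility by the first variable. -/
lemma not_X_dvd_subst {x y f : Bi} (hx : (MvPowerSeries.X 0 : Bi) ∣ x)
    (hy0 : MvPowerSeries.constantCoeff y = 0) (hy : ¬ (MvPowerSeries.X 0 : Bi) ∣ y)
    (hf : ¬ (MvPowerSeries.X 0 : Bi) ∣ f) :
    ¬ (MvPowerSeries.X 0 : Bi) ∣ MvPowerSeries.subst ![x, y] f := by
  have hx0 : MvPowerSeries.constantCoeff x = 0 := by
    obtain ⟨r, rfl⟩ := hx
    simp
  have hs := hasSubst_pair hx0 hy0
  obtain ⟨r, f₀, rfl⟩ := exists_eq_X_mul_add f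
  have hf0 : f₀ ≠ 0 := by
    rintro rfl
    rw [map_zero, add_zero] at hf
    exact hf (dvd_mul_right _ _)
  have hu : MvPowerSeries.constantCoeff (inVar 1 f₀.divXPowOrder) ≠ 0 := by
    rwa [constantCoeff_inVar, Ne, PowerSeries.constantCoeff_divXPowOrder_eq_zero_iff]
  have hunit : IsUnit (MvPowerSeries.subst ![x, y] (inVar 1 f₀.divXPowOrder)) := by
    have := (isUnit_of_constantCoeff_ne_zero hu).map (MvPowerSeries.substAlgHom (R := ℂ) hs)
    rwa [MvPowerSeries.coe_substAlgHom] at this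
  have h1 : MvPowerSeries.subst ![x, y] (MvPowerSeries.X 0 * r + inVar 1 f₀) =
      x * MvPowerSeries.subst ![x, y] r +
        y ^ f₀.order.toNat * MvPowerSeries.subst ![x, y] (inVar 1 f₀.divXPowOrder) := by
    conv_lhs => rw [← PowerSeries.X_pow_order_mul_divXPowOrder (f := f₀)]
    rw [map_mul, map_pow, inVar_X, MvPowerSeries.subst_add hs, MvPowerSeries.subst_mul hs,
      MvPowerSeries.subst_mul hs, MvPowerSeries.subst_pow hs, MvPowerSeries.subst_X hs,
      MvPowerSeries.subst_X hs]
    rfl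
  rw [h1, dvd_add_right (hx.mul_right _)]
  intro h
  rcases prime_X_zero.dvd_or_dvd h with h | h
  · exact hy (prime_X_zero.dvd_of_dvd_pow h)
  · exact prime_X_zero.not_isUnit (isUnit_of_dvd_unit h hunit)

lemma exists_eq_X_pow_mul {f : Bi} (hf : f ≠ 0) :
    ∃ (m : ℕ) (r : Bi), f = MvPowerSeries.X 0 ^ m * r ∧ ¬ (MvPowerSeries.X 0 : Bi) ∣ r := by
  obtain ⟨e, he⟩ : ∃ e, MvPowerSeries.coeff e f ≠ 0 := by
    by_contra! h
    exact hf (MvPowerSeries.ext h)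
  have hfin : FiniteMultiplicity (MvPowerSeries.X 0 : Bi) f := by
    refine ⟨e 0, fun h => he ?_⟩
    exact MvPowerSeries.X_pow_dvd_iff.1 h e (Nat.lt_succ_self _)
  obtain ⟨r, hr, hr'⟩ := hfin.exists_eq_pow_mul_and_not_dvd
  exact ⟨_, r, hr, hr'⟩

/-- Orders with respect to `t` after a substitution whose first component is `t ^ a` times a
unit are multiples of `a`. -/
lemma dvd_of_subst_eq {x y f : Bi} {a N : ℕ} (ha : 1 ≤ a) {u w : Biˣ}
    (hx : x = (MvPowerSeries.X 0 : Bi) ^ a * (u : Bi)) (hy0 : MvPowerSeries.constantCoeff y = 0)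
    (hy : ¬ (MvPowerSeries.X 0 : Bi) ∣ y)
    (hf : MvPowerSeries.subst ![x, y] f = (MvPowerSeries.X 0 : Bi) ^ N * (w : Bi)) : a ∣ N := by
  have hxd : (MvPowerSeries.X 0 : Bi) ∣ x := by
    rw [hx]
    exact (dvd_pow_self (MvPowerSeries.X 0 : Bi) (by omega)).mul_right _
  have hx0 : MvPowerSeries.constantCoeff x = 0 := by
    obtain ⟨r, rfl⟩ := hxd
    simp
  have hs := hasSubst_pair hx0 hy0
  have hf0 : f ≠ 0 := by
    rintro rfl
    have h0 : MvPowerSeries.subst ![x, y] (0 : Bi) = 0 := by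
      rw [← MvPowerSeries.coe_substAlgHom hs, map_zero]
    rw [h0] at hf
    exact mul_ne_zero (pow_ne_zero _ (X_zero_ne_zero)) w.ne_zero hf.symm
  obtain ⟨m, r, rfl, hr⟩ := exists_eq_X_pow_mul hf0
  have hr' := not_X_dvd_subst hxd hy0 hy hr
  rw [MvPowerSeries.subst_mul hs, MvPowerSeries.subst_pow hs, MvPowerSeries.subst_X hs] at hf
  change x ^ m * _ = _ at hf
  have hxm : x ^ m = (MvPowerSeries.X 0 : Bi) ^ (a * m) * (u : Bi) ^ m := by
    rw [hx, mul_pow, ← pow_mul]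
  rw [hxm, mul_assoc] at hf
  set T : Bi := MvPowerSeries.X 0
  have hT : T ≠ 0 := X_zero_ne_zero
  suffices h : a * m = N from ⟨m, h.symm⟩
  rcases lt_trichotomy (a * m) N with h | h | h
  · exfalso
    obtain ⟨l, rfl⟩ := Nat.exists_eq_add_of_lt h
    rw [add_assoc, pow_add, mul_assoc] at hf
    have h1 := mul_left_cancel₀ (pow_ne_zero _ hT) hf
    have h2 : T ∣ (u : Bi) ^ m * MvPowerSeries.subst ![x, y] r := by
      rw [h1]
      exact (dvd_pow_self _ (by omega)).mul_right _
    rcases prime_X_zero.dvd_or_dvd h2 with h2 | h2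
    · exact prime_X_zero.not_isUnit (isUnit_of_dvd_unit h2 (u.isUnit.pow m))
    · exact hr' h2
  · exact h
  · exfalso
    obtain ⟨l, hl⟩ := Nat.exists_eq_add_of_lt h
    rw [hl, add_assoc, pow_add, mul_assoc] at hf
    have h1 := mul_left_cancel₀ (pow_ne_zero _ hT) hf
    have h2 : T ∣ w := by
      rw [← h1]
      exact (dvd_pow_self _ (by omega)).mul_right _
    exact prime_X_zero.not_isUnit (isUnit_of_dvd_unit h2 w.isUnit)

/-! ### Derivations and integral powers of units -/

lemma derivation_zpow {A : Type*} [CommRing A] [Algebra ℂ A] (D : Derivation ℂ A A) (v : Aˣ)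
    (q : ℤ) : D ((v ^ q : Aˣ) : A) = (q : A) * ((v ^ (q - 1) : Aˣ) : A) * D v := by
  have hnat : ∀ m : ℕ, D ((v ^ (m : ℤ) : Aˣ) : A) =
      ((m : ℤ) : A) * ((v ^ ((m : ℤ) - 1) : Aˣ) : A) * D v := by
    intro m
    cases m with
    | zero => simp
    | succ m =>
      have h1 : ((m + 1 : ℕ) : ℤ) - 1 = m := by push_cast; ring
      rw [h1, zpow_natCast, zpow_natCast, Units.val_pow_eq_pow_val, Units.val_pow_eq_pow_val,
        Derivation.leibniz_pow]
      simp
      ring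
  rcases Int.eq_nat_or_neg q with ⟨m, rfl | rfl⟩
  · exact hnat m
  · have h1 : ((v ^ (-(m : ℤ)) : Aˣ) : A) * ((v ^ (m : ℤ) : Aˣ) : A) = 1 := by
      rw [← Units.val_mul, ← zpow_add, neg_add_cancel, zpow_zero, Units.val_one]
    rw [D.leibniz_of_mul_eq_one h1, hnat, smul_eq_mul]
    have h2 : ((v ^ (-(m : ℤ)) : Aˣ) : A) ^ 2 * ((v ^ ((m : ℤ) - 1) : Aˣ) : A) =
        ((v ^ (-(m : ℤ) - 1) : Aˣ) : A) := by
      rw [pow_two, ← Units.val_mul, ← Units.val_mul, ← zpow_add, ← zpow_add]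
      congr 2
      ring
    rw [← h2]
    push_cast
    ring

/-! ### The blow-down maps -/

lemma constantCoeff_bind₁ {σ : Fin 2 → MvPolynomial (Fin 2) ℂ}
    (hσ : ∀ i, MvPolynomial.constantCoeff (σ i) = 0) (p : MvPolynomial (Fin 2) ℂ) :
    MvPolynomial.constantCoeff (MvPolynomial.bind₁ σ p) = MvPolynomial.constantCoeff p := by
  induction p using MvPolynomial.induction_on with
  | C a => simp
  | add p q hp hq => simp [hp, hq]
  | mul_X p i hp => simp [hσ]

lemma constantCoeff_map_infPoint (γ : Param) (k : ℕ) :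
    MvPolynomial.constantCoeff (infPoint γ k).mapX = 0 ∧
      MvPolynomial.constantCoeff (infPoint γ k).mapY = 0 := by
  induction k with
  | zero => simp [infPoint]
  | succ k ih =>
    rw [infPoint_succ]
    cases h : (infPoint γ k).curve.dir with
    | some c =>
      rw [InfPoint.blowUp_of_some h]
      simp only
      rw [constantCoeff_bind₁, constantCoeff_bind₁]
      · exact ih
      all_goals intro i; fin_cases i <;> simp
    | none =>
      rw [InfPoint.blowUp_of_none h]
      simp only
      rw [constantCoeff_bind₁, constantCoeff_bind₁]
      · exact ih
      all_goals intro i; fin_cases i <;> simp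

namespace PlaneBranch

variable {C : PlaneBranch} {g' : ℕ}

/-- The blow-down map takes the coordinates of a lift back to the family. -/
lemma eval₂_map_of_lifts {S : Type} [CommRing S] {ι : ℂ⟦X⟧ →+* S} {v : S} {k : ℕ} {x y : S}
    (h : C.Lifts g' ι v k x y) :
    MvPolynomial.eval₂Hom (ι.comp PowerSeries.C) ![x, y] (infPoint C.param k).mapX =
        ι PowerSeries.X ^ C.n ∧
      MvPolynomial.eval₂Hom (ι.comp PowerSeries.C) ![x, y] (infPoint C.param k).mapY =
        C.pt ι g' v := by
  induction k generalizing x y with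
  | zero =>
    obtain ⟨rfl, rfl⟩ := h
    simp [infPoint]
  | succ k ih =>
    obtain ⟨x₀, y₀, h0, h1⟩ := h
    have h2 := ih h0
    rw [infPoint_succ]
    rcases h1 with ⟨c, hd, -, rfl, hy⟩ | ⟨hd, -, rfl, hx⟩
    · rw [InfPoint.blowUp_of_some hd]
      simp only
      rw [MvPolynomial.eval₂Hom_bind₁, MvPolynomial.eval₂Hom_bind₁]
      have h3 : (fun i => MvPolynomial.eval₂Hom (ι.comp PowerSeries.C) ![x, y]
          (![MvPolynomial.X 0, MvPolynomial.X 0 * (MvPolynomial.X 1 + MvPolynomial.C c)] i)) =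
          ![x, y₀] := by
        funext i
        fin_cases i
        · simp
        · simp [hy]
      rw [h3]
      exact h2
    · rw [InfPoint.blowUp_of_none hd]
      simp only
      rw [MvPolynomial.eval₂Hom_bind₁, MvPolynomial.eval₂Hom_bind₁]
      have h3 : (fun i => MvPolynomial.eval₂Hom (ι.comp PowerSeries.C) ![x, y]
          (![MvPolynomial.X 0 * MvPolynomial.X 1, MvPolynomial.X 1] i)) =
          ![x₀, y] := by
        funext i
        fin_cases i
        · simp [hx]
        · simp
      rw [h3]
      exact h2

/-! ### The chart in which the family is separated -/

variable (C) in
/-- The last characteristic coefficient plus a variable. -/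
def genericValue (g' : ℕ) : Bi :=
  MvPowerSeries.C (PowerSeries.coeff (C.β (g' + 1)) C.η) + MvPowerSeries.X 1

lemma exists_unit_genericValue (hg : C.g = g' + 1) : ∃ v : Biˣ, (v : Bi) = C.genericValue g' := by
  have h : IsUnit (C.genericValue g') := by
    apply isUnit_of_constantCoeff_ne_zero
    rw [genericValue]
    simpa using (C.β_mem (show g' < C.g by omega)).2
  exact ⟨h.unit, rfl⟩

variable (C) in
/-- The coordinates of the generic member of the family at `P_k` define a map that is ramified
of order `a` along `t = 0`. -/
def SeparatingChart (g' k a : ℕ) (x y : Bi) : Prop :=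
  C.Lifts g' (inVar 0).toRingHom (C.genericValue g') k x y ∧
  (∃ u : Biˣ, x = (MvPowerSeries.X 0 : Bi) ^ a * (u : Bi)) ∧
  MvPowerSeries.constantCoeff y = 0 ∧
  MvPowerSeries.constantCoeff (MvPowerSeries.pderiv ℂ 1 y) ≠ 0

lemma constantCoeff_unit_zpow (v : Biˣ) (q : ℤ) :
    MvPowerSeries.constantCoeff ((v ^ q : Biˣ) : Bi) =
      MvPowerSeries.constantCoeff (v : Bi) ^ q := by
  have h : ∀ s : Biˣ, MvPowerSeries.constantCoeff (s : Bi) =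
      (Units.map (MvPowerSeries.constantCoeff (R := ℂ) (σ := Fin 2)).toMonoidHom s : ℂˣ) :=
    fun _ => rfl
  rw [h, h, map_zpow, Units.val_zpow_eq_zpow_val]

/-- The second coordinate in the new chart is `κ' (v ^ q - c ^ q)` up to a multiple of `t`. Its
derivative with respect to `v = c + u` does not vanish at the origin, since `q ≠ 0` and `c ≠ 0`. -/
lemma LastStage.exists_chart (hg : C.g = g' + 1) {k a : ℕ} (h : C.LastStage g' k a) :
    ∃ x y, C.SeparatingChart g' (k + 1) a x y := by
  obtain ⟨-, -, κ, κ', p, q, hq, hd, h⟩ := h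
  obtain ⟨v, hv⟩ := exists_unit_genericValue hg
  obtain ⟨x, z, hl, hx, r, hz⟩ := h (inVar 0).toRingHom isSeriesRing_inVar v
  set c := PowerSeries.coeff (C.β (g' + 1)) C.η with hc
  have hc0 : c ≠ 0 := (C.β_mem (show g' < C.g by omega)).2
  have hvc : MvPowerSeries.constantCoeff (v : Bi) = c := by
    rw [hv, genericValue]
    simp [← hc]
  have hXt : (inVar 0).toRingHom PowerSeries.X = (MvPowerSeries.X 0 : Bi) := inVar_X 0
  have hκ' : (cst (inVar 0).toRingHom κ' : Bi) = MvPowerSeries.C (κ' : ℂ) := inVar_C 0 _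
  rw [pow_zero, one_mul, hXt, Units.val_mul, hκ'] at hz
  refine ⟨x, z - (inVar 0).toRingHom (PowerSeries.C (κ' * c ^ q)), ⟨x, _, hv ▸ hl, Or.inl
    ⟨_, hd, hx.mem_nonZeroDivisors isSeriesRing_inVar, rfl, by ring⟩⟩, ?_, ?_, ?_⟩
  · obtain ⟨u, hu⟩ := hx.exists_unit isSeriesRing_inVar
    rw [hXt] at hu
    exact ⟨u, hu⟩
  · have h1 : (inVar 0).toRingHom (PowerSeries.C (κ' * c ^ q)) =
        (MvPowerSeries.C ((κ' : ℂ) * c ^ q) : Bi) := inVar_C 0 _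
    rw [h1, hz]
    simp [constantCoeff_unit_zpow, hvc]
  · have h1 : (inVar 0).toRingHom (PowerSeries.C (κ' * c ^ q)) =
        (MvPowerSeries.C ((κ' : ℂ) * c ^ q) : Bi) := inVar_C 0 _
    have h2 : MvPowerSeries.pderiv ℂ 1 (v : Bi) = 1 := by
      rw [hv, genericValue, map_add, MvPowerSeries.pderiv_C, MvPowerSeries.pderiv_X_self, zero_add]
    have h3 : MvPowerSeries.pderiv ℂ 1 (MvPowerSeries.X 0 : Bi) = 0 :=
      MvPowerSeries.pderiv_X_of_ne (by decide)
    rw [h1, hz, map_sub, MvPowerSeries.pderiv_C, sub_zero, map_add, Derivation.leibniz,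
      Derivation.leibniz, h3, MvPowerSeries.pderiv_C, derivation_zpow, h2]
    simp only [smul_eq_mul, mul_one, mul_zero, add_zero, map_add, map_mul,
      MvPowerSeries.constantCoeff_C, MvPowerSeries.constantCoeff_X, zero_mul,
      constantCoeff_unit_zpow, hvc, map_intCast]
    exact mul_ne_zero κ'.ne_zero (mul_ne_zero (by exact_mod_cast hq) (zpow_ne_zero _ hc0))

namespace SeparatingChart

variable {k a : ℕ} {x y : Bi}

lemma not_dvd (h : C.SeparatingChart g' k a x y) : ¬ (MvPowerSeries.X 0 : Bi) ∣ y := by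
  rintro ⟨r, rfl⟩
  apply h.2.2.2
  rw [Derivation.leibniz, MvPowerSeries.pderiv_X_of_ne (show (0 : Fin 2) ≠ 1 by decide)]
  simp

lemma constantCoeff_x (h : C.SeparatingChart g' k a x y) (ha : 1 ≤ a) :
    MvPowerSeries.constantCoeff x = 0 := by
  obtain ⟨-, ⟨u, rfl⟩, -⟩ := h
  have : a ≠ 0 := by omega
  simp [this]

/-- The separating chart followed by the blow-down map is the generic member of the family. -/
lemma aeval_map (h : C.SeparatingChart g' k a x y) :
    MvPolynomial.aeval ![x, y] (infPoint C.param k).mapX = (MvPowerSeries.X 0 : Bi) ^ C.n ∧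
      MvPolynomial.aeval ![x, y] (infPoint C.param k).mapY =
        C.pt (inVar 0).toRingHom g' (C.genericValue g') := by
  have h1 := eval₂_map_of_lifts h.1
  have h2 : (inVar 0).toRingHom.comp PowerSeries.C = (algebraMap ℂ Bi) := by
    ext1 c
    exact inVar_C 0 c
  have h3 : (inVar 0).toRingHom PowerSeries.X = (MvPowerSeries.X 0 : Bi) := inVar_X 0
  rw [h2, h3] at h1
  exact h1

end SeparatingChart

lemma hasSubst_map (γ : Param) (k : ℕ) : MvPowerSeries.HasSubst
    (![((infPoint γ k).mapX : Bi), ((infPoint γ k).mapY : Bi)] : Fin 2 → Bi) := by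
  obtain ⟨h1, h2⟩ := constantCoeff_map_infPoint γ k
  refine hasSubst_pair ?_ ?_
  · rw [← MvPowerSeries.coeff_zero_eq_constantCoeff_apply, MvPolynomial.coeff_coe]
    exact h1
  · rw [← MvPowerSeries.coeff_zero_eq_constantCoeff_apply, MvPolynomial.coeff_coe]
    exact h2

lemma SeparatingChart.subst_subst {k a : ℕ} {x y : Bi} (h : C.SeparatingChart g' k a x y)
    (ha : 1 ≤ a) (G : Bi) :
    MvPowerSeries.subst ![x, y] (MvPowerSeries.subst
        ![((infPoint C.param k).mapX : Bi), ((infPoint C.param k).mapY : Bi)] G) =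
      MvPowerSeries.subst ![(MvPowerSeries.X 0 : Bi) ^ C.n,
        C.pt (inVar 0).toRingHom g' (C.genericValue g')] G := by
  have hs : MvPowerSeries.HasSubst ![x, y] := hasSubst_pair (h.constantCoeff_x ha) h.2.2.1
  refine (MvPowerSeries.subst_comp_subst_apply (R := ℂ) (S := ℂ) (T := ℂ)
    (hasSubst_map C.param k) hs G).trans ?_
  congr 1
  funext i
  obtain ⟨h1, h2⟩ := h.aeval_map
  fin_cases i
  · exact (MvPowerSeries.subst_coe (R := ℂ) (a := ![x, y]) _).trans h1
  · exact (MvPowerSeries.subst_coe (R := ℂ) (a := ![x, y]) _).trans h2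

lemma constantCoeff_X_pow_n (C : PlaneBranch) :
    MvPowerSeries.constantCoeff ((MvPowerSeries.X 0 : Bi) ^ C.n) = 0 := by
  simp [C.n_ne_zero]

lemma constantCoeff_initialPart (C : PlaneBranch) (j : ℕ) :
    PowerSeries.constantCoeff (C.initialPart j) = 0 := by
  rw [← PowerSeries.coeff_zero_eq_constantCoeff_apply, coeff_initialPart,
    PowerSeries.coeff_zero_eq_constantCoeff_apply, C.constantCoeff_eq, ite_self]

lemma constantCoeff_pt_inVar (hg : C.g = g' + 1) (v : Bi) :
    MvPowerSeries.constantCoeff (C.pt (inVar 0).toRingHom g' v) = 0 := by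
  have h1 : MvPowerSeries.constantCoeff ((inVar 0).toRingHom (C.initialPart g')) = 0 := by
    refine (constantCoeff_inVar 0 _).trans ?_
    exact C.constantCoeff_initialPart g'
  have h2 : (inVar 0).toRingHom PowerSeries.X = (MvPowerSeries.X 0 : Bi) := inVar_X 0
  have h3 : C.β (g' + 1) ≠ 0 := (C.β_pos (by omega)).ne'
  rw [pt, map_add, h1, h2]
  simp [h3]

/-- Substitution of the generic member of the family into a polynomial in `y`. -/
lemma subst_toSeries_generic (hg : C.g = g' + 1) (v : Bi) (H : Polynomial ℂ⟦X⟧) :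
    MvPowerSeries.subst ![(MvPowerSeries.X 0 : Bi) ^ C.n, C.pt (inVar 0).toRingHom g' v]
      (toSeries H) = valueAt (inVar 0).toRingHom C.n C.n_ne_zero
        (C.pt (inVar 0).toRingHom g' v) H := by
  rw [subst_toSeries C.constantCoeff_X_pow_n (constantCoeff_pt_inVar hg v), valueAt,
    Polynomial.coe_eval₂RingHom]
  congr 1
  ext1 f
  change PowerSeries.substAlgHom _ f = inVar 0 (PowerSeries.expand C.n C.n_ne_zero f)
  rw [PowerSeries.coe_substAlgHom, inVar_apply]
  exact subst_pow_eq_subst_expand (MvPowerSeries.constantCoeff_X 0) C.n_ne_zero f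

/-- The semigroup of the branch is generated by coprime integers, hence the chart in which the
family is separated is unramified. -/
lemma SeparatingChart.eq_one (hg : C.g = g' + 1) {k a : ℕ} {x y : Bi} (ha : 1 ≤ a)
    (h : C.SeparatingChart g' k a x y) : a = 1 := by
  obtain ⟨v, hv⟩ := exists_unit_genericValue hg
  obtain ⟨u, hu⟩ := h.2.1
  have hXt : (inVar 0).toRingHom PowerSeries.X = (MvPowerSeries.X 0 : Bi) := inVar_X 0
  -- The value of a semiroot on the family is `t ^ v_{j+1}` times a unit.
  have hkey : ∀ j, j < C.g → ∀ s : Biˣ, HasLead ((inVar 0).toRingHom PowerSeries.X) (C.v (j + 1)) s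
      (valueAt (inVar 0).toRingHom C.n C.n_ne_zero
        (C.pt (inVar 0).toRingHom g' (C.genericValue g')) (C.semirootPoly j)) →
      a ∣ C.v (j + 1) := by
    intro j hj s hs
    obtain ⟨w, hw⟩ := hs.exists_unit isSeriesRing_inVar
    rw [← subst_toSeries_generic hg, ← h.subst_subst ha, hXt] at hw
    exact dvd_of_subst_eq ha hu h.2.2.1 h.not_dvd hw
  have hv' : ∀ j < C.g, a ∣ C.v (j + 1) := by
    intro j hj
    rcases (show j < g' ∨ j = g' by omega) with hj' | rfl
    · obtain ⟨κ, hκ, hl⟩ := C.semiroot_lead_of_lt hj' (by omega)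
      have h1 := hl (inVar 0).toRingHom (C.genericValue g')
      have h2 : (inVar 0).toRingHom (PowerSeries.C κ) =
          (cst (inVar 0).toRingHom (Units.mk0 κ hκ) : Biˣ) := rfl
      rw [h2] at h1
      exact hkey j hj _ h1
    · obtain ⟨κ, hκ, hl⟩ := C.semiroot_lead hj
      have h1 := hl (inVar 0).toRingHom (C.genericValue j)
      have h2 : (inVar 0).toRingHom (PowerSeries.C κ) * C.genericValue j =
          ((cst (inVar 0).toRingHom (Units.mk0 κ hκ) * v : Biˣ) : Bi) := by
        rw [Units.val_mul, hv]
        rfl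
      rw [h2] at h1
      exact hkey j hj _ h1
  have h0 : a ∣ C.n := by
    have h1 := h.subst_subst ha (MvPowerSeries.X 0)
    rw [MvPowerSeries.subst_X (hasSubst_pair C.constantCoeff_X_pow_n
      (constantCoeff_pt_inVar hg _))] at h1
    refine dvd_of_subst_eq (w := 1) ha hu h.2.2.1 h.not_dvd (h1.trans ?_)
    rw [Units.val_one, mul_one]
    rfl
  have he : ∀ j ≤ C.g, a ∣ C.e j := by
    intro j hj
    induction j with
    | zero => exact h0
    | succ j ih =>
      rw [← C.gcd_e_v (by omega)]
      exact Nat.dvd_gcd (ih (by omega)) (hv' j (by omega))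
  have := he C.g le_rfl
  rw [C.e_g (by omega)] at this
  exact Nat.dvd_one.1 this

lemma LastStage.eq_one (hg : C.g = g' + 1) {k a : ℕ} (h : C.LastStage g' k a) : a = 1 := by
  obtain ⟨x, y, hxy⟩ := h.exists_chart hg
  exact hxy.eq_one hg h.2.1

/-! ### The dual graph -/

/-- The exceptional components through `P_k` are among `E_1, …, E_k`, and at most one of them has
each of the two equations `x = 0` and `y = 0`. -/
lemma infPoint_div (γ : Param) (k : ℕ) :
    (∀ j, (infPoint γ k).divX = some j → 1 ≤ j ∧ j ≤ k) ∧
    (∀ j, (infPoint γ k).divY = some j → 1 ≤ j ∧ j ≤ k) ∧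
    ∀ j j', (infPoint γ k).divX = some j → (infPoint γ k).divY = some j' → j ≠ j' := by
  induction k with
  | zero => simp [infPoint]
  | succ k ih =>
    obtain ⟨h1, h2, h3⟩ := ih
    rw [infPoint_succ]
    cases h : (infPoint γ k).curve.dir with
    | some c =>
      rw [InfPoint.blowUp_of_some h]
      simp only
      have h4 : ∀ j, (open Classical in if c = 0 then (infPoint γ k).divY else none) = some j →
          1 ≤ j ∧ j ≤ k := by
        intro j hj
        split_ifs at hj
        exact h2 j hj
      refine ⟨fun j hj => ?_, fun j hj => ?_, fun j j' hj hj' => ?_⟩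
      · simp only [Option.some.injEq] at hj
        omega
      · have := h4 j hj
        omega
      · simp only [Option.some.injEq] at hj
        have := h4 j' hj'
        omega
    | none =>
      rw [InfPoint.blowUp_of_none h]
      simp only
      refine ⟨fun j hj => ?_, fun j hj => ?_, fun j j' hj hj' => ?_⟩
      · have := h1 j hj
        omega
      · simp only [Option.some.injEq] at hj
        omega
      · simp only [Option.some.injEq] at hj'
        have := h1 j hj
        omega

/-- The combinatorial data of the end of the resolution: `k + 1` is the number of blowing-ups,
and the last one takes place at the intersection of two components, in a direction transversal to
both. -/
lemma LastStage.numBlowUps_eq (hg : C.g = g' + 1) {k : ℕ} (h : C.LastStage g' k 1) :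
    C.numBlowUps = k + 1 ∧ (infPoint C.param k).divX ≠ none ∧ (infPoint C.param k).divY ≠ none ∧
      (infPoint C.param (k + 1)).divX = some (k + 1) ∧
      (infPoint C.param (k + 1)).divY = none := by
  obtain ⟨hu, -, κ, κ', p, q, hq, hd, h⟩ := h
  have hc : PowerSeries.coeff (C.β (g' + 1)) C.η ≠ 0 := (C.β_mem (show g' < C.g by omega)).2
  have hdir : κ' * PowerSeries.coeff (C.β (g' + 1)) C.η ^ q ≠ 0 :=
    mul_ne_zero κ'.ne_zero (zpow_ne_zero _ hc)
  have hX : (infPoint C.param (k + 1)).divX = some (k + 1) := by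
    rw [infPoint_succ, InfPoint.blowUp_of_some hd]
  have hY : (infPoint C.param (k + 1)).divY = none := by
    rw [infPoint_succ, InfPoint.blowUp_of_some hd]
    exact if_neg hdir
  refine ⟨?_, hu.divX.resolve_right (by omega), hu.divY.resolve_left (by omega), hX, hY⟩
  have hNC : (infPoint C.param (k + 1)).IsNormalCrossing := by
    obtain ⟨v, hv⟩ := exists_unit_tailPart hg
    obtain ⟨x, z, hl, hx, hz⟩ := h (RingHom.id _) isSeriesRing_id v
    have hcv : PowerSeries.constantCoeff (v : ℂ⟦X⟧) = PowerSeries.coeff (C.β (g' + 1)) C.η := by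
      rw [hv, constantCoeff_tailPart]
    have hl' : C.Lifts g' (RingHom.id _) v (k + 1) x
        (z - PowerSeries.C (κ' * PowerSeries.coeff (C.β (g' + 1)) C.η ^ q)) :=
      ⟨x, _, hl, Or.inl ⟨_, hd, hx.mem_nonZeroDivisors isSeriesRing_id, rfl, by simp⟩⟩
    have hcurve := curve_of_lifts (v := v) (by
      intro j _
      rw [hv, ← param_eq_member]
      rfl) hl'
    rw [hv, ← param_eq_member] at hcurve
    have hxo : x.order = 1 := by
      have := order_of_hasLead_unit hx
      simpa using this
    have hz0 : PowerSeries.constantCoeff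
        (z - PowerSeries.C (κ' * PowerSeries.coeff (C.β (g' + 1)) C.η ^ q)) = 0 := by
      rw [map_sub, PowerSeries.constantCoeff_C, constantCoeff_of_hasLead_zero hz]
      have h3 : ∀ s : ℂ⟦X⟧ˣ, PowerSeries.constantCoeff (s : ℂ⟦X⟧) =
          (Units.map (PowerSeries.constantCoeff (R := ℂ)).toMonoidHom s : ℂˣ) := fun _ => rfl
      rw [h3, map_mul, map_zpow, Units.val_mul, Units.val_zpow_eq_zpow_val, ← h3 v, hcv,
        sub_eq_zero]
      congr 1
    refine ⟨?_, Or.inr hY, fun _ => ?_, fun h => absurd hY h⟩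
    · rw [hcurve]
      simp only
      rw [hxo, min_eq_left]
      rw [← Nat.cast_one]
      refine PowerSeries.nat_le_order _ 1 fun i hi => ?_
      rw [Nat.lt_one_iff.1 hi, PowerSeries.coeff_zero_eq_constantCoeff_apply, hz0]
    · rw [hcurve]
      exact hxo
  refine le_antisymm (Nat.sInf_le hNC) ?_
  by_contra! hlt
  exact hu.not_normalCrossing _ (Nat.lt_succ_iff.1 hlt)
    (Nat.sInf_mem (s := {k | (infPoint C.param k).IsNormalCrossing}) ⟨_, hNC⟩)

/-- The last component of the exceptional divisor meets two other components and the strict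
transform of the branch, hence it is the last triple point. -/
lemma LastStage.lastTriplePoint_eq (hg : C.g = g' + 1) {k : ℕ} (h : C.LastStage g' k 1) :
    C.lastTriplePoint = k + 1 := by
  obtain ⟨hN, hX, hY, hX', hY'⟩ := h.numBlowUps_eq hg
  obtain ⟨α, hα⟩ := Option.ne_none_iff_exists'.1 hX
  obtain ⟨α', hα'⟩ := Option.ne_none_iff_exists'.1 hY
  obtain ⟨h1, h2, h3⟩ := infPoint_div C.param k
  have hα1 := h1 α hα
  have hα2 := h2 α' hα'
  have hne := h3 α α' hα hα'
  have hTN : ∀ b, (infPoint C.param (k + 1)).Through b ↔ b = k + 1 := by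
    intro b
    rw [InfPoint.Through, hX', hY']
    simp [eq_comm]
  have htrip : C.IsTriplePoint (k + 1) := by
    refine ⟨by omega, ?_⟩
    -- The neighbours are the strict transform, with index `0`, and the two components
    -- through `P_k`.
    have hset : C.dualGraph.neighborSet (k + 1) = ({0, α, α'} : Set ℕ) := by
      ext b
      rw [SimpleGraph.mem_neighborSet, dualGraph, SimpleGraph.fromRel_adj]
      simp only [hTN, Meet, hN, Set.mem_insert_iff, Set.mem_singleton_iff]
      constructor
      · rintro ⟨-, ⟨⟨h, -⟩ | h⟩ | ⟨h | h⟩⟩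
        · omega
        · omega
        · exact Or.inl h.1
        · obtain ⟨-, -, -, ht, -⟩ := h
          rw [Nat.add_sub_cancel, InfPoint.Through, hα, hα'] at ht
          simp only [Option.some.injEq] at ht
          tauto
      · rintro (rfl | rfl | rfl)
        · exact ⟨by omega, Or.inr (Or.inl ⟨rfl, by omega, trivial⟩)⟩
        · refine ⟨by omega, Or.inr (Or.inr ⟨by omega, by omega, le_rfl, ?_, by omega⟩)⟩
          rw [Nat.add_sub_cancel]
          exact Or.inl hα
        · refine ⟨by omega, Or.inr (Or.inr ⟨by omega, by omega, le_rfl, ?_, by omega⟩)⟩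
          rw [Nat.add_sub_cancel]
          exact Or.inr hα'
    rw [hset, Set.ncard_eq_three]
    exact ⟨0, α, α', by omega, by omega, hne, rfl⟩
  have hle : ∀ m, C.IsTriplePoint m → m ≤ k + 1 := by
    rintro m ⟨-, hm⟩
    by_contra! hlt
    have hset : C.dualGraph.neighborSet m = ∅ := by
      ext b
      rw [SimpleGraph.mem_neighborSet, dualGraph, SimpleGraph.fromRel_adj]
      simp only [hTN, Meet, hN, Set.mem_empty_iff_false, iff_false]
      rintro ⟨-, ⟨⟨h, -⟩ | h⟩ | ⟨h | h⟩⟩ <;> omega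
    rw [hset] at hm
    simp at hm
  exact IsGreatest.csSup_eq ⟨htrip, fun m hm => hle m hm⟩

end PlaneBranch

/-! ### Dicritical components -/

/-- The total derivative of a polynomial in two power series. -/
lemma derivation_aeval (D : Derivation ℂ Bi Bi) (x y : Bi) (p : MvPolynomial (Fin 2) ℂ) :
    D (MvPolynomial.aeval ![x, y] p) =
      MvPolynomial.aeval ![x, y] (MvPolynomial.pderiv 0 p) * D x +
        MvPolynomial.aeval ![x, y] (MvPolynomial.pderiv 1 p) * D y := by
  induction p using MvPolynomial.induction_on with
  | C a => simp
  | add p q hp hq =>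
    simp only [map_add, hp, hq]
    ring
  | mul_X p i hp =>
    rw [map_mul, Derivation.leibniz, hp, MvPolynomial.aeval_X]
    fin_cases i
    · simp [MvPolynomial.pderiv_X_of_ne (show (0 : Fin 2) ≠ 1 by decide)]
      ring
    · simp [MvPolynomial.pderiv_X_of_ne (show (1 : Fin 2) ≠ 0 by decide)]
      ring

lemma isUnit_pderiv_X_mul (u : Biˣ) :
    IsUnit (MvPowerSeries.pderiv ℂ 0 ((MvPowerSeries.X 0 : Bi) * (u : Bi))) := by
  apply isUnit_of_constantCoeff_ne_zero
  rw [Derivation.leibniz, MvPowerSeries.pderiv_X_self]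
  have := MvPowerSeries.isUnit_constantCoeff _ u.isUnit
  simpa using this.ne_zero

lemma X_zero_dvd_pderiv_one (u : Bi) :
    (MvPowerSeries.X 0 : Bi) ∣ MvPowerSeries.pderiv ℂ 1 ((MvPowerSeries.X 0 : Bi) * u) := by
  rw [Derivation.leibniz, MvPowerSeries.pderiv_X_of_ne (show (0 : Fin 2) ≠ 1 by decide)]
  simp

/-- Whether the line `t = 0` is invariant under the form `P dx + Q dy`, up to a power of `t`, can
be read off from the pullback of this form by a map that is étale along this line and maps it
to itself. -/
lemma exists_transversal_iff {x y P Q : Bi} {u : Biˣ}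
    (hx : x = (MvPowerSeries.X 0 : Bi) * (u : Bi)) (hy0 : MvPowerSeries.constantCoeff y = 0)
    (hy : MvPowerSeries.constantCoeff (MvPowerSeries.pderiv ℂ 1 y) ≠ 0)
    (hyd : ¬ (MvPowerSeries.X 0 : Bi) ∣ y) {W : Fin 2 → Bi}
    (hW : ∀ i, W i = MvPowerSeries.subst ![x, y] P * MvPowerSeries.pderiv ℂ i x +
      MvPowerSeries.subst ![x, y] Q * MvPowerSeries.pderiv ℂ i y) :
    (∃ (m : ℕ) (A B : Bi), P = MvPowerSeries.X 0 ^ m * A ∧ Q = MvPowerSeries.X 0 ^ m * B ∧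
      ¬ (MvPowerSeries.X 0 : Bi) ∣ B) ↔
    ∃ m : ℕ, (MvPowerSeries.X 0 : Bi) ^ m ∣ W 0 ∧ (MvPowerSeries.X 0 : Bi) ^ m ∣ W 1 ∧
      ¬ (MvPowerSeries.X 0 : Bi) ^ (m + 1) ∣ W 1 := by
  set T : Bi := MvPowerSeries.X 0 with hT
  have hxT : T ∣ x := by rw [hx]; exact dvd_mul_right _ _
  have hx0 : MvPowerSeries.constantCoeff x = 0 := by rw [hx]; simp [hT]
  have hs := hasSubst_pair hx0 hy0
  have hT0 : T ≠ 0 := X_zero_ne_zero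
  have hTp : Prime T := prime_X_zero
  have hu0 : IsUnit (MvPowerSeries.pderiv ℂ 0 x) := by rw [hx]; exact isUnit_pderiv_X_mul u
  have hu1 : T ∣ MvPowerSeries.pderiv ℂ 1 x := by rw [hx]; exact X_zero_dvd_pderiv_one _
  have hy1 : IsUnit (MvPowerSeries.pderiv ℂ 1 y) := isUnit_of_constantCoeff_ne_zero hy
  have hsub : ∀ (m : ℕ) (A : Bi), MvPowerSeries.subst ![x, y] (T ^ m * A) =
      T ^ m * ((u : Bi) ^ m * MvPowerSeries.subst ![x, y] A) := by
    intro m A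
    rw [MvPowerSeries.subst_mul hs, MvPowerSeries.subst_pow hs, MvPowerSeries.subst_X hs]
    change x ^ m * _ = _
    rw [hx]
    ring
  have hWm : ∀ (m : ℕ) (A B : Bi), P = T ^ m * A → Q = T ^ m * B → ∀ i,
      W i = T ^ m * ((u : Bi) ^ m * (MvPowerSeries.subst ![x, y] A * MvPowerSeries.pderiv ℂ i x +
        MvPowerSeries.subst ![x, y] B * MvPowerSeries.pderiv ℂ i y)) := by
    intro m A B hA hB i
    rw [hW, hA, hB, hsub, hsub]
    ring
  have hcancel : ∀ (m : ℕ) (z : Bi), T ^ (m + 1) ∣ T ^ m * ((u : Bi) ^ m * z) → T ∣ z := by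
    intro m z h
    rw [pow_succ] at h
    have h1 := (mul_dvd_mul_iff_left (pow_ne_zero m hT0)).1 h
    exact ((u ^ m).isUnit.dvd_mul_left).1 (by simpa using h1)
  constructor
  · rintro ⟨m, A, B, hA, hB, hnd⟩
    have h := hWm m A B hA hB
    refine ⟨m, h 0 ▸ dvd_mul_right _ _, h 1 ▸ dvd_mul_right _ _, fun h1 => ?_⟩
    rw [h 1] at h1
    have h2 := (dvd_add_right (hu1.mul_left _)).1 (hcancel m _ h1)
    exact not_X_dvd_subst hxT hy0 hyd hnd ((hy1.dvd_mul_right).1 h2)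
  · rintro ⟨m, h0, h1, h2⟩
    -- Extract the largest power of `t` from the form. If the line were invariant, then after this
    -- division the pullback would have a coefficient of `dt` that is not divisible by `t`, and a
    -- coefficient of `du` that is.
    obtain ⟨l, A, B, hA, hB, hnd⟩ : ∃ (l : ℕ) (A B : Bi), P = T ^ l * A ∧ Q = T ^ l * B ∧
        ¬ (T ∣ A ∧ T ∣ B) := by
      by_cases hP : P = 0
      · have hQ : Q ≠ 0 := by
          rintro rfl
          apply h2
          have h3 : MvPowerSeries.subst ![x, y] (0 : Bi) = 0 := by
            rw [← MvPowerSeries.coe_substAlgHom hs, map_zero]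
          rw [hW, hP, h3]
          simp
        obtain ⟨l, B, hB, hBd⟩ := exists_eq_X_pow_mul hQ
        exact ⟨l, 0, B, by rw [hP, mul_zero], hB, fun h => hBd h.2⟩
      · obtain ⟨l, A, hA, hAd⟩ := exists_eq_X_pow_mul hP
        by_cases hQ : Q = 0
        · exact ⟨l, A, 0, hA, by rw [hQ, mul_zero], fun h => hAd h.1⟩
        · obtain ⟨l', B, hB, hBd⟩ := exists_eq_X_pow_mul hQ
          rcases le_total l l' with hl | hl
          · obtain ⟨q, rfl⟩ := Nat.exists_eq_add_of_le hl
            exact ⟨l, A, T ^ q * B, hA, by rw [hB]; ring, fun h => hAd h.1⟩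
          · obtain ⟨q, rfl⟩ := Nat.exists_eq_add_of_le hl
            exact ⟨l', T ^ q * A, B, by rw [hA]; ring, hB, fun h => hBd h.2⟩
    refine ⟨l, A, B, hA, hB, fun hBd => ?_⟩
    have hAd : ¬ T ∣ A := fun h => hnd ⟨h, hBd⟩
    have h := hWm l A B hA hB
    have hBs : T ∣ MvPowerSeries.subst ![x, y] B := by
      obtain ⟨B', rfl⟩ := hBd
      rw [MvPowerSeries.subst_mul hs, MvPowerSeries.subst_X hs]
      exact hxT.mul_right _
    have hml : m ≤ l := by
      by_contra! hlm
      have h3 := (pow_dvd_pow T (show l + 1 ≤ m from hlm)).trans h0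
      rw [h 0] at h3
      have h4 := (dvd_add_left (hBs.mul_right _)).1 (hcancel l _ h3)
      exact not_X_dvd_subst hxT hy0 hyd hAd ((hu0.dvd_mul_right).1 h4)
    apply h2
    refine (pow_dvd_pow T (show m + 1 ≤ l + 1 by omega)).trans ?_
    rw [h 1, pow_succ]
    exact mul_dvd_mul_left _ (dvd_mul_of_dvd_right
      (dvd_add (hu1.mul_left _) (hBs.mul_right _)) _)

namespace PlaneBranch

variable {C : PlaneBranch} {g' : ℕ}

variable (C) in
/-- The coefficients of `dt` and `du` in the pullback of a form to the generic member of the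
family. -/
def pullGeneric (g' : ℕ) (ω : OneForm) (i : Fin 2) : Bi :=
  MvPowerSeries.subst ![(MvPowerSeries.X 0 : Bi) ^ C.n,
      C.pt (inVar 0).toRingHom g' (C.genericValue g')] ω.1 *
    MvPowerSeries.pderiv ℂ i ((MvPowerSeries.X 0 : Bi) ^ C.n) +
  MvPowerSeries.subst ![(MvPowerSeries.X 0 : Bi) ^ C.n,
      C.pt (inVar 0).toRingHom g' (C.genericValue g')] ω.2 *
    MvPowerSeries.pderiv ℂ i (C.pt (inVar 0).toRingHom g' (C.genericValue g'))

/-- The pullback to the generic member of the family factors through the coordinates at `P_k`. -/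
lemma SeparatingChart.pullGeneric_eq {k : ℕ} {x y : Bi} (h : C.SeparatingChart g' k 1 x y)
    (ω : OneForm) (i : Fin 2) :
    C.pullGeneric g' ω i =
      MvPowerSeries.subst ![x, y] ((infPoint C.param k).pullForm ω).1 *
        MvPowerSeries.pderiv ℂ i x +
      MvPowerSeries.subst ![x, y] ((infPoint C.param k).pullForm ω).2 *
        MvPowerSeries.pderiv ℂ i y := by
  obtain ⟨hX, hY⟩ := h.aeval_map
  have hs : MvPowerSeries.HasSubst ![x, y] := hasSubst_pair (h.constantCoeff_x le_rfl) h.2.2.1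
  have hc : ∀ p : MvPolynomial (Fin 2) ℂ, MvPowerSeries.subst ![x, y] (p : Bi) =
      MvPolynomial.aeval ![x, y] p := fun p => MvPowerSeries.subst_coe _
  have hf : ∀ j : Fin 2, MvPowerSeries.subst ![x, y]
      (MvPowerSeries.subst
          ![((infPoint C.param k).mapX : Bi), ((infPoint C.param k).mapY : Bi)] ω.1 *
          MvPowerSeries.pderiv ℂ j ((infPoint C.param k).mapX : Bi) +
        MvPowerSeries.subst
          ![((infPoint C.param k).mapX : Bi), ((infPoint C.param k).mapY : Bi)] ω.2 *
          MvPowerSeries.pderiv ℂ j ((infPoint C.param k).mapY : Bi)) =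
      MvPowerSeries.subst ![(MvPowerSeries.X 0 : Bi) ^ C.n,
          C.pt (inVar 0).toRingHom g' (C.genericValue g')] ω.1 *
        MvPolynomial.aeval ![x, y] (MvPolynomial.pderiv j (infPoint C.param k).mapX) +
      MvPowerSeries.subst ![(MvPowerSeries.X 0 : Bi) ^ C.n,
          C.pt (inVar 0).toRingHom g' (C.genericValue g')] ω.2 *
        MvPolynomial.aeval ![x, y] (MvPolynomial.pderiv j (infPoint C.param k).mapY) := by
    intro j
    rw [MvPowerSeries.subst_add hs, MvPowerSeries.subst_mul hs, MvPowerSeries.subst_mul hs,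
      h.subst_subst le_rfl, h.subst_subst le_rfl, MvPowerSeries.pderiv_coe,
      MvPowerSeries.pderiv_coe, hc, hc]
  have h1 : ((infPoint C.param k).pullForm ω).1 = MvPowerSeries.subst
          ![((infPoint C.param k).mapX : Bi), ((infPoint C.param k).mapY : Bi)] ω.1 *
          MvPowerSeries.pderiv ℂ 0 ((infPoint C.param k).mapX : Bi) +
        MvPowerSeries.subst
          ![((infPoint C.param k).mapX : Bi), ((infPoint C.param k).mapY : Bi)] ω.2 *
          MvPowerSeries.pderiv ℂ 0 ((infPoint C.param k).mapY : Bi) := rfl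
  have h2 : ((infPoint C.param k).pullForm ω).2 = MvPowerSeries.subst
          ![((infPoint C.param k).mapX : Bi), ((infPoint C.param k).mapY : Bi)] ω.1 *
          MvPowerSeries.pderiv ℂ 1 ((infPoint C.param k).mapX : Bi) +
        MvPowerSeries.subst
          ![((infPoint C.param k).mapX : Bi), ((infPoint C.param k).mapY : Bi)] ω.2 *
          MvPowerSeries.pderiv ℂ 1 ((infPoint C.param k).mapY : Bi) := rfl
  rw [h1, h2, hf, hf]
  have h3 := derivation_aeval (MvPowerSeries.pderiv ℂ i) x y (infPoint C.param k).mapX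
  have h4 := derivation_aeval (MvPowerSeries.pderiv ℂ i) x y (infPoint C.param k).mapY
  rw [hX] at h3
  rw [hY] at h4
  rw [pullGeneric, h3, h4]
  ring

/-- The last exceptional component is dicritical if and only if, on the generic member of the
family, the coefficient of `du` has at most the order in `t` of the coefficient of `dt`. -/
lemma LastStage.isDicriticalAt_iff (hg : C.g = g' + 1) {k : ℕ} (h : C.LastStage g' k 1)
    (ω : OneForm) :
    C.IsDicriticalAt ω C.lastTriplePoint ↔
      ∃ m : ℕ, (MvPowerSeries.X 0 : Bi) ^ m ∣ C.pullGeneric g' ω 0 ∧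
        (MvPowerSeries.X 0 : Bi) ^ m ∣ C.pullGeneric g' ω 1 ∧
        ¬ (MvPowerSeries.X 0 : Bi) ^ (m + 1) ∣ C.pullGeneric g' ω 1 := by
  obtain ⟨x, y, hxy⟩ := h.exists_chart hg
  obtain ⟨-, -, -, hX, hY⟩ := h.numBlowUps_eq hg
  obtain ⟨u, hu⟩ := hxy.2.1
  rw [pow_one] at hu
  rw [← exists_transversal_iff hu hxy.2.2.1 hxy.2.2.2 hxy.not_dvd
    (fun i => hxy.pullGeneric_eq ω i), h.lastTriplePoint_eq hg, IsDicriticalAt]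
  refine exists_congr fun m => exists_congr fun A => exists_congr fun B => ?_
  rw [hX, hY]
  simp only [true_and, reduceCtorEq, false_and, or_false]
  rw [← and_assoc, Prod.ext_iff]
  rfl

end PlaneBranch

/-! ### Derivatives of polynomials over power series -/

/-- The derivative of a polynomial over `ℂ⟦t⟧` with respect to `t`. -/
def coeffDeriv (P : Polynomial ℂ⟦X⟧) : Polynomial ℂ⟦X⟧ :=
  P.sum fun k f => Polynomial.monomial k (PowerSeries.derivative ℂ f)

lemma coeff_coeffDeriv (P : Polynomial ℂ⟦X⟧) (k : ℕ) :
    (coeffDeriv P).coeff k = PowerSeries.derivative ℂ (P.coeff k) := by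
  rw [coeffDeriv, Polynomial.sum_def, Polynomial.finsetSum_coeff]
  simp only [Polynomial.coeff_monomial]
  rw [Finset.sum_ite_eq']
  split_ifs with h
  · rfl
  · rw [Polynomial.notMem_support_iff.1 h, map_zero]

lemma coeffDeriv_add (P Q : Polynomial ℂ⟦X⟧) :
    coeffDeriv (P + Q) = coeffDeriv P + coeffDeriv Q := by
  ext1 k
  simp [coeff_coeffDeriv]

lemma coeffDeriv_zero : coeffDeriv 0 = 0 := by
  ext1 k
  simp [coeff_coeffDeriv]

lemma coeffDeriv_monomial (k : ℕ) (f : ℂ⟦X⟧) : coeffDeriv (Polynomial.monomial k f) =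
    Polynomial.monomial k (PowerSeries.derivative ℂ f) := by
  ext1 l
  rw [coeff_coeffDeriv, Polynomial.coeff_monomial, Polynomial.coeff_monomial]
  split_ifs
  · rfl
  · rw [map_zero]

lemma coeffDeriv_C_mul (f : ℂ⟦X⟧) (P : Polynomial ℂ⟦X⟧) : coeffDeriv (Polynomial.C f * P) =
    Polynomial.C (PowerSeries.derivative ℂ f) * P + Polynomial.C f * coeffDeriv P := by
  ext1 k
  rw [coeff_coeffDeriv, Polynomial.coeff_C_mul, Derivation.leibniz, Polynomial.coeff_add,
    Polynomial.coeff_C_mul, Polynomial.coeff_C_mul, coeff_coeffDeriv, smul_eq_mul, smul_eq_mul]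
  ring

lemma coeffDeriv_X_pow_mul (a : ℕ) (P : Polynomial ℂ⟦X⟧) :
    Polynomial.C PowerSeries.X * coeffDeriv (Polynomial.C PowerSeries.X ^ a * P) =
      Polynomial.C PowerSeries.X ^ a *
        ((a : Polynomial ℂ⟦X⟧) * P + Polynomial.C PowerSeries.X * coeffDeriv P) := by
  rw [← Polynomial.C_pow, coeffDeriv_C_mul, PowerSeries.derivative_pow, PowerSeries.derivative_X]
  cases a with
  | zero => simp
  | succ a =>
    simp only [Polynomial.C_mul, Polynomial.C_pow, map_natCast, Polynomial.C_1,
      Nat.add_sub_cancel]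
    ring

lemma pderiv_zero_toSeries (P : Polynomial ℂ⟦X⟧) :
    MvPowerSeries.pderiv ℂ 0 (toSeries P) = toSeries (coeffDeriv P) := by
  ext m
  rw [MvPowerSeries.coeff_pderiv]
  change PowerSeries.coeff ((m + Finsupp.single (0 : Fin 2) 1 : Fin 2 →₀ ℕ) 0)
      (P.coeff ((m + Finsupp.single (0 : Fin 2) 1 : Fin 2 →₀ ℕ) 1)) * _ =
    PowerSeries.coeff (m 0) ((coeffDeriv P).coeff (m 1))
  rw [coeff_coeffDeriv, PowerSeries.coeff_derivative]
  simp

lemma pderiv_one_toSeries (P : Polynomial ℂ⟦X⟧) :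
    MvPowerSeries.pderiv ℂ 1 (toSeries P) = toSeries (Polynomial.derivative P) := by
  ext m
  rw [MvPowerSeries.coeff_pderiv]
  change PowerSeries.coeff ((m + Finsupp.single (1 : Fin 2) 1 : Fin 2 →₀ ℕ) 0)
      (P.coeff ((m + Finsupp.single (1 : Fin 2) 1 : Fin 2 →₀ ℕ) 1)) * _ =
    PowerSeries.coeff (m 0) ((Polynomial.derivative P).coeff (m 1))
  rw [Polynomial.coeff_derivative]
  have h : PowerSeries.coeff (m 0) (P.coeff (m 1 + 1) * ((m 1 : ℂ⟦X⟧) + 1)) =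
      PowerSeries.coeff (m 0) (P.coeff (m 1 + 1)) * ((m 1 : ℂ) + 1) := by
    have : ((m 1 : ℂ⟦X⟧) + 1) = PowerSeries.C ((m 1 : ℂ) + 1) := by simp
    rw [this, PowerSeries.coeff_mul_C]
  rw [h]
  simp

/-- A derivation of an algebra over `ℂ⟦t⟧` that satisfies the chain rule for power series in
`t`. -/
def ChainRule {S : Type} [CommRing S] [Algebra ℂ S] (D : Derivation ℂ S S) (ι : ℂ⟦X⟧ →+* S) :
    Prop := ∀ f, D (ι f) = ι (PowerSeries.derivative ℂ f) * D (ι PowerSeries.X)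

lemma ChainRule.eval₂ {S : Type} [CommRing S] [Algebra ℂ S] {D : Derivation ℂ S S}
    {ι : ℂ⟦X⟧ →+* S} (h : ChainRule D ι) (v : S) (P : Polynomial ℂ⟦X⟧) :
    D (P.eval₂ ι v) = (coeffDeriv P).eval₂ ι v * D (ι PowerSeries.X) +
      (Polynomial.derivative P).eval₂ ι v * D v := by
  induction P using Polynomial.induction_on' with
  | add p q hp hq =>
    rw [Polynomial.eval₂_add, map_add, hp, hq, coeffDeriv_add, Polynomial.derivative_add,
      Polynomial.eval₂_add, Polynomial.eval₂_add]
    ring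
  | monomial k f =>
    rw [Polynomial.eval₂_monomial, Derivation.leibniz, h f, Derivation.leibniz_pow,
      coeffDeriv_monomial, Polynomial.derivative_monomial, Polynomial.eval₂_monomial,
      Polynomial.eval₂_monomial, map_mul, map_natCast]
    simp only [smul_eq_mul, nsmul_eq_mul]
    ring

lemma ChainRule.expand {S : Type} [CommRing S] [Algebra ℂ S] {D : Derivation ℂ S S}
    {ι : ℂ⟦X⟧ →+* S} (h : ChainRule D ι) (n : ℕ) (hn : n ≠ 0) :
    ChainRule D (ι.comp (PowerSeries.expand n hn : ℂ⟦X⟧ →ₐ[ℂ] ℂ⟦X⟧).toRingHom) := by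
  intro f
  change D (ι (PowerSeries.expand n hn f)) =
    ι (PowerSeries.expand n hn (PowerSeries.derivative ℂ f)) *
      D (ι (PowerSeries.expand n hn PowerSeries.X))
  rw [h, h (PowerSeries.expand n hn PowerSeries.X), ← mul_assoc, ← map_mul]
  congr 2
  rw [PowerSeries.expand_X, PowerSeries.expand_apply, PowerSeries.expand_apply]
  exact PowerSeries.derivative_subst (PowerSeries.HasSubst.X_pow hn)

lemma chainRule_id : ChainRule (PowerSeries.derivative ℂ) (RingHom.id ℂ⟦X⟧) := by
  intro f
  simp

lemma chainRule_inVar (i : Fin 2) : ChainRule (MvPowerSeries.pderiv ℂ i : Derivation ℂ Bi Bi)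
    (inVar 0).toRingHom := by
  intro f
  change MvPowerSeries.pderiv ℂ i (inVar 0 f) =
    inVar 0 (PowerSeries.derivative ℂ f) * MvPowerSeries.pderiv ℂ i (inVar 0 PowerSeries.X)
  rw [inVar_X]
  ext m
  rw [MvPowerSeries.coeff_pderiv, coeff_inVar]
  fin_cases i
  · change _ = MvPowerSeries.coeff m (inVar 0 (PowerSeries.derivative ℂ f) *
      MvPowerSeries.pderiv ℂ 0 (MvPowerSeries.X 0 : Bi))
    rw [MvPowerSeries.pderiv_X_self, mul_one, coeff_inVar, PowerSeries.coeff_derivative]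
    have h : m + Finsupp.single (0 : Fin 2) 1 =
        Finsupp.single 0 ((m + Finsupp.single (0 : Fin 2) 1 : Fin 2 →₀ ℕ) 0) ↔
          m = Finsupp.single 0 (m 0) := by
      simp [Finsupp.single_add]
    simp only [Fin.zero_eta, h]
    split_ifs <;> simp
  · change _ = MvPowerSeries.coeff m (inVar 0 (PowerSeries.derivative ℂ f) *
      MvPowerSeries.pderiv ℂ 1 (MvPowerSeries.X 0 : Bi))
    rw [MvPowerSeries.pderiv_X_of_ne (show (0 : Fin 2) ≠ 1 by decide), mul_zero, if_neg,
      zero_mul]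
    · exact (LinearMap.map_zero _).symm
    · intro h
      have h1 := DFunLike.congr_fun h 1
      simp at h1

namespace PlaneBranch

variable {C : PlaneBranch} {g' : ℕ}

/-! ### The pullback of the form to the family -/

variable (C) in
/-- The value of a polynomial on the family, as a polynomial in the parameter. -/
def onFamily (g' : ℕ) (K : Polynomial ℂ⟦X⟧) : Polynomial ℂ⟦X⟧ :=
  valueAt Polynomial.C C.n C.n_ne_zero (C.pt Polynomial.C g' Polynomial.X) K

lemma eval₂_onFamily {S : Type} [CommRing S] (ι : ℂ⟦X⟧ →+* S) (v : S) (K : Polynomial ℂ⟦X⟧) :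
    (C.onFamily g' K).eval₂ ι v = valueAt ι C.n C.n_ne_zero (C.pt ι g' v) K := by
  rw [onFamily, valueAt, valueAt, Polynomial.coe_eval₂RingHom, Polynomial.coe_eval₂RingHom,
    ← Polynomial.coe_eval₂RingHom, Polynomial.hom_eval₂, ← RingHom.comp_assoc,
    Polynomial.eval₂RingHom_comp_C]
  congr 1
  rw [Polynomial.coe_eval₂RingHom, pt, Polynomial.eval₂_add, Polynomial.eval₂_mul,
    Polynomial.eval₂_C, Polynomial.eval₂_X, Polynomial.eval₂_pow, Polynomial.eval₂_C, pt]

variable (C) in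
/-- The semiroots `F_j`, `j ≤ g`, as polynomials in `y`. -/
def rootPoly : ℕ → Polynomial ℂ⟦X⟧
  | 0 => Polynomial.C PowerSeries.X
  | j + 1 => C.semirootPoly j

lemma semiroot_eq {j : ℕ} (hj : j ≤ C.g) : C.semiroot j = toSeries (C.rootPoly j) := by
  cases j with
  | zero =>
    rw [semiroot, rootPoly, ← Polynomial.monomial_zero_left, toSeries_monomial, pow_zero, mul_one,
      PowerSeries.subst_X (PowerSeries.HasSubst.X 0)]
  | succ j =>
    rw [semiroot, if_pos hj]
    rfl

variable (C) in
/-- The coefficient of `dt` in the pullback of `H₁ ω_{i,g'+1} + d H₂` to the family. -/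
def tCoeff (g' i : ℕ) (H₁ H₂ : Polynomial ℂ⟦X⟧) : Polynomial ℂ⟦X⟧ :=
  C.onFamily g' H₁ *
    ((C.v i : Polynomial ℂ⟦X⟧) * C.onFamily g' (C.rootPoly i) *
        coeffDeriv (C.onFamily g' (C.rootPoly (g' + 1))) -
      (C.v (g' + 1) : Polynomial ℂ⟦X⟧) * C.onFamily g' (C.rootPoly (g' + 1)) *
        coeffDeriv (C.onFamily g' (C.rootPoly i))) + coeffDeriv (C.onFamily g' H₂)

variable (C) in
/-- The coefficient of the differential of the parameter in the pullback of
`H₁ ω_{i,g'+1} + d H₂` to the family. -/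
def vCoeff (g' i : ℕ) (H₁ H₂ : Polynomial ℂ⟦X⟧) : Polynomial ℂ⟦X⟧ :=
  C.onFamily g' H₁ *
    ((C.v i : Polynomial ℂ⟦X⟧) * C.onFamily g' (C.rootPoly i) *
        Polynomial.derivative (C.onFamily g' (C.rootPoly (g' + 1))) -
      (C.v (g' + 1) : Polynomial ℂ⟦X⟧) * C.onFamily g' (C.rootPoly (g' + 1)) *
        Polynomial.derivative (C.onFamily g' (C.rootPoly i))) +
    Polynomial.derivative (C.onFamily g' H₂)

/-- The pullback of `H₁ ω_{i,g} + d H₂` to a member of the family. -/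
lemma pullback_eq (hg : C.g = g' + 1) {i : ℕ} (hi : i < C.g) (H₁ H₂ : Polynomial ℂ⟦X⟧)
    {ω : OneForm} (hω : ω = toSeries H₁ • C.basicForm i C.g + d (toSeries H₂))
    {S : Type} [CommRing S] [Algebra ℂ S] {D : Derivation ℂ S S} {ι : ℂ⟦X⟧ →+* S}
    (hD : ChainRule D ι) (v : S) (φ : MvPowerSeries (Fin 2) ℂ →+* S)
    (hφ : ∀ K, φ (toSeries K) = valueAt ι C.n C.n_ne_zero (C.pt ι g' v) K) :
    φ ω.1 * D (ι PowerSeries.X ^ C.n) + φ ω.2 * D (C.pt ι g' v) =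
      (C.tCoeff g' i H₁ H₂).eval₂ ι v * D (ι PowerSeries.X) +
        (C.vCoeff g' i H₁ H₂).eval₂ ι v * D v := by
  have hn : ι PowerSeries.X ^ C.n =
      (ι.comp (PowerSeries.expand C.n C.n_ne_zero : ℂ⟦X⟧ →ₐ[ℂ] ℂ⟦X⟧).toRingHom)
        PowerSeries.X := by
    change _ = ι (PowerSeries.expand C.n C.n_ne_zero PowerSeries.X)
    rw [PowerSeries.expand_X, map_pow]
  have hd : ∀ K, φ (toSeries (coeffDeriv K)) * D (ι PowerSeries.X ^ C.n) +
      φ (toSeries (Polynomial.derivative K)) * D (C.pt ι g' v) =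
      (coeffDeriv (C.onFamily g' K)).eval₂ ι v * D (ι PowerSeries.X) +
        (Polynomial.derivative (C.onFamily g' K)).eval₂ ι v * D v := by
    intro K
    rw [← hD.eval₂, eval₂_onFamily, hφ, hφ, hn]
    exact ((hD.expand C.n C.n_ne_zero).eval₂ (C.pt ι g' v) K).symm
  have h1 : ω.1 = toSeries H₁ * ((C.v i : MvPowerSeries (Fin 2) ℂ) * toSeries (C.rootPoly i) *
      toSeries (coeffDeriv (C.rootPoly (g' + 1))) -
      (C.v (g' + 1) : MvPowerSeries (Fin 2) ℂ) * toSeries (C.rootPoly (g' + 1)) *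
      toSeries (coeffDeriv (C.rootPoly i))) + toSeries (coeffDeriv H₂) := by
    rw [hω, basicForm, semiroot_eq hi.le, hg, semiroot_eq hg.ge]
    simp only [d, Prod.fst_add, Prod.smul_fst, Prod.fst_sub, smul_eq_mul, pderiv_zero_toSeries]
  have h2 : ω.2 = toSeries H₁ * ((C.v i : MvPowerSeries (Fin 2) ℂ) * toSeries (C.rootPoly i) *
      toSeries (Polynomial.derivative (C.rootPoly (g' + 1))) -
      (C.v (g' + 1) : MvPowerSeries (Fin 2) ℂ) * toSeries (C.rootPoly (g' + 1)) *
      toSeries (Polynomial.derivative (C.rootPoly i))) +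
      toSeries (Polynomial.derivative H₂) := by
    rw [hω, basicForm, semiroot_eq hi.le, hg, semiroot_eq hg.ge]
    simp only [d, Prod.snd_add, Prod.smul_snd, Prod.snd_sub, smul_eq_mul, pderiv_one_toSeries]
  rw [h1, h2, tCoeff, vCoeff]
  simp only [map_add, map_mul, map_sub, map_natCast, Polynomial.eval₂_add, Polynomial.eval₂_mul,
    Polynomial.eval₂_sub, Polynomial.eval₂_natCast, eval₂_onFamily, ← hφ]
  have e1 := hd (C.rootPoly (g' + 1))
  have e2 := hd (C.rootPoly i)
  have e3 := hd H₂
  linear_combination (φ (toSeries H₁) * (C.v i : S) * φ (toSeries (C.rootPoly i))) * e1 -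
    (φ (toSeries H₁) * (C.v (g' + 1) : S) * φ (toSeries (C.rootPoly (g' + 1)))) * e2 + e3

/-! ### Leading terms of the pullback -/

/-- The order of the leading term is the intersection multiplicity, because the branch is the
member of the family for a parameter `v` that is a unit. -/
lemma exists_onFamily_eq (hg : C.g = g' + 1) {H : Polynomial ℂ⟦X⟧} (hH : H ≠ 0)
    (hdeg : H.natDegree < C.n) :
    ∃ κ : ℂ, κ ≠ 0 ∧ ∃ (h m : ℕ) (r : Polynomial ℂ⟦X⟧), C.inter (toSeries H) = h ∧
      C.onFamily g' H = Polynomial.C PowerSeries.X ^ h *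
        (Polynomial.C (PowerSeries.C κ) * Polynomial.X ^ m + Polynomial.C PowerSeries.X * r) := by
  obtain ⟨κ, hκ, h, m, hl⟩ := C.monomial_lead hg H hH hdeg
  obtain ⟨r, hr⟩ := hl Polynomial.C Polynomial.X
  refine ⟨κ, hκ, h, m, r, ?_, hr⟩
  obtain ⟨v, hv⟩ := exists_unit_tailPart hg
  have h1 := hl (RingHom.id _) (v : ℂ⟦X⟧)
  have h2 : RingHom.id _ (PowerSeries.C κ) * (v : ℂ⟦X⟧) ^ m =
      ((cst (RingHom.id _) (Units.mk0 κ hκ) * v ^ m : ℂ⟦X⟧ˣ) : ℂ⟦X⟧) := rfl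
  rw [h2] at h1
  rw [inter, param, pull_toSeries C.n_ne_zero C.constantCoeff_eq, η_eq C g', ← hv]
  exact order_of_hasLead_unit h1

lemma inter_ne_zero {H : Polynomial ℂ⟦X⟧}
    (h : MvPowerSeries.constantCoeff (toSeries H) = 0) : C.inter (toSeries H) ≠ 0 := by
  rw [inter, param, pull_toSeries C.n_ne_zero C.constantCoeff_eq,
    PowerSeries.order_ne_zero_iff_constCoeff_eq_zero, valueAt,
    Polynomial.coe_eval₂RingHom, Polynomial.hom_eval₂, C.constantCoeff_eq,
    Polynomial.eval₂_at_zero]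
  change PowerSeries.constantCoeff (PowerSeries.expand C.n C.n_ne_zero (H.coeff 0)) = 0
  rw [PowerSeries.constantCoeff_expand]
  rw [← PowerSeries.coeff_zero_eq_constantCoeff_apply]
  rw [← MvPowerSeries.coeff_zero_eq_constantCoeff_apply] at h
  exact h

lemma exists_rootPoly_eq (hg : C.g = g' + 1) {i : ℕ} (hi : i < C.g) :
    ∃ κ : ℂ, κ ≠ 0 ∧ ∃ r : Polynomial ℂ⟦X⟧, C.onFamily g' (C.rootPoly i) =
      Polynomial.C PowerSeries.X ^ C.v i *
        (Polynomial.C (PowerSeries.C κ) + Polynomial.C PowerSeries.X * r) := by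
  cases i with
  | zero =>
    refine ⟨1, one_ne_zero, 0, ?_⟩
    rw [rootPoly, onFamily, valueAt, Polynomial.coe_eval₂RingHom, Polynomial.eval₂_C, v_zero]
    change Polynomial.C (PowerSeries.expand C.n C.n_ne_zero PowerSeries.X) = _
    rw [PowerSeries.expand_X]
    simp
  | succ j =>
    obtain ⟨κ, hκ, hl⟩ := C.semiroot_lead_of_lt (show j < g' by omega) (by omega)
    obtain ⟨r, hr⟩ := hl Polynomial.C Polynomial.X
    exact ⟨κ, hκ, r, hr⟩

lemma exists_rootPoly_last_eq (hg : C.g = g' + 1) :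
    ∃ κ : ℂ, κ ≠ 0 ∧ ∃ r : Polynomial ℂ⟦X⟧, C.onFamily g' (C.rootPoly (g' + 1)) =
      Polynomial.C PowerSeries.X ^ C.v (g' + 1) *
        (Polynomial.C (PowerSeries.C κ) * Polynomial.X + Polynomial.C PowerSeries.X * r) := by
  obtain ⟨κ, hκ, hl⟩ := C.semiroot_lead (show g' < C.g by omega)
  obtain ⟨r, hr⟩ := hl Polynomial.C Polynomial.X
  exact ⟨κ, hκ, r, hr⟩

lemma C_X_ne_zero : (Polynomial.C PowerSeries.X : Polynomial ℂ⟦X⟧) ≠ 0 :=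
  Polynomial.C_ne_zero.2 PowerSeries.X_ne_zero

/-- The logarithmic combination `v_i dF_g / F_g - v_g dF_i / F_i` has no pole along `t = 0`. -/
lemma exists_basic_eq (hg : C.g = g' + 1) {i : ℕ} (hi : i < C.g) :
    ∃ κ : ℂ, κ ≠ 0 ∧ ∃ q r : Polynomial ℂ⟦X⟧,
      (C.v i : Polynomial ℂ⟦X⟧) * C.onFamily g' (C.rootPoly i) *
          coeffDeriv (C.onFamily g' (C.rootPoly (g' + 1))) -
        (C.v (g' + 1) : Polynomial ℂ⟦X⟧) * C.onFamily g' (C.rootPoly (g' + 1)) *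
          coeffDeriv (C.onFamily g' (C.rootPoly i)) =
        Polynomial.C PowerSeries.X ^ (C.v i + C.v (g' + 1)) * q ∧
      (C.v i : Polynomial ℂ⟦X⟧) * C.onFamily g' (C.rootPoly i) *
          Polynomial.derivative (C.onFamily g' (C.rootPoly (g' + 1))) -
        (C.v (g' + 1) : Polynomial ℂ⟦X⟧) * C.onFamily g' (C.rootPoly (g' + 1)) *
          Polynomial.derivative (C.onFamily g' (C.rootPoly i)) =
        Polynomial.C PowerSeries.X ^ (C.v i + C.v (g' + 1)) *
          (Polynomial.C (PowerSeries.C κ) + Polynomial.C PowerSeries.X * r) := by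
  obtain ⟨κ, hκ, r, hr⟩ := exists_rootPoly_eq hg hi
  obtain ⟨κ', hκ', r', hr'⟩ := exists_rootPoly_last_eq hg
  rw [hr, hr']
  have hvi : (C.v i : ℂ) ≠ 0 := by exact_mod_cast (C.v_pos hi.le).ne'
  refine ⟨C.v i * κ * κ', mul_ne_zero (mul_ne_zero hvi hκ) hκ', ?_⟩
  set t : Polynomial ℂ⟦X⟧ := Polynomial.C PowerSeries.X with ht
  set a := C.v i
  set b := C.v (g' + 1)
  set P := Polynomial.C (PowerSeries.C κ) + t * r with hP
  set Q := Polynomial.C (PowerSeries.C κ') * Polynomial.X + t * r' with hQ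
  have hdt : ∀ (m : ℕ) (f : Polynomial ℂ⟦X⟧), Polynomial.derivative (t ^ m * f) =
      t ^ m * Polynomial.derivative f := by
    intro m f
    rw [ht, ← Polynomial.C_pow, Polynomial.derivative_C_mul]
  have hdt1 : ∀ f : Polynomial ℂ⟦X⟧, Polynomial.derivative (t * f) =
      t * Polynomial.derivative f := fun f => by rw [ht, Polynomial.derivative_C_mul]
  refine ⟨(a : Polynomial ℂ⟦X⟧) * P * coeffDeriv Q - (b : Polynomial ℂ⟦X⟧) * Q * coeffDeriv P,
    (a : Polynomial ℂ⟦X⟧) * Polynomial.C (PowerSeries.C κ) * Polynomial.derivative r' +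
      (a : Polynomial ℂ⟦X⟧) * r * Polynomial.derivative Q -
      (b : Polynomial ℂ⟦X⟧) * Q * Polynomial.derivative r, ?_, ?_⟩
  -- In `t ∂(t ^ a P) = t ^ a (a P + t ∂P)` and `t ∂(t ^ b Q) = t ^ b (b Q + t ∂Q)`, where `∂` is
  -- the derivative with respect to `t`, the multiples of `P Q` cancel.
  · apply mul_left_cancel₀ C_X_ne_zero
    have e1 := coeffDeriv_X_pow_mul a P
    have e2 := coeffDeriv_X_pow_mul b Q
    rw [← ht] at e1 e2 ⊢
    rw [pow_add]
    linear_combination ((a : Polynomial ℂ⟦X⟧) * (t ^ a * P)) * e2 -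
      ((b : Polynomial ℂ⟦X⟧) * (t ^ b * Q)) * e1
  · have e1 : Polynomial.derivative P = t * Polynomial.derivative r := by
      rw [hP, Polynomial.derivative_add, Polynomial.derivative_C, hdt1, zero_add]
    have e2 : Polynomial.derivative Q = Polynomial.C (PowerSeries.C κ') +
        t * Polynomial.derivative r' := by
      rw [hQ, Polynomial.derivative_add, Polynomial.derivative_C_mul, Polynomial.derivative_X,
        hdt1, mul_one]
    have e3 : (Polynomial.C (PowerSeries.C (a * κ * κ')) : Polynomial ℂ⟦X⟧) =
        (a : Polynomial ℂ⟦X⟧) * Polynomial.C (PowerSeries.C κ) *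
          Polynomial.C (PowerSeries.C κ') := by
      simp
    rw [hdt, hdt, e1, e2, e3, hP, pow_add]
    ring

/-- The pullback of `H₁ ω_{i,g} + d H₂` to the family, up to a power of `t`: either both
coefficients are divisible by the same power of `t` and the leading term of the coefficient of
the differential of the parameter is a monomial, or the leading term of the coefficient of `dt`
is a monomial and the other coefficient has larger order. -/
lemma tCoeff_vCoeff_cases (hg : C.g = g' + 1) {i : ℕ} (hi : i < C.g) {H₁ H₂ : Polynomial ℂ⟦X⟧}
    (hdeg₁ : H₁.natDegree < C.n) (hdeg₂ : H₂.natDegree < C.n) (hH₁ : H₁ ≠ 0)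
    (hH₂ : MvPowerSeries.constantCoeff (toSeries H₂) = 0) :
    ∃ κ : ℂ, κ ≠ 0 ∧ ∃ (s m : ℕ) (q r : Polynomial ℂ⟦X⟧),
      (C.inter (toSeries H₁) + (C.v i : ℕ∞) + (C.v C.g : ℕ∞) < C.inter (toSeries H₂) ∧
        C.tCoeff g' i H₁ H₂ = Polynomial.C PowerSeries.X ^ s * q ∧
        C.vCoeff g' i H₁ H₂ = Polynomial.C PowerSeries.X ^ s *
          (Polynomial.C (PowerSeries.C κ) * Polynomial.X ^ m +
            Polynomial.C PowerSeries.X * r)) ∨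
      (¬ C.inter (toSeries H₁) + (C.v i : ℕ∞) + (C.v C.g : ℕ∞) < C.inter (toSeries H₂) ∧
        C.tCoeff g' i H₁ H₂ = Polynomial.C PowerSeries.X ^ s *
          (Polynomial.C (PowerSeries.C κ) * Polynomial.X ^ m + Polynomial.C PowerSeries.X * r) ∧
        C.vCoeff g' i H₁ H₂ = Polynomial.C PowerSeries.X ^ (s + 1) * q) := by
  obtain ⟨κ₁, hκ₁, h₁, m₁, r₁, hi₁, hr₁⟩ := exists_onFamily_eq hg hH₁ hdeg₁
  obtain ⟨κ, hκ, q, r, hq, hr⟩ := exists_basic_eq hg hi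
  rw [tCoeff, vCoeff, hq, hr, hr₁, hi₁]
  set t : Polynomial ℂ⟦X⟧ := Polynomial.C PowerSeries.X with ht
  have hdt : ∀ (m : ℕ) (f : Polynomial ℂ⟦X⟧), Polynomial.derivative (t ^ m * f) =
      t ^ m * Polynomial.derivative f := by
    intro m f
    rw [ht, ← Polynomial.C_pow, Polynomial.derivative_C_mul]
  set a := C.v i + C.v (g' + 1) with ha
  have hs : (h₁ : ℕ∞) + (C.v i : ℕ∞) + (C.v C.g : ℕ∞) = ((h₁ + a : ℕ) : ℕ∞) := by
    rw [hg, ha]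
    push_cast
    ring
  rw [hs]
  set K₁ := Polynomial.C (PowerSeries.C κ₁) * Polynomial.X ^ m₁ + t * r₁ with hK₁
  set K := Polynomial.C (PowerSeries.C κ) + t * r with hK
  have hKK : K₁ * K = Polynomial.C (PowerSeries.C (κ₁ * κ)) * Polynomial.X ^ m₁ +
      t * (r₁ * K + Polynomial.C (PowerSeries.C κ₁) * Polynomial.X ^ m₁ * r) := by
    rw [hK₁, hK, map_mul, map_mul]
    ring
  by_cases hH : H₂ = 0
  · have h0 : C.onFamily g' H₂ = 0 := by rw [hH, onFamily, map_zero]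
    refine ⟨κ₁ * κ, mul_ne_zero hκ₁ hκ, h₁ + a, m₁, K₁ * q,
      r₁ * K + Polynomial.C (PowerSeries.C κ₁) * Polynomial.X ^ m₁ * r, Or.inl ⟨?_, ?_, ?_⟩⟩
    · have : C.inter (toSeries H₂) = ⊤ := by
        rw [inter, param, pull_toSeries C.n_ne_zero C.constantCoeff_eq, hH, map_zero,
          PowerSeries.order_zero]
      rw [this]
      exact ENat.natCast_lt_top _
    · rw [h0, coeffDeriv_zero, pow_add]
      ring
    · rw [h0, Polynomial.derivative_zero, ← hKK, pow_add]
      ring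
  obtain ⟨κ₂, hκ₂, h₂, m₂, r₂, hi₂, hr₂⟩ := exists_onFamily_eq hg hH hdeg₂
  have hpos : h₂ ≠ 0 := by
    have := C.inter_ne_zero hH₂
    rw [hi₂] at this
    exact_mod_cast this
  obtain ⟨h, rfl⟩ := Nat.exists_eq_succ_of_ne_zero hpos
  rw [hi₂, hr₂, hdt]
  set K₂ := Polynomial.C (PowerSeries.C κ₂) * Polynomial.X ^ m₂ + t * r₂ with hK₂
  have hdK₂ : coeffDeriv (t ^ h.succ * K₂) = t ^ h * (((h + 1 : ℕ) : Polynomial ℂ⟦X⟧) * K₂ +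
      t * coeffDeriv K₂) := by
    apply mul_left_cancel₀ C_X_ne_zero
    rw [ht, coeffDeriv_X_pow_mul, Nat.succ_eq_add_one]
    ring
  rw [hdK₂]
  by_cases hlt : h₁ + a < h.succ
  · obtain ⟨l, rfl⟩ := Nat.exists_eq_add_of_le (Nat.lt_succ_iff.1 hlt)
    refine ⟨κ₁ * κ, mul_ne_zero hκ₁ hκ, h₁ + a, m₁,
      K₁ * q + t ^ l * (((h₁ + a + l + 1 : ℕ) : Polynomial ℂ⟦X⟧) * K₂ + t * coeffDeriv K₂),
      (r₁ * K + Polynomial.C (PowerSeries.C κ₁) * Polynomial.X ^ m₁ * r) +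
        t ^ l * Polynomial.derivative K₂, Or.inl ⟨by exact_mod_cast hlt, ?_, ?_⟩⟩
    · ring
    · rw [Nat.succ_eq_add_one]
      linear_combination t ^ (h₁ + a) * hKK
  · obtain ⟨l, hl⟩ := Nat.exists_eq_add_of_le (not_lt.1 hlt)
    refine ⟨(h + 1 : ℕ) * κ₂, mul_ne_zero (by exact_mod_cast h.succ_ne_zero) hκ₂, h, m₂,
      t ^ l * (K₁ * K) + Polynomial.derivative K₂,
      t ^ l * (K₁ * q) + (((h + 1 : ℕ) : Polynomial ℂ⟦X⟧) * r₂ + coeffDeriv K₂),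
      Or.inr ⟨by exact_mod_cast hlt, ?_, ?_⟩⟩
    · have e1 : (t : Polynomial ℂ⟦X⟧) ^ h₁ * K₁ * (t ^ a * q) =
          t ^ (h₁ + a) * (K₁ * q) := by ring
      have e2 : (Polynomial.C (PowerSeries.C (((h + 1 : ℕ) : ℂ) * κ₂)) : Polynomial ℂ⟦X⟧) =
          ((h + 1 : ℕ) : Polynomial ℂ⟦X⟧) * Polynomial.C (PowerSeries.C κ₂) := by
        rw [map_mul, map_mul, map_natCast, map_natCast]
      rw [e1, hl, e2, hK₂, Nat.succ_eq_add_one]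
      ring
    · have e1 : (t : Polynomial ℂ⟦X⟧) ^ h₁ * K₁ * (t ^ a * K) =
          t ^ (h₁ + a) * (K₁ * K) := by ring
      rw [e1, hl, Nat.succ_eq_add_one]
      ring

/-! ### The criterion for the last component to be dicritical -/

lemma pullGeneric_eq (hg : C.g = g' + 1) {i : ℕ} (hi : i < C.g) {H₁ H₂ : Polynomial ℂ⟦X⟧}
    {ω : OneForm} (hω : ω = toSeries H₁ • C.basicForm i C.g + d (toSeries H₂)) :
    C.pullGeneric g' ω 0 =
        (C.tCoeff g' i H₁ H₂).eval₂ (inVar 0).toRingHom (C.genericValue g') ∧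
      C.pullGeneric g' ω 1 =
        (C.vCoeff g' i H₁ H₂).eval₂ (inVar 0).toRingHom (C.genericValue g') := by
  have hs := hasSubst_pair C.constantCoeff_X_pow_n (constantCoeff_pt_inVar hg (C.genericValue g'))
  have h : ∀ j, C.pullGeneric g' ω j =
      (C.tCoeff g' i H₁ H₂).eval₂ (inVar 0).toRingHom (C.genericValue g') *
          MvPowerSeries.pderiv ℂ j ((inVar 0).toRingHom PowerSeries.X) +
        (C.vCoeff g' i H₁ H₂).eval₂ (inVar 0).toRingHom (C.genericValue g') *
          MvPowerSeries.pderiv ℂ j (C.genericValue g') := by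
    intro j
    have h1 := pullback_eq hg hi H₁ H₂ hω (chainRule_inVar j) (C.genericValue g')
      (MvPowerSeries.substAlgHom (R := ℂ) hs).toRingHom (fun K => by
        change MvPowerSeries.substAlgHom hs (toSeries K) = _
        rw [MvPowerSeries.coe_substAlgHom]
        exact subst_toSeries_generic hg _ K)
    have hX : (inVar 0).toRingHom PowerSeries.X = (MvPowerSeries.X 0 : Bi) := inVar_X 0
    have h2 : ∀ G, (MvPowerSeries.substAlgHom (R := ℂ) hs).toRingHom G =
        MvPowerSeries.subst ![(MvPowerSeries.X 0 : Bi) ^ C.n,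
          C.pt (inVar 0).toRingHom g' (C.genericValue g')] G := by
      intro G
      change MvPowerSeries.substAlgHom hs G = _
      rw [MvPowerSeries.coe_substAlgHom]
    rw [← h1, h2, h2, hX]
    rfl
  have hX : (inVar 0).toRingHom PowerSeries.X = (MvPowerSeries.X 0 : Bi) := inVar_X 0
  have h01 : (0 : Fin 2) ≠ 1 := by decide
  rw [h 0, h 1, hX, genericValue, map_add, map_add, MvPowerSeries.pderiv_C,
    MvPowerSeries.pderiv_C, MvPowerSeries.pderiv_X_self, MvPowerSeries.pderiv_X_self,
    MvPowerSeries.pderiv_X_of_ne h01, MvPowerSeries.pderiv_X_of_ne h01.symm]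
  simp

/-- A polynomial in `v` with a monomial as leading coefficient has the value `t ^ s` times a unit at
`v = c + u`, because `c ≠ 0`. -/
lemma exists_eval₂_generic (hg : C.g = g' + 1) {κ : ℂ} (hκ : κ ≠ 0) (s m : ℕ)
    (r : Polynomial ℂ⟦X⟧) : ∃ w : Biˣ, (Polynomial.C PowerSeries.X ^ s *
      (Polynomial.C (PowerSeries.C κ) * Polynomial.X ^ m +
        Polynomial.C PowerSeries.X * r)).eval₂ (inVar 0).toRingHom (C.genericValue g') =
      (MvPowerSeries.X 0 : Bi) ^ s * (w : Bi) := by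
  obtain ⟨v, hv⟩ := exists_unit_genericValue hg
  have h := HasLead.exists_unit isSeriesRing_inVar (a := s)
    (s := cst (inVar 0).toRingHom (Units.mk0 κ hκ) * v ^ m)
    ⟨r.eval₂ (inVar 0).toRingHom (C.genericValue g'), rfl⟩
  obtain ⟨w, hw⟩ := h
  have hX : (inVar 0).toRingHom PowerSeries.X = (MvPowerSeries.X 0 : Bi) := inVar_X 0
  refine ⟨w, ?_⟩
  rw [← hX, ← hw, Units.val_mul, Units.val_pow_eq_pow_val, hv]
  simp only [Polynomial.eval₂_mul, Polynomial.eval₂_add, Polynomial.eval₂_pow,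
    Polynomial.eval₂_C, Polynomial.eval₂_X]
  rfl

/-- The criterion for the last exceptional component to be dicritical. -/
lemma isDicriticalAt_iff (hg : C.g = g' + 1) {i : ℕ} (hi : i < C.g) {H₁ H₂ : Polynomial ℂ⟦X⟧}
    (hdeg₁ : H₁.natDegree < C.n) (hdeg₂ : H₂.natDegree < C.n) (hH₁ : H₁ ≠ 0)
    (hH₂ : MvPowerSeries.constantCoeff (toSeries H₂) = 0)
    {ω : OneForm} (hω : ω = toSeries H₁ • C.basicForm i C.g + d (toSeries H₂)) :
    C.IsDicriticalAt ω C.lastTriplePoint ↔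
      C.inter (toSeries H₁) + (C.v i : ℕ∞) + (C.v C.g : ℕ∞) < C.inter (toSeries H₂) := by
  obtain ⟨k, a, h⟩ := exists_lastStage C hg
  obtain rfl := h.eq_one hg
  obtain ⟨h0, h1⟩ := pullGeneric_eq hg hi hω
  have hT : (MvPowerSeries.X 0 : Bi) ≠ 0 := X_zero_ne_zero
  have hnd : ∀ (l : ℕ) (w : Biˣ), ¬ (MvPowerSeries.X 0 : Bi) ^ (l + 1) ∣
      (MvPowerSeries.X 0 : Bi) ^ l * (w : Bi) := by
    intro l w hd
    rw [pow_succ] at hd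
    exact prime_X_zero.not_isUnit (isUnit_of_dvd_unit
      ((mul_dvd_mul_iff_left (pow_ne_zero l hT)).1 hd) w.isUnit)
  have hX : (inVar 0).toRingHom PowerSeries.X = (MvPowerSeries.X 0 : Bi) := inVar_X 0
  have hev : ∀ (l : ℕ) (q : Polynomial ℂ⟦X⟧), (Polynomial.C PowerSeries.X ^ l * q).eval₂
      (inVar 0).toRingHom (C.genericValue g') =
      (MvPowerSeries.X 0 : Bi) ^ l * q.eval₂ (inVar 0).toRingHom (C.genericValue g') := by
    intro l q
    rw [Polynomial.eval₂_mul, Polynomial.eval₂_pow, Polynomial.eval₂_C, hX]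
  rw [h.isDicriticalAt_iff hg, h0, h1]
  obtain ⟨κ, hκ, s, m, q, r, ⟨hlt, ht, hv⟩ | ⟨hlt, ht, hv⟩⟩ :=
    tCoeff_vCoeff_cases hg hi hdeg₁ hdeg₂ hH₁ hH₂
  · obtain ⟨w, hw⟩ := exists_eval₂_generic hg hκ s m r
    rw [iff_true_right hlt, ht, hv, hw, hev]
    exact ⟨s, dvd_mul_right _ _, dvd_mul_right _ _, hnd s w⟩
  · obtain ⟨w, hw⟩ := exists_eval₂_generic hg hκ s m r
    rw [iff_false_right hlt, ht, hv, hw, hev]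
    rintro ⟨l, h2, -, h4⟩
    have hl : l ≤ s := by
      by_contra! hl
      exact hnd s w ((pow_dvd_pow _ (show s + 1 ≤ l from hl)).trans h2)
    exact h4 ((pow_dvd_pow _ (show l + 1 ≤ s + 1 by omega)).trans (dvd_mul_right _ _))

end PlaneBranch

/-! ### Formal solutions of differential equations -/

section

variable {R : Type*} [CommRing R]

lemma constantCoeff_eval (P : Polynomial R⟦X⟧) (f : R⟦X⟧) :
    PowerSeries.constantCoeff (P.eval f) =
      (P.map PowerSeries.constantCoeff).eval (PowerSeries.constantCoeff f) := by
  rw [Polynomial.eval_map, Polynomial.eval₂_hom]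

lemma X_pow_dvd_derivative {n : ℕ} {f : R⟦X⟧} (h : PowerSeries.X ^ (n + 1) ∣ f) :
    PowerSeries.X ^ n ∣ PowerSeries.derivative R f := by
  rw [PowerSeries.X_pow_dvd_iff] at h ⊢
  intro m hm
  rw [PowerSeries.coeff_derivative, h (m + 1) (by omega), zero_mul]

/-- The left-hand side of the differential equation `P(t, f) + Q(t, f) f' = 0`. -/
def odeSide (P Q : Polynomial R⟦X⟧) (f : R⟦X⟧) : R⟦X⟧ :=
  P.eval f + Q.eval f * PowerSeries.derivative R f

/-- The coefficient of order `n` of the differential equation determines the next coefficient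
of the solution. -/
lemma coeff_odeSide (P Q : Polynomial R⟦X⟧) {f h : R⟦X⟧} {n : ℕ} {a : R}
    (hfh : PowerSeries.X ^ (n + 2) ∣ h - (f + PowerSeries.C a * PowerSeries.X ^ (n + 1))) :
    PowerSeries.coeff n (odeSide P Q h) = PowerSeries.coeff n (odeSide P Q f) +
      (Q.map PowerSeries.constantCoeff).eval (PowerSeries.constantCoeff f) * (a * (n + 1)) := by
  have h1 : PowerSeries.X ^ (n + 1) ∣ h - f := by
    have h2 := (pow_dvd_pow PowerSeries.X (show n + 1 ≤ n + 2 by omega)).trans hfh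
    have h3 := dvd_add h2 (dvd_mul_left (PowerSeries.X ^ (n + 1)) (PowerSeries.C a))
    convert h3 using 1
    ring
  have h4 : PowerSeries.X ^ (n + 1) ∣ PowerSeries.derivative R h -
      (PowerSeries.derivative R f +
        PowerSeries.C (a * (n + 1)) * PowerSeries.X ^ n) := by
    have h5 := X_pow_dvd_derivative hfh
    convert h5 using 1
    rw [map_sub, map_add, Derivation.leibniz, PowerSeries.derivative_C,
      PowerSeries.derivative_pow, PowerSeries.derivative_X]
    simp
    ring
  have h6 : PowerSeries.X ^ (n + 1) ∣ odeSide P Q h - (odeSide P Q f +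
      Q.eval f * (PowerSeries.C (a * (n + 1)) * PowerSeries.X ^ n)) := by
    have e1 := h1.trans (Polynomial.sub_dvd_eval_sub h f P)
    have e2 := (h1.trans (Polynomial.sub_dvd_eval_sub h f Q)).mul_right
      (PowerSeries.derivative R h)
    have e3 := h4.mul_left (Q.eval f)
    convert dvd_add (dvd_add e1 e2) e3 using 1
    rw [odeSide, odeSide]
    ring
  have h7 := PowerSeries.X_pow_dvd_iff.1 h6 n (Nat.lt_succ_self n)
  rw [map_sub, sub_eq_zero, map_add, ← mul_assoc, PowerSeries.coeff_mul_X_pow'] at h7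
  rw [h7, if_pos le_rfl, Nat.sub_self, PowerSeries.coeff_zero_eq_constantCoeff_apply, map_mul,
    PowerSeries.constantCoeff_C, constantCoeff_eval]

/-- A regular differential equation with prescribed initial value has a formal solution. -/
lemma exists_formal_solution [Algebra ℂ R] (P Q : Polynomial R⟦X⟧) (u b : R)
    (hb : (Q.map PowerSeries.constantCoeff).eval u * b = 1) :
    ∃ f : R⟦X⟧, PowerSeries.constantCoeff f = u ∧ odeSide P Q f = 0 := by
  -- Each approximation is corrected in degree `n + 1` so as to annihilate the coefficient of order
  -- `n` of the equation.
  let step : ℕ → R⟦X⟧ → R⟦X⟧ := fun n f => f + PowerSeries.C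
    (-(b * algebraMap ℂ R ((n + 1 : ℂ)⁻¹)) * PowerSeries.coeff n (odeSide P Q f)) *
      PowerSeries.X ^ (n + 1)
  let approx : ℕ → R⟦X⟧ := fun n => Nat.rec (PowerSeries.C u) step n
  have happ : ∀ n, approx (n + 1) = step n (approx n) := fun n => rfl
  have hstab : ∀ n k, k ≤ n → PowerSeries.coeff k (approx n) = PowerSeries.coeff k (approx k) := by
    intro n
    induction n with
    | zero =>
      intro k hk
      rw [Nat.le_zero.1 hk]
    | succ n ih =>
      intro k hk
      rcases Nat.le_succ_iff.1 hk with hk | rfl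
      · rw [← ih k hk, happ]
        simp only [step, map_add]
        rw [PowerSeries.coeff_mul_X_pow', if_neg (by omega), add_zero]
      · rfl
  have hconst : ∀ n, PowerSeries.constantCoeff (approx n) = u := by
    intro n
    rw [← PowerSeries.coeff_zero_eq_constantCoeff_apply, hstab n 0 (Nat.zero_le _),
      PowerSeries.coeff_zero_eq_constantCoeff_apply]
    exact PowerSeries.constantCoeff_C u
  set f : R⟦X⟧ := PowerSeries.mk fun k => PowerSeries.coeff k (approx k) with hf
  have hdvd : ∀ n, PowerSeries.X ^ (n + 1) ∣ f - approx n := by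
    intro n
    rw [PowerSeries.X_pow_dvd_iff]
    intro m hm
    rw [map_sub, hf, PowerSeries.coeff_mk, hstab n m (by omega), sub_self]
  refine ⟨f, ?_, ?_⟩
  · rw [hf, ← PowerSeries.coeff_zero_eq_constantCoeff_apply, PowerSeries.coeff_mk,
      PowerSeries.coeff_zero_eq_constantCoeff_apply, hconst]
  · ext n
    have h1 := hdvd (n + 1)
    rw [happ] at h1
    rw [coeff_odeSide P Q h1, hconst, map_zero]
    have h2 : algebraMap ℂ R ((n + 1 : ℂ)⁻¹) * ((n : R) + 1) = 1 := by
      have h3 : ((n : R) + 1) = algebraMap ℂ R (n + 1 : ℂ) := by simp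
      rw [h3, ← map_mul, inv_mul_cancel₀ (by exact_mod_cast n.succ_ne_zero), map_one]
    linear_combination (-(PowerSeries.coeff n (odeSide P Q (approx n))) *
      algebraMap ℂ R ((n + 1 : ℂ)⁻¹) * ((n : R) + 1)) * hb -
      PowerSeries.coeff n (odeSide P Q (approx n)) * h2

end

lemma map_odeSide {R S : Type*} [CommRing R] [CommRing S] (σ : R →+* S)
    (P Q : Polynomial R⟦X⟧) (f : R⟦X⟧) :
    PowerSeries.map σ (odeSide P Q f) =
      odeSide (P.map (PowerSeries.map σ)) (Q.map (PowerSeries.map σ)) (PowerSeries.map σ f) := by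
  have h : PowerSeries.map σ (PowerSeries.derivative R f) =
      PowerSeries.derivative S (PowerSeries.map σ f) := by
    ext n
    simp [PowerSeries.coeff_derivative]
  rw [odeSide, odeSide, map_add, map_mul, h, Polynomial.eval_map, Polynomial.eval_map,
    Polynomial.eval₂_hom, Polynomial.eval₂_hom]

/-! ### Laurent polynomials and rational functions -/

/-- A Laurent polynomial as a rational function without poles outside the origin. -/
lemma exists_ratFunc (p : LaurentPolynomial ℂ) : ∃ s : RatFunc ℂ, ∀ u : ℂˣ,
    s.denom.eval (u : ℂ) ≠ 0 ∧
      s.eval (RingHom.id ℂ) (u : ℂ) = LaurentPolynomial.eval₂ (RingHom.id ℂ) u p := by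
  obtain ⟨N, q, hq⟩ := p.exists_T_pow
  refine ⟨algebraMap _ _ q / algebraMap _ _ (Polynomial.X ^ N : Polynomial ℂ), fun u => ?_⟩
  have hu : (u : ℂ) ^ N ≠ 0 := pow_ne_zero _ u.ne_zero
  set s : RatFunc ℂ := algebraMap _ _ q / algebraMap _ _ (Polynomial.X ^ N : Polynomial ℂ) with hs
  have hden : s.denom.eval (u : ℂ) ≠ 0 := by
    intro h
    obtain ⟨w, hw⟩ := RatFunc.denom_div_dvd q (Polynomial.X ^ N : Polynomial ℂ)
    have h1 := congr_arg (Polynomial.eval (u : ℂ)) hw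
    rw [← hs, Polynomial.eval_mul, h, zero_mul, Polynomial.eval_pow, Polynomial.eval_X] at h1
    exact hu h1
  refine ⟨hden, ?_⟩
  have h1 : s * algebraMap _ _ (Polynomial.X ^ N : Polynomial ℂ) = algebraMap _ _ q :=
    div_mul_cancel₀ _ (RatFunc.algebraMap_ne_zero (pow_ne_zero _ Polynomial.X_ne_zero))
  have h2 := congr_arg (RatFunc.eval (RingHom.id ℂ) (u : ℂ)) h1
  have h4 := RatFunc.eval_mul (f := RingHom.id ℂ) (a := (u : ℂ)) (x := s)
    (y := algebraMap _ _ (Polynomial.X ^ N : Polynomial ℂ)) (by rwa [Polynomial.eval₂_id])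
    (by rw [RatFunc.denom_algebraMap]; simp)
  rw [h4, RatFunc.eval_algebraMap, RatFunc.eval_algebraMap] at h2
  have h3 := congr_arg (LaurentPolynomial.eval₂ (RingHom.id ℂ) u) hq
  rw [map_mul, LaurentPolynomial.eval₂_toLaurent, LaurentPolynomial.eval₂_T_n] at h3
  rw [← mul_left_inj' hu, ← h3]
  simpa using h2

/-- The solutions of a differential equation `P(t, f) + Q(t, f) f' = 0` with `Q(0, f) = κ f ^ m`
depend rationally on their initial value. -/
lemma exists_rational_solution (P Q : Polynomial ℂ⟦X⟧) {κ : ℂ} (hκ : κ ≠ 0) {m : ℕ}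
    (hQ : Q.map PowerSeries.constantCoeff = Polynomial.C κ * Polynomial.X ^ m) :
    ∃ s : ℕ → RatFunc ℂ, ∀ u : ℂ, u ≠ 0 → (∀ k, (s k).denom.eval u ≠ 0) ∧
      (s 0).eval (RingHom.id ℂ) u = u ∧
      odeSide P Q (PowerSeries.mk fun k => (s k).eval (RingHom.id ℂ) u) = 0 := by
  let ε : ℂ →+* LaurentPolynomial ℂ := algebraMap ℂ (LaurentPolynomial ℂ)
  have hεC : ∀ c, ε c = LaurentPolynomial.C c := fun c => rfl
  obtain ⟨f, hf0, hf⟩ := exists_formal_solution (P.map (PowerSeries.map ε))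
    (Q.map (PowerSeries.map ε)) (LaurentPolynomial.T 1)
    (LaurentPolynomial.C κ⁻¹ * LaurentPolynomial.T (-(m : ℤ))) (by
      have h1 : (Q.map (PowerSeries.map ε)).map PowerSeries.constantCoeff =
          (Q.map PowerSeries.constantCoeff).map ε := by
        rw [Polynomial.map_map, Polynomial.map_map]
        congr 1
      rw [h1, hQ, Polynomial.map_mul, Polynomial.map_pow, Polynomial.map_X, Polynomial.map_C,
        Polynomial.eval_mul, Polynomial.eval_pow, Polynomial.eval_X, Polynomial.eval_C, hεC,
        LaurentPolynomial.T_pow, mul_mul_mul_comm, ← map_mul, mul_inv_cancel₀ hκ, map_one,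
        ← LaurentPolynomial.T_add]
      simp)
  choose s hs using fun k => exists_ratFunc (PowerSeries.coeff k f)
  refine ⟨s, fun u hu => ?_⟩
  let σ : LaurentPolynomial ℂ →+* ℂ :=
    LaurentPolynomial.eval₂ (RingHom.id ℂ) (Units.mk0 u hu)
  have hσ : ∀ k, (s k).eval (RingHom.id ℂ) u = σ (PowerSeries.coeff k f) :=
    fun k => (hs k (Units.mk0 u hu)).2
  refine ⟨fun k => (hs k (Units.mk0 u hu)).1, ?_, ?_⟩
  · rw [hσ, PowerSeries.coeff_zero_eq_constantCoeff_apply, hf0]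
    change LaurentPolynomial.eval₂ _ _ _ = _
    rw [LaurentPolynomial.eval₂_T]
    simp
  · have h1 : (PowerSeries.mk fun k => (s k).eval (RingHom.id ℂ) u) = PowerSeries.map σ f := by
      ext k
      rw [PowerSeries.coeff_mk, hσ, PowerSeries.coeff_map]
    have h2 : (PowerSeries.map σ).comp (PowerSeries.map ε) = RingHom.id ℂ⟦X⟧ := by
      ext f k
      change PowerSeries.coeff k (PowerSeries.map σ (PowerSeries.map ε f)) = _
      rw [PowerSeries.coeff_map, PowerSeries.coeff_map, hεC]
      change LaurentPolynomial.eval₂ _ _ _ = _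
      rw [LaurentPolynomial.eval₂_C]
      rfl
    have h3 := map_odeSide σ (P.map (PowerSeries.map ε)) (Q.map (PowerSeries.map ε)) f
    rw [hf, map_zero, Polynomial.map_map, Polynomial.map_map, h2, Polynomial.map_id,
      Polynomial.map_id] at h3
    rw [h1, ← h3]

/-! ### Operations on convergent power series -/

lemma isConvergent_of_coeff_eq_zero {f : ℂ⟦X⟧} (N : ℕ)
    (h : ∀ k, N ≤ k → PowerSeries.coeff k f = 0) : IsConvergent f := by
  refine ⟨1, one_pos, summable_of_ne_finset_zero (s := Finset.range N) fun k hk => ?_⟩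
  rw [h k (by simpa using hk)]
  simp

lemma isConvergent_C (c : ℂ) : IsConvergent (PowerSeries.C c) :=
  isConvergent_of_finite fun k hk => by rw [PowerSeries.coeff_C, if_neg (by omega)]

lemma isConvergent_X_pow (n : ℕ) : IsConvergent (PowerSeries.X ^ n : ℂ⟦X⟧) :=
  isConvergent_of_coeff_eq_zero (n + 1) fun k hk => by
    rw [PowerSeries.coeff_X_pow, if_neg (by omega)]

lemma IsConvergent.derivative {f : ℂ⟦X⟧} (hf : IsConvergent f) :
    IsConvergent (PowerSeries.derivative ℂ f) := by
  obtain ⟨r, hr, hf⟩ := hf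
  refine ⟨r / 2, by positivity, Summable.of_nonneg_of_le (fun k => by positivity) (fun k => ?_)
    (((summable_nat_add_iff 1).2 hf).mul_left (2 / r))⟩
  rw [PowerSeries.coeff_derivative, norm_mul]
  have h1 : ‖((k : ℂ) + 1)‖ = (k : ℝ) + 1 := by
    have : ((k : ℂ) + 1) = ((k + 1 : ℕ) : ℂ) := by push_cast; rfl
    rw [this, Complex.norm_natCast]
    push_cast
    rfl
  have h2 : (k : ℝ) + 1 ≤ 2 ^ (k + 1) := by
    have := (Nat.lt_two_pow_self (n := k + 1)).le
    exact_mod_cast this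
  have h3 : (r / 2) ^ k * 2 ^ (k + 1) = 2 / r * r ^ (k + 1) := by
    rw [div_pow, pow_succ, pow_succ]
    field_simp
  rw [h1]
  calc ‖PowerSeries.coeff (k + 1) f‖ * ((k : ℝ) + 1) * (r / 2) ^ k
      ≤ ‖PowerSeries.coeff (k + 1) f‖ * 2 ^ (k + 1) * (r / 2) ^ k := by gcongr
    _ = ‖PowerSeries.coeff (k + 1) f‖ * ((r / 2) ^ k * 2 ^ (k + 1)) := by ring
    _ = _ := by rw [h3]; ring

lemma IsConvergent.of_X_pow_mul {f : ℂ⟦X⟧} {s : ℕ} (hf : IsConvergent (PowerSeries.X ^ s * f)) :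
    IsConvergent f := by
  obtain ⟨r, hr, hf⟩ := hf
  refine ⟨r, hr, ?_⟩
  have h1 := ((summable_nat_add_iff s).2 hf).mul_left ((r ^ s)⁻¹)
  refine h1.congr fun k => ?_
  rw [PowerSeries.coeff_X_pow_mul', if_pos (by omega), Nat.add_sub_cancel, pow_add]
  field_simp

lemma IsConvergent.expand {f : ℂ⟦X⟧} (hf : IsConvergent f) {n : ℕ} (hn : n ≠ 0) :
    IsConvergent (PowerSeries.expand n hn f) := by
  obtain ⟨r, hr, hf⟩ := hf
  have hinj : Function.Injective fun k : ℕ => n * k :=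
    fun a b h => Nat.eq_of_mul_eq_mul_left (Nat.pos_of_ne_zero hn) h
  refine ⟨min r 1, lt_min hr one_pos, (hinj.summable_iff ?_).1
    (Summable.of_nonneg_of_le (fun k => ?_) (fun k => ?_) hf)⟩
  · intro k hk
    rw [PowerSeries.coeff_expand, if_neg, norm_zero, zero_mul]
    rintro ⟨l, rfl⟩
    exact hk ⟨l, rfl⟩
  · have : 0 ≤ min r 1 := (lt_min hr one_pos).le
    simp only [Function.comp]
    positivity
  · simp only [Function.comp]
    rw [PowerSeries.coeff_expand_mul]
    have h0 : 0 ≤ min r 1 := (lt_min hr one_pos).le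
    have h1 : (min r 1) ^ (n * k) ≤ (min r 1) ^ k :=
      pow_le_pow_of_le_one h0 (min_le_right _ _)
        (Nat.le_mul_of_pos_left k (Nat.pos_of_ne_zero hn))
    gcongr
    exact h1.trans (pow_le_pow_left₀ h0 (min_le_left _ _) k)

/-- The ring of polynomials with convergent coefficients. -/
def convergentPolys : Subring (Polynomial ℂ⟦X⟧) :=
  Polynomial.liftsRing convergentSeries.subtype

lemma mem_convergentPolys {P : Polynomial ℂ⟦X⟧} :
    P ∈ convergentPolys ↔ ∀ k, IsConvergent (P.coeff k) := by
  rw [convergentPolys, ← Polynomial.lifts_iff_liftsRing, Polynomial.lifts_iff_coeff_lifts]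
  refine forall_congr' fun k => ?_
  constructor
  · rintro ⟨f, hf⟩
    rw [← hf]
    exact f.2
  · intro h
    exact ⟨⟨_, h⟩, rfl⟩

lemma exists_map_eq {P : Polynomial ℂ⟦X⟧} (h : P ∈ convergentPolys) :
    ∃ P' : Polynomial convergentSeries, P'.map convergentSeries.subtype = P := by
  rw [convergentPolys, ← Polynomial.lifts_iff_liftsRing, Polynomial.mem_lifts] at h
  exact h

lemma C_mem_convergentPolys {f : ℂ⟦X⟧} (hf : IsConvergent f) :
    Polynomial.C f ∈ convergentPolys := by
  rw [mem_convergentPolys]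
  intro k
  rw [Polynomial.coeff_C]
  split_ifs
  · exact hf
  · exact convergentSeries.zero_mem

lemma X_mem_convergentPolys : (Polynomial.X : Polynomial ℂ⟦X⟧) ∈ convergentPolys :=
  (Polynomial.lifts_iff_liftsRing _ _).1 (Polynomial.X_mem_lifts _)

lemma comp_mem_convergentPolys {P Q : Polynomial ℂ⟦X⟧} (hP : P ∈ convergentPolys)
    (hQ : Q ∈ convergentPolys) : P.comp Q ∈ convergentPolys := by
  rw [Polynomial.comp, Polynomial.eval₂_eq_sum_range]
  exact sum_mem fun k _ => mul_mem (C_mem_convergentPolys (mem_convergentPolys.1 hP k))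
    (pow_mem hQ k)

lemma derivative_mem_convergentPolys {P : Polynomial ℂ⟦X⟧} (hP : P ∈ convergentPolys) :
    Polynomial.derivative P ∈ convergentPolys := by
  rw [mem_convergentPolys] at hP ⊢
  intro k
  rw [Polynomial.coeff_derivative]
  have h : ((k : ℂ⟦X⟧) + 1) ∈ convergentSeries :=
    add_mem (natCast_mem _ k) (one_mem _)
  exact (hP (k + 1)).mul h

lemma coeffDeriv_mem_convergentPolys {P : Polynomial ℂ⟦X⟧} (hP : P ∈ convergentPolys) :
    coeffDeriv P ∈ convergentPolys := by
  rw [mem_convergentPolys] at hP ⊢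
  intro k
  rw [coeff_coeffDeriv]
  exact (hP k).derivative

lemma mem_convergentPolys_of_X_pow_mul {P : Polynomial ℂ⟦X⟧} {s : ℕ}
    (hP : Polynomial.C PowerSeries.X ^ s * P ∈ convergentPolys) : P ∈ convergentPolys := by
  rw [mem_convergentPolys] at hP ⊢
  intro k
  have h := hP k
  rw [← Polynomial.C_pow, Polynomial.coeff_C_mul] at h
  exact h.of_X_pow_mul

/-! ### Convergence of formal solutions -/

/-- Partial sums of the series of absolute values at radius `ρ`. -/
def partialNorm (ρ : ℝ) (K : ℕ) (f : ℂ⟦X⟧) : ℝ :=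
  ∑ k ∈ Finset.range (K + 1), ‖PowerSeries.coeff k f‖ * ρ ^ k

section

variable {ρ : ℝ}

lemma partialNorm_nonneg (hρ : 0 ≤ ρ) (K : ℕ) (f : ℂ⟦X⟧) :
    0 ≤ partialNorm ρ K f :=
  Finset.sum_nonneg fun k _ => by positivity

lemma partialNorm_add (hρ : 0 ≤ ρ) (K : ℕ) (f h : ℂ⟦X⟧) :
    partialNorm ρ K (f + h) ≤ partialNorm ρ K f + partialNorm ρ K h := by
  rw [partialNorm, partialNorm, partialNorm, ← Finset.sum_add_distrib]
  refine Finset.sum_le_sum fun k _ => ?_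
  rw [map_add, ← add_mul]
  gcongr
  exact norm_add_le _ _

lemma partialNorm_mul (hρ : 0 ≤ ρ) (K : ℕ) (f h : ℂ⟦X⟧) :
    partialNorm ρ K (f * h) ≤ partialNorm ρ K f * partialNorm ρ K h := by
  rw [partialNorm, partialNorm, partialNorm, Finset.sum_mul_sum, ← Finset.sum_product']
  refine le_trans (Finset.sum_le_sum fun n hn => ?_)
    (Finset.sum_fiberwise_le_sum_of_sum_fiber_nonneg (t := Finset.range (K + 1))
      (g := fun p : ℕ × ℕ => p.1 + p.2) fun n _ => Finset.sum_nonneg fun p _ => by positivity)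
  have hn' : n ≤ K := Nat.lt_succ_iff.1 (Finset.mem_range.1 hn)
  have h1 : {p ∈ Finset.range (K + 1) ×ˢ Finset.range (K + 1) | p.1 + p.2 = n} =
      Finset.HasAntidiagonal.antidiagonal n := by
    ext p
    simp only [Finset.mem_filter, Finset.mem_product, Finset.mem_range,
      Finset.HasAntidiagonal.mem_antidiagonal]
    omega
  rw [h1, PowerSeries.coeff_mul]
  calc ‖∑ p ∈ Finset.HasAntidiagonal.antidiagonal n,
        PowerSeries.coeff p.1 f * PowerSeries.coeff p.2 h‖ * ρ ^ n
      ≤ (∑ p ∈ Finset.HasAntidiagonal.antidiagonal n,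
          ‖PowerSeries.coeff p.1 f * PowerSeries.coeff p.2 h‖) *
          ρ ^ n := by
        gcongr
        exact norm_sum_le _ _
    _ = _ := by
        rw [Finset.sum_mul]
        refine Finset.sum_congr rfl fun p hp => ?_
        rw [← Finset.HasAntidiagonal.mem_antidiagonal.1 hp, norm_mul, pow_add]
        ring

lemma partialNorm_X_mul (ρ : ℝ) (K : ℕ) (f : ℂ⟦X⟧) :
    partialNorm ρ (K + 1) (PowerSeries.X * f) = ρ * partialNorm ρ K f := by
  rw [partialNorm, partialNorm, Finset.sum_range_succ', Finset.mul_sum]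
  simp only [PowerSeries.coeff_succ_X_mul, PowerSeries.coeff_zero_X_mul, norm_zero, zero_mul,
    add_zero]
  exact Finset.sum_congr rfl fun k _ => by ring

lemma partialNorm_mono (hρ : 0 ≤ ρ) (K : ℕ) (f : ℂ⟦X⟧) {L : ℕ} (hKL : K ≤ L) :
    partialNorm ρ K f ≤ partialNorm ρ L f := by
  refine Finset.sum_le_sum_of_subset_of_nonneg ?_ fun k _ _ => by positivity
  intro k
  simp only [Finset.mem_range]
  omega

lemma partialNorm_X_mul_le (hρ : 0 ≤ ρ) (K : ℕ) (f : ℂ⟦X⟧) :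
    partialNorm ρ K (PowerSeries.X * f) ≤ ρ * partialNorm ρ K f :=
  (partialNorm_mono hρ K _ K.le_succ).trans (partialNorm_X_mul ρ K f).le

/-- The product of two power series without constant term is determined, up to order `K + 1`,
by their coefficients up to order `K`. -/
lemma partialNorm_mul_of_constantCoeff (hρ : 0 ≤ ρ) (K : ℕ) (f h : ℂ⟦X⟧)
    (hf : PowerSeries.constantCoeff f = 0)
    (hh : PowerSeries.constantCoeff h = 0) :
    partialNorm ρ (K + 1) (f * h) ≤ partialNorm ρ K f * partialNorm ρ K h := by
  obtain ⟨f', rfl⟩ := PowerSeries.X_dvd_iff.2 hf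
  obtain ⟨h', rfl⟩ := PowerSeries.X_dvd_iff.2 hh
  have e : PowerSeries.X * f' * (PowerSeries.X * h') =
      PowerSeries.X * (PowerSeries.X * (f' * h')) := by ring
  rw [e, partialNorm_X_mul]
  cases K with
  | zero => simp [partialNorm]
  | succ K =>
    rw [partialNorm_X_mul, partialNorm_X_mul, partialNorm_X_mul]
    have := partialNorm_mul hρ K f' h'
    calc ρ * (ρ * partialNorm ρ K (f' * h'))
        ≤ ρ * (ρ * (partialNorm ρ K f' * partialNorm ρ K h')) := by gcongr
      _ = _ := by ring

end

lemma exists_partialNorm_le {f : ℂ⟦X⟧} (hf : IsConvergent f) : ∃ r M : ℝ, 0 < r ∧ 0 ≤ M ∧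
    ∀ ρ, 0 ≤ ρ → ρ ≤ r → ∀ K, partialNorm ρ K f ≤ M := by
  obtain ⟨r, hr, hf⟩ := hf
  refine ⟨r, ∑' k, ‖PowerSeries.coeff k f‖ * r ^ k, hr, tsum_nonneg fun k => by positivity,
    fun ρ hρ hle K => ?_⟩
  refine le_trans (Finset.sum_le_sum fun k _ => ?_)
    (hf.sum_le_tsum (Finset.range (K + 1)) fun k _ => by positivity)
  gcongr

lemma exists_partialNorm_eval_le {P : Polynomial ℂ⟦X⟧} (hP : P ∈ convergentPolys) :
    ∃ r M : ℝ, 0 < r ∧ 0 ≤ M ∧ ∀ ρ, 0 ≤ ρ → ρ ≤ r → ∀ K W, partialNorm ρ K W ≤ 1 →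
      partialNorm ρ K (P.eval W) ≤ M := by
  obtain ⟨P', rfl⟩ := exists_map_eq hP
  clear hP
  induction P' using Polynomial.induction_on' with
  | add p q hp hq =>
    obtain ⟨r, M, hr, hM, h⟩ := hp
    obtain ⟨r', M', hr', hM', h'⟩ := hq
    refine ⟨min r r', M + M', lt_min hr hr', by positivity, fun ρ hρ hle K W hW => ?_⟩
    rw [Polynomial.map_add, Polynomial.eval_add]
    exact (partialNorm_add hρ K _ _).trans (add_le_add
      (h ρ hρ (hle.trans (min_le_left _ _)) K W hW)
      (h' ρ hρ (hle.trans (min_le_right _ _)) K W hW))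
  | monomial k f =>
    obtain ⟨r, M, hr, hM, h⟩ := exists_partialNorm_le f.2
    refine ⟨r, M, hr, hM, fun ρ hρ hle K W hW => ?_⟩
    rw [Polynomial.map_monomial, Polynomial.eval_monomial]
    have hpow : partialNorm ρ K (W ^ k) ≤ 1 := by
      induction k with
      | zero =>
        rw [pow_zero, partialNorm, Finset.sum_range_succ']
        simp [PowerSeries.coeff_one]
      | succ k ih =>
        rw [pow_succ]
        exact (partialNorm_mul hρ K _ _).trans
          (mul_le_one₀ ih (partialNorm_nonneg hρ K W) hW)
    refine (partialNorm_mul hρ K _ _).trans ?_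
    refine (mul_le_of_le_one_right (partialNorm_nonneg hρ K _) hpow).trans ?_
    exact h ρ hρ hle K

/-- Formal solutions of regular differential equations with convergent coefficients converge: on
a small disk, the partial sums of the majorant of `t f'` are bounded by induction. -/
lemma isConvergent_of_odeSide_eq_zero {P Q : Polynomial ℂ⟦X⟧} (hP : P ∈ convergentPolys)
    (hQ : Q ∈ convergentPolys) {f : ℂ⟦X⟧} (hf : odeSide P Q f = 0)
    (h0 : (Q.map PowerSeries.constantCoeff).eval (PowerSeries.constantCoeff f) ≠ 0) :
    IsConvergent f := by
  set u := PowerSeries.constantCoeff f with hu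
  set b := (Q.map PowerSeries.constantCoeff).eval u with hb
  set W := f - PowerSeries.C u with hW
  set Y := PowerSeries.X * PowerSeries.derivative ℂ f with hY
  -- Move the initial value to the origin.
  set L : Polynomial ℂ⟦X⟧ := Polynomial.X + Polynomial.C (PowerSeries.C u) with hL
  have hLmem : L ∈ convergentPolys :=
    add_mem X_mem_convergentPolys (C_mem_convergentPolys (isConvergent_C u))
  have hLW : L.eval W = f := by
    rw [hL, Polynomial.eval_add, Polynomial.eval_X, Polynomial.eval_C, hW]
    ring
  have hP1 := comp_mem_convergentPolys hP hLmem
  have hQ1 := comp_mem_convergentPolys hQ hLmem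
  set P₁ := P.comp L
  set Q₁ := Q.comp L with hQ₁
  have hPW : P₁.eval W = P.eval f := by rw [Polynomial.eval_comp, hLW]
  have hQW : Q₁.eval W = Q.eval f := by rw [Polynomial.eval_comp, hLW]
  have hQ0 : PowerSeries.constantCoeff (Q₁.coeff 0) = b := by
    rw [Polynomial.coeff_zero_eq_eval_zero, hQ₁, Polynomial.eval_comp, constantCoeff_eval]
    rw [hL]
    simp [hb]
  obtain ⟨q, hq⟩ : PowerSeries.X ∣ Q₁.coeff 0 - PowerSeries.C b := by
    rw [PowerSeries.X_dvd_iff, map_sub, hQ0, PowerSeries.constantCoeff_C, sub_self]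
  have hqc : IsConvergent q := by
    refine IsConvergent.of_X_pow_mul (s := 1) ?_
    rw [pow_one, ← hq]
    exact convergentSeries.sub_mem (mem_convergentPolys.1 hQ1 0) (isConvergent_C b)
  have hD : Q₁.divX ∈ convergentPolys := by
    rw [mem_convergentPolys] at hQ1 ⊢
    intro k
    rw [Polynomial.coeff_divX]
    exact hQ1 _
  have hQeval : Q₁.eval W = PowerSeries.C b + (PowerSeries.X * q + W * Q₁.divX.eval W) := by
    conv_lhs => rw [← Polynomial.divX_mul_X_add Q₁]
    rw [Polynomial.eval_add, Polynomial.eval_mul, Polynomial.eval_X, Polynomial.eval_C]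
    linear_combination hq
  set Z := PowerSeries.X * q + W * Q₁.divX.eval W with hZ
  have heq : PowerSeries.C b * Y = (-1 : ℂ⟦X⟧) * (PowerSeries.X * P₁.eval W + Z * Y) := by
    rw [odeSide, ← hPW, ← hQW, hQeval] at hf
    rw [hY]
    linear_combination PowerSeries.X * hf
  have hW0 : PowerSeries.constantCoeff W = 0 := by
    rw [hW, map_sub, PowerSeries.constantCoeff_C, sub_self]
  have hY0 : PowerSeries.constantCoeff Y = 0 := by
    rw [hY, map_mul, PowerSeries.constantCoeff_X, zero_mul]
  have hZ0 : PowerSeries.constantCoeff Z = 0 := by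
    rw [hZ, map_add, map_mul, map_mul, hW0, PowerSeries.constantCoeff_X, zero_mul, zero_mul,
      add_zero]
  have hWY : ∀ (ρ : ℝ) (K : ℕ), 0 ≤ ρ → partialNorm ρ K W ≤ partialNorm ρ K Y := by
    intro ρ K hρ
    refine Finset.sum_le_sum fun k _ => ?_
    gcongr
    cases k with
    | zero =>
      rw [PowerSeries.coeff_zero_eq_constantCoeff_apply, hW0, norm_zero]
      exact norm_nonneg _
    | succ k =>
      rw [hW, hY, PowerSeries.coeff_succ_X_mul, PowerSeries.coeff_derivative, map_sub,
        PowerSeries.coeff_C, if_neg (Nat.succ_ne_zero k), sub_zero, norm_mul]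
      refine le_mul_of_one_le_right (norm_nonneg _) ?_
      have : ((k : ℂ) + 1) = ((k + 1 : ℕ) : ℂ) := by push_cast; rfl
      rw [this, Complex.norm_natCast]
      exact_mod_cast Nat.succ_pos k
  obtain ⟨r₁, M₁, hr₁, hM₁, hb₁⟩ := exists_partialNorm_eval_le hP1
  obtain ⟨r₂, M₂, hr₂, hM₂, hb₂⟩ := exists_partialNorm_eval_le hD
  obtain ⟨r₃, M₃, hr₃, hM₃, hb₃⟩ := exists_partialNorm_le hqc
  set M := M₁ + M₂ + M₃ + 1 with hM
  have hMpos : 0 < M := by positivity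
  set β := ‖b‖ with hβ
  have hβpos : 0 < β := norm_pos_iff.2 h0
  -- With `W = f - u`, `Y = t f'` and `Z` without constant term, the equation reads
  -- `b Y = -(t P₁(W) + Z Y)`. The constants are chosen such that the bound `δ` for the
  -- `K`-th partial sum of the majorant of `Y` yields `β δ` as a bound for the `(K + 1)`-st one of
  -- the right-hand side.
  set δ := min 1 (β / (4 * M)) with hδ
  have hδpos : 0 < δ := lt_min one_pos (by positivity)
  set ρ := min (min r₁ (min r₂ r₃)) (β * δ / (4 * M)) with hρ
  have hρpos : 0 < ρ := lt_min (lt_min hr₁ (lt_min hr₂ hr₃)) (by positivity)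
  have hρr : ρ ≤ min r₁ (min r₂ r₃) := min_le_left _ _
  have hρ1 : ρ ≤ r₁ := hρr.trans (min_le_left _ _)
  have hρ2 : ρ ≤ r₂ := hρr.trans ((min_le_right _ _).trans (min_le_left _ _))
  have hρ3 : ρ ≤ r₃ := hρr.trans ((min_le_right _ _).trans (min_le_right _ _))
  have hρM : ρ * M ≤ β * δ / 4 := by
    have h1 : ρ ≤ β * δ / (4 * M) := min_le_right _ _
    rw [le_div_iff₀ (by positivity)] at h1
    linarith
  have hδM : δ * M ≤ β / 4 := by
    have h1 : δ ≤ β / (4 * M) := min_le_right _ _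
    rw [le_div_iff₀ (by positivity)] at h1
    linarith
  have hδ1 : δ ≤ 1 := min_le_left _ _
  have hbound : ∀ K, partialNorm ρ K Y ≤ δ := by
    intro K
    induction K with
    | zero =>
      rw [partialNorm]
      simp [hY0, hδpos.le]
    | succ K ih =>
      have hWK : partialNorm ρ K W ≤ δ := (hWY ρ K hρpos.le).trans ih
      have h1 : partialNorm ρ K (P₁.eval W) ≤ M :=
        (hb₁ ρ hρpos.le hρ1 K W (hWK.trans hδ1)).trans (by rw [hM]; linarith)
      have h2 : partialNorm ρ K (Q₁.divX.eval W) ≤ M :=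
        (hb₂ ρ hρpos.le hρ2 K W (hWK.trans hδ1)).trans (by rw [hM]; linarith)
      have h3 : partialNorm ρ K q ≤ M := (hb₃ ρ hρpos.le hρ3 K).trans (by rw [hM]; linarith)
      have hZK : partialNorm ρ K Z ≤ ρ * M + δ * M := by
        refine (partialNorm_add hρpos.le K _ _).trans (add_le_add ?_ ?_)
        · exact (partialNorm_X_mul_le hρpos.le K q).trans
            (mul_le_mul_of_nonneg_left h3 hρpos.le)
        · exact (partialNorm_mul hρpos.le K _ _).trans
            (mul_le_mul hWK h2 (partialNorm_nonneg hρpos.le K _) hδpos.le)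
      have h4 : partialNorm ρ (K + 1) (PowerSeries.C b * Y) =
          β * partialNorm ρ (K + 1) Y := by
        rw [partialNorm, partialNorm, Finset.mul_sum]
        refine Finset.sum_congr rfl fun k _ => ?_
        rw [PowerSeries.coeff_C_mul, norm_mul, mul_assoc]
      have h5 : partialNorm ρ (K + 1) ((-1 : ℂ⟦X⟧) * (PowerSeries.X * P₁.eval W + Z * Y)) =
          partialNorm ρ (K + 1) (PowerSeries.X * P₁.eval W + Z * Y) := by
        rw [partialNorm, partialNorm]
        refine Finset.sum_congr rfl fun k _ => ?_
        rw [neg_one_mul, map_neg, norm_neg]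
      have h6 : β * partialNorm ρ (K + 1) Y ≤ ρ * M + (ρ * M + δ * M) * δ := by
        rw [← h4, heq, h5]
        refine (partialNorm_add hρpos.le _ _ _).trans (add_le_add ?_ ?_)
        · rw [partialNorm_X_mul]
          exact mul_le_mul_of_nonneg_left h1 hρpos.le
        · exact (partialNorm_mul_of_constantCoeff hρpos.le K _ _ hZ0 hY0).trans
            (mul_le_mul hZK ih (partialNorm_nonneg hρpos.le K _) (by positivity))
      have h7 : ρ * M * δ ≤ β * δ / 4 := by
        have : ρ * M * δ ≤ ρ * M * 1 := mul_le_mul_of_nonneg_left hδ1 (by positivity)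
        linarith
      have h8 : δ * M * δ ≤ β / 4 * δ := mul_le_mul_of_nonneg_right hδM hδpos.le
      have h9 : β * partialNorm ρ (K + 1) Y ≤ β * δ := by
        have : 0 ≤ β * δ := by positivity
        nlinarith
      exact le_of_mul_le_mul_left h9 hβpos
  have hWc : IsConvergent W := by
    refine ⟨ρ, hρpos, summable_of_sum_range_le (c := δ) (fun k => by positivity) fun K => ?_⟩
    refine le_trans ?_ ((hWY ρ K hρpos.le).trans (hbound K))
    rw [partialNorm, Finset.sum_range_succ]
    exact le_add_of_nonneg_right (by positivity)
  have hfW : f = W + PowerSeries.C u := by rw [hW]; ring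
  rw [hfW]
  exact hWc.add (isConvergent_C u)

namespace PlaneBranch

variable {C : PlaneBranch} {g' : ℕ}

/-! ### Convergence of the pullback of the form -/

lemma isConvergent_initialPart (C : PlaneBranch) (j : ℕ) : IsConvergent (C.initialPart j) :=
  isConvergent_of_coeff_eq_zero (C.β (j + 1)) fun k hk => by
    rw [coeff_initialPart, if_neg (not_lt.2 hk)]

lemma pt_mem_convergentPolys (C : PlaneBranch) (g' : ℕ) :
    C.pt Polynomial.C g' Polynomial.X ∈ convergentPolys := by
  rw [pt, ← Polynomial.C_pow]
  exact add_mem (C_mem_convergentPolys (C.isConvergent_initialPart g'))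
    (mul_mem X_mem_convergentPolys (C_mem_convergentPolys (isConvergent_X_pow _)))

lemma onFamily_mem_convergentPolys {H : Polynomial ℂ⟦X⟧} (hH : H ∈ convergentPolys) :
    C.onFamily g' H ∈ convergentPolys := by
  rw [onFamily, valueAt, Polynomial.coe_eval₂RingHom, Polynomial.eval₂_eq_sum_range]
  exact sum_mem fun k _ => mul_mem
    (C_mem_convergentPolys ((mem_convergentPolys.1 hH k).expand C.n_ne_zero))
    (pow_mem (C.pt_mem_convergentPolys g') k)

lemma onFamily_rootPoly_mem_convergentPolys (C : PlaneBranch) (g' i : ℕ) :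
    C.onFamily g' (C.rootPoly i) ∈ convergentPolys := by
  cases i with
  | zero =>
    refine onFamily_mem_convergentPolys (C_mem_convergentPolys ?_)
    have := isConvergent_X_pow 1
    rwa [pow_one] at this
  | succ j =>
    rw [rootPoly, onFamily, semirootPoly, valueAt_branchPoly _ _ C.n_ne_zero (C.e_pos j).ne'
      (C.n_div_e_ne_zero j) (Nat.mul_div_cancel' (C.e_dvd_n j)).symm]
    refine prod_mem fun α _ => sub_mem (C.pt_mem_convergentPolys g') (C_mem_convergentPolys ?_)
    refine isConvergent_of_coeff_eq_zero (C.β (j + 1)) fun k hk => ?_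
    rw [expand_truncated, coeff_initialPart, if_neg (not_lt.2 hk), zero_mul]

lemma tCoeff_mem_convergentPolys {H₁ H₂ : Polynomial ℂ⟦X⟧} (h₁ : H₁ ∈ convergentPolys)
    (h₂ : H₂ ∈ convergentPolys) (i : ℕ) : C.tCoeff g' i H₁ H₂ ∈ convergentPolys := by
  have hr := C.onFamily_rootPoly_mem_convergentPolys g'
  exact add_mem (mul_mem (onFamily_mem_convergentPolys h₁) (sub_mem
    (mul_mem (mul_mem (natCast_mem _ _) (hr i)) (coeffDeriv_mem_convergentPolys (hr _)))
    (mul_mem (mul_mem (natCast_mem _ _) (hr _)) (coeffDeriv_mem_convergentPolys (hr i)))))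
    (coeffDeriv_mem_convergentPolys (onFamily_mem_convergentPolys h₂))

lemma vCoeff_mem_convergentPolys {H₁ H₂ : Polynomial ℂ⟦X⟧} (h₁ : H₁ ∈ convergentPolys)
    (h₂ : H₂ ∈ convergentPolys) (i : ℕ) : C.vCoeff g' i H₁ H₂ ∈ convergentPolys := by
  have hr := C.onFamily_rootPoly_mem_convergentPolys g'
  exact add_mem (mul_mem (onFamily_mem_convergentPolys h₁) (sub_mem
    (mul_mem (mul_mem (natCast_mem _ _) (hr i)) (derivative_mem_convergentPolys (hr _)))
    (mul_mem (mul_mem (natCast_mem _ _) (hr _)) (derivative_mem_convergentPolys (hr i)))))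
    (derivative_mem_convergentPolys (onFamily_mem_convergentPolys h₂))

/-! ### The separatrices -/

lemma constantCoeff_pt (hg : C.g = g' + 1) (v : ℂ⟦X⟧) :
    PowerSeries.constantCoeff (C.pt (RingHom.id _) g' v) = 0 := by
  have h : C.β (g' + 1) ≠ 0 := (C.β_pos (by omega)).ne'
  rw [pt, map_add, RingHom.id_apply, C.constantCoeff_initialPart]
  simp [h]

lemma isConvergent_pt (C : PlaneBranch) (g' : ℕ) {v : ℂ⟦X⟧} (hv : IsConvergent v) :
    IsConvergent (C.pt (RingHom.id _) g' v) :=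
  (C.isConvergent_initialPart g').add (hv.mul (isConvergent_X_pow _))

/-- A member of the family is invariant under `ω` if and only if its parameter solves a differential
equation. -/
lemma pullForm_member (hg : C.g = g' + 1) {i : ℕ} (hi : i < C.g) (H₁ H₂ : Polynomial ℂ⟦X⟧)
    {ω : OneForm} (hω : ω = toSeries H₁ • C.basicForm i C.g + d (toSeries H₂)) (v : ℂ⟦X⟧) :
    (C.member g' v).pullForm ω = odeSide (C.tCoeff g' i H₁ H₂) (C.vCoeff g' i H₁ H₂) v := by
  have hX : PowerSeries.constantCoeff (PowerSeries.X ^ C.n : ℂ⟦X⟧) = 0 := by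
    simp [C.n_ne_zero]
  have hs : MvPowerSeries.HasSubst ![(PowerSeries.X ^ C.n : ℂ⟦X⟧), C.pt (RingHom.id _) g' v] :=
    hasSubst_pair hX (constantCoeff_pt hg v)
  have h := pullback_eq hg hi H₁ H₂ hω chainRule_id v
    (MvPowerSeries.substAlgHom (R := ℂ) hs).toRingHom (fun K => by
      change MvPowerSeries.substAlgHom hs (toSeries K) = _
      rw [MvPowerSeries.coe_substAlgHom]
      exact pull_toSeries C.n_ne_zero (constantCoeff_pt hg v) K)
  have h2 : ∀ G, (MvPowerSeries.substAlgHom (R := ℂ) hs).toRingHom G =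
      (C.member g' v).pull G := by
    intro G
    change MvPowerSeries.substAlgHom hs G = _
    rw [MvPowerSeries.coe_substAlgHom]
    rfl
  rw [h2, h2] at h
  refine h.trans ?_
  rw [RingHom.id_apply, PowerSeries.derivative_X, mul_one]
  rfl

/-- The members of the family pass through the same infinitely near points as the branch up to
the last blowing-up, where they are separated. -/
lemma LastStage.meetsTransversally (hg : C.g = g' + 1) {k : ℕ} (h : C.LastStage g' k 1)
    (v : ℂ⟦X⟧ˣ) : C.MeetsTransversally (C.member g' v) C.lastTriplePoint := by
  rw [h.lastTriplePoint_eq hg]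
  obtain ⟨hu, -, κ, κ', p, q, -, -, h⟩ := h
  refine ⟨fun j hj => hu.sameDir v j (by omega), Or.inl ?_⟩
  obtain ⟨x, z, hl, hx, hz⟩ := h (RingHom.id _) isSeriesRing_id v
  have hcurve := curve_of_lifts (fun j hj => hu.sameDir v j hj) hl
  have hd : (infPoint (C.member g' v) k).curve.dir =
      some (PowerSeries.constantCoeff (quot (x * z) x)) := by
    rw [hcurve, Param.dir, if_pos]
    simp only
    rw [PowerSeries.order_mul]
    exact le_self_add
  rw [infPoint_succ, InfPoint.blowUp_of_some hd, hcurve]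
  refine ⟨rfl, ?_⟩
  have := order_of_hasLead_unit hx
  simpa using this

/-- The series of the theorem is a member of the family, the parameter being
`u + ∑_{k > 0} s_k(u) t ^ k`. -/
lemma family_eq_member (hg : C.g = g' + 1) (s : ℕ → RatFunc ℂ) {u : ℂ}
    (hs : (s 0).eval (RingHom.id ℂ) u = u) :
    C.family (fun j => s (j - C.β C.g)) u =
      C.member g' (PowerSeries.mk fun k => (s k).eval (RingHom.id ℂ) u) := by
  rw [family, member, β_zero, Param.mk.injEq]
  refine ⟨rfl, ?_⟩
  ext k
  rw [pt, map_add, RingHom.id_apply, RingHom.id_apply, PowerSeries.coeff_mul_X_pow',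
    coeff_initialPart, PowerSeries.coeff_mk, hg]
  by_cases h : k < C.β (g' + 1)
  · rw [if_pos h, if_pos h, if_neg (not_le.2 h), add_zero]
  · rw [if_neg h, if_neg h, if_pos (not_lt.1 h), zero_add, PowerSeries.coeff_mk]
    split_ifs with h1
    · rw [h1, Nat.sub_self, hs]
    · rfl

/-- In the dicritical case the family contains, for every non-zero initial value of the
parameter, a separatrix, whose coefficients depend rationally on the initial value. -/
lemma exists_separatrices (hg : C.g = g' + 1) {i : ℕ} (hi : i < C.g) {H₁ H₂ : Polynomial ℂ⟦X⟧}
    (h₁ : H₁ ∈ convergentPolys) (h₂ : H₂ ∈ convergentPolys)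
    (hdeg₁ : H₁.natDegree < C.n) (hdeg₂ : H₂.natDegree < C.n) (hH₁ : H₁ ≠ 0)
    (hH₂ : MvPowerSeries.constantCoeff (toSeries H₂) = 0)
    {ω : OneForm} (hω : ω = toSeries H₁ • C.basicForm i C.g + d (toSeries H₂))
    (hlt : C.inter (toSeries H₁) + (C.v i : ℕ∞) + (C.v C.g : ℕ∞) < C.inter (toSeries H₂)) :
    ∃ s : ℕ → RatFunc ℂ,
      (∀ (j : ℕ) (u : ℂ), C.β C.g < j → u ≠ 0 → (s j).denom.eval u ≠ 0) ∧
      ∀ u : ℂ, u ≠ 0 → IsSeparatrix ω (C.family s u) ∧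
        C.MeetsTransversally (C.family s u) C.lastTriplePoint := by
  obtain ⟨k, a, hL⟩ := exists_lastStage C hg
  obtain rfl := hL.eq_one hg
  obtain ⟨κ, hκ, l, m, q, r, ⟨-, ht, hv⟩ | ⟨hn, -⟩⟩ :=
    tCoeff_vCoeff_cases hg hi hdeg₁ hdeg₂ hH₁ hH₂
  swap
  · exact absurd hlt hn
  have htc := tCoeff_mem_convergentPolys (C := C) (g' := g') h₁ h₂ i
  have hvc := vCoeff_mem_convergentPolys (C := C) (g' := g') h₁ h₂ i
  rw [ht] at htc
  rw [hv] at hvc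
  set Q : Polynomial ℂ⟦X⟧ := Polynomial.C (PowerSeries.C κ) * Polynomial.X ^ m +
    Polynomial.C PowerSeries.X * r with hQ
  have hQ0 : Q.map PowerSeries.constantCoeff = Polynomial.C κ * Polynomial.X ^ m := by
    rw [hQ]
    simp
  obtain ⟨s, hs⟩ := exists_rational_solution q Q hκ hQ0
  refine ⟨fun j => s (j - C.β C.g), fun j u _ hu => (hs u hu).1 _, fun u hu => ?_⟩
  obtain ⟨-, hs0, hode⟩ := hs u hu
  rw [family_eq_member hg s hs0]
  set V : ℂ⟦X⟧ := PowerSeries.mk fun k => (s k).eval (RingHom.id ℂ) u with hV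
  have hV0 : PowerSeries.constantCoeff V = u := by
    rw [← PowerSeries.coeff_zero_eq_constantCoeff_apply, hV, PowerSeries.coeff_mk, hs0]
  have hVc : IsConvergent V := by
    refine isConvergent_of_odeSide_eq_zero (mem_convergentPolys_of_X_pow_mul htc)
      (mem_convergentPolys_of_X_pow_mul hvc) hode ?_
    rw [hQ0, hV0]
    simp [hκ, hu]
  have hVu : IsUnit V := by
    rw [PowerSeries.isUnit_iff_constantCoeff, hV0]
    exact hu.isUnit
  refine ⟨⟨isConvergent_X_pow _, C.isConvergent_pt g' hVc, ?_, constantCoeff_pt hg V,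
    fun h => pow_ne_zero C.n PowerSeries.X_ne_zero h.1, ?_⟩, ?_⟩
  · simp [member, C.n_ne_zero]
  · rw [pullForm_member hg hi H₁ H₂ hω, ht, hv, odeSide, Polynomial.eval_mul,
      Polynomial.eval_mul, Polynomial.eval_pow, Polynomial.eval_C, mul_assoc, ← mul_add]
    rw [odeSide] at hode
    rw [hode, mul_zero]
  · obtain ⟨v, hv⟩ := hVu
    rw [← hv]
    exact hL.meetsTransversally hg v

end PlaneBranch

end PlaneFoliation

end

open PlaneFoliation in
theorem theorem3p2 (C : PlaneBranch) (i : ℕ) (hi : i < C.g)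
    (H₁ H₂ : Polynomial convergentSeries)
    (hdeg₁ : H₁.natDegree < C.v 0) (hdeg₂ : H₂.natDegree < C.v 0)
    (hH₁ : H₁ ≠ 0)
    (hH₂ : MvPowerSeries.constantCoeff (ofConv H₂) = 0)
    (ω : OneForm) (hω : ω = ofConv H₁ • C.basicForm i C.g + d (ofConv H₂))
    (hfol : IsSingularFoliation ω) :
    (C.IsDicriticalAt ω C.lastTriplePoint ↔
      C.inter (ofConv H₁) + (C.v i : ℕ∞) + (C.v C.g : ℕ∞) < C.inter (ofConv H₂)) ∧
    (C.inter (ofConv H₁) + (C.v i : ℕ∞) + (C.v C.g : ℕ∞) < C.inter (ofConv H₂) →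
      ∃ s : ℕ → RatFunc ℂ,
        (∀ (j : ℕ) (u : ℂ), C.β C.g < j → u ≠ 0 → (s j).denom.eval u ≠ 0) ∧
        ∀ u : ℂ, u ≠ 0 →
          IsSeparatrix ω (C.family s u) ∧
          C.MeetsTransversally (C.family s u) C.lastTriplePoint) := by
  obtain ⟨g', hg⟩ := Nat.exists_eq_succ_of_ne_zero (show C.g ≠ 0 by omega)
  have hinj : Function.Injective convergentSeries.subtype := Subtype.val_injective
  have hmem : ∀ H : Polynomial convergentSeries,
      H.map convergentSeries.subtype ∈ convergentPolys := fun H => by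
    rw [mem_convergentPolys]
    intro k
    rw [Polynomial.coeff_map]
    exact (H.coeff k).2
  rw [C.v_zero] at hdeg₁ hdeg₂
  have h₁ : (H₁.map convergentSeries.subtype).natDegree < C.n := by
    rwa [Polynomial.natDegree_map_eq_of_injective hinj]
  have h₂ : (H₂.map convergentSeries.subtype).natDegree < C.n := by
    rwa [Polynomial.natDegree_map_eq_of_injective hinj]
  have h₃ : H₁.map convergentSeries.subtype ≠ 0 := (Polynomial.map_ne_zero_iff hinj).2 hH₁
  exact ⟨PlaneBranch.isDicriticalAt_iff hg hi h₁ h₂ h₃ hH₂ hω,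
    PlaneBranch.exists_separatrices hg hi (hmem H₁) (hmem H₂) h₁ h₂ h₃ hH₂ hω⟩
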